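/- **Setting.** Let $d\in\mathbb N_0$, $\mathfrak h=L^2(\mathbb R^d;\mathbb C)$, $M=\sqrt{1-\Delta}$, $h=-\Delta+V$, where $V:\mathbb R^d\to\mathbb R$ is infinitesimally form-bounded with respect to $-\Delta$. Let $v:\mathbb R^d\to\mathbb R$ be even with $v^2\le CM^2$ (as quadratic forms) for some $C>0$. For an operator $A$ with kernel $A(x,y)$ write $\bar A$ for its complex conjugate, $A^T=\bar A^{*}$, $d(A)(x)=A(x,x)$, $(v\,\sharp\,A)(x,y)=v(x-y)A(x,y)$, and put $$b[\gamma]=v*d(\gamma)+v\,\sharp\,\gamma,\quad k[\sigma]=v\,\sharp\,\sigma,\quad h(\gamma)=h+b[\gamma],\quad \gamma^\phi=\gamma+|\phi\rangle\langle\phi|,\quad \sigma^\phi=\sigma+\phi\otimes\phi .$$ Let $\mathcal H^j=M^{-j}\mathcal L^1M^{-j}$ with norm $\|M^j\gamma M^j\|_{\mathcal L^1}$, let $H^j_s$ be the space of symmetric kernels $\sigma\in H^j(\mathbb R^{2d})$, and let $X^j$ be the set of $(\phi,\gamma,\sigma)\in H^j(\mathbb R^d)\times\mathcal H^j\times H^j_s$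 with $\gamma=\gamma^*$. Let $T>0$ and let $\rho_t=(\phi_t,\gamma_t,\sigma_t)\in C^0([0,T);X^3)\cap C^1([0,T);X^1)$ solve the HFB equations $$i\partial_t\phi_t=h(\gamma_t)\phi_t+k(t)\bar\phi_t,\qquad i\partial_t\gamma_t=[h(t),\gamma_t]+k(t)\sigma_t^*-\sigma_tk(t)^*,$$ $$i\partial_t\sigma_t=h(t)\sigma_t^T+\sigma_th(t)^T+k(t)\gamma_t^T+\gamma_tk(t)^T+k(t),$$ where $h(t)=h(\gamma_t^{\phi_t})$ and $k(t)=k[\sigma_t^{\phi_t}]$. The energy is $$\mathcal E(\phi,\gamma,\sigma)=\mathrm{Tr}[h(\gamma+|\phi\rangle\langle\phi|)]+\mathrm{Tr}[b[|\phi\rangle\langle\phi|]\gamma]+\tfrac12\mathrm{Tr}[b[\gamma]\gamma]+\tfrac12\int v(x-y)|\sigma(x,y)+\phi(x)\phi(y)|^2\,dx\,dy ,$$ with $\mathrm{Tr}[h\alpha]:=\mathrm{Tr}[(M^{-1}hM^{-1})(M\alpha M)]$ for $\alpha\in\mathcal H^1$. Let $0\le\gamma_0'\in\mathcal H^1$,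 $\mathcal S=\begin{pmatrix}1&0\\0&-1\end{pmatrix}$, and let $\mathcal U_t=\begin{pmatrix}u_t&v_t\\ \bar v_t&\bar u_t\end{pmatrix}$, $t\in[0,T)$, be bounded operators on $\mathfrak h\times\mathfrak h$ with $\mathcal U_t^*\mathcal S\,\mathcal U_t=\mathcal S=\mathcal U_t\,\mathcal S\,\mathcal U_t^*$, such that for $\mathcal U_t$ and for $\mathcal U_t^*$ the diagonal entries are bounded on $H^1$ and the off-diagonal entries are Hilbert–Schmidt on $H^1$, such that $t\mapsto\mathcal U_t^*$ is strongly continuous on $H^1\times H^1$ and satisfies, as operators $H^1\times H^1\to H^{-1}\times H^{-1}$, $$i\partial_t\,\mathcal U_t^*=\mathcal S\begin{pmatrix}h(t)&k(t)\\ \overline{k(t)}&\overline{h(t)}\end{pmatrix}\mathcal U_t^* ,$$ and such that $$\begin{pmatrix}\gamma_0&\sigma_0\\ \bar\sigma_0&1+\bar\gamma_0\end{pmatrix}=\mathcal U_0^*\begin{pmatrix}\gamma_0'&0\\0&1+\bar\gamma_0'\end{pmatrix}\mathcal U_0 .$$ For $\phi\in H^1$ and bounded $u,w$ such that $u^*$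 is bounded on $H^1$ and $wM$ is Hilbert–Schmidt on $\mathfrak h$, put $\gamma_{u,w}=u^*\gamma_0'u+w^T(1+\bar\gamma_0')\bar w$, $\sigma_{u,w}=u^*\gamma_0'w+w^T(1+\bar\gamma_0')\bar u$ and $$\mathcal H_{\gamma_0'}(\phi,u,w)=\langle\phi,h\phi\rangle+\mathrm{Tr}[\gamma_{u,w}(h+b[|\phi\rangle\langle\phi|])]+\tfrac12\mathrm{Tr}[\gamma_{u,w}\,b[\gamma_{u,w}]]+\tfrac12\mathrm{Tr}\big[k[\sigma_{u,w}+|\phi\rangle\langle\bar\phi|]\,(w^*\gamma_0'u+u^T(1+\bar\gamma_0')\bar w+|\bar\phi\rangle\langle\phi|)\big].$$ The partial derivatives are directional: $\partial\mathcal H_{\gamma_0'}/\partial\langle\phi|=a$ means $d\mathcal H_{\gamma_0'}[\eta]=2\,\mathrm{Re}\langle\eta,a\rangle$ for all $\eta\in H^1$, and $\partial\mathcal H_{\gamma_0'}/\partial u^*=A$ means that, for every direction $\delta u$ in the above class, $\delta u^*A$ is trace class on $H^1$ and $d\mathcal H_{\gamma_0'}[\delta u]=2\,\mathrm{Re}\,\mathrm{Tr}_{H^1}[\delta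 u^*A]$; likewise for $\partial\mathcal H_{\gamma_0'}/\partial v^*$, the derivative in the last argument $w$. **Proposition.** For every $t\in[0,T)$, $(\phi_t,u_t,v_t)$ is in the domain of $\mathcal H_{\gamma_0'}$, $$\mathcal E(\phi_t,\gamma_t,\sigma_t)=\mathcal H_{\gamma_0'}(\phi_t,u_t,v_t),$$ the time derivatives $\partial_tu_t,\partial_tv_t:H^1\to H^{-1}$ exist (tested on $H^1$), and $$\frac{\partial\mathcal H_{\gamma_0'}}{\partial\langle\phi|}(\phi_t,u_t,v_t)=i\partial_t\phi_t,$$ $$\frac{\partial\mathcal H_{\gamma_0'}}{\partial u^*}(\phi_t,u_t,v_t)=-\gamma_0'\,i\partial_tu_t+\tfrac12v_t\overline{k(t)},$$ $$\frac{\partial\mathcal H_{\gamma_0'}}{\partial v^*}(\phi_t,u_t,v_t)=\gamma_0'\,i\partial_tv_t+v_t\overline{h(t)}+\tfrac12u_tk(t).$$ Moreover the energy is conserved: $\mathcal E(\phi_t,\gamma_t,\sigma_t)=\mathcal E(\phi_0,\gamma_0,\sigma_0)$ for all $t\in[0,T)$. -/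

import Mathlib

open MeasureTheory Filter Topology
open scoped ENNReal ComplexInnerProductSpace Matrix

namespace HFB

noncomputable section

/-! ### Operators on `L²(ℝᵈ; ℂ)` -/

/-- Euclidean space `ℝᵈ`. -/
abbrev E (d : ℕ) : Type := EuclideanSpace ℝ (Fin d)

/-- The one-particle Hilbert space `L²(ℝᵈ; ℂ)`. -/
abbrev L2 (d : ℕ) : Type := Lp ℂ 2 (volume : Measure (E d))

/-- Bounded operators on `L²(ℝᵈ; ℂ)`; `*` is composition and `star` is the adjoint. -/
abbrev Op (d : ℕ) : Type := L2 d →L[ℂ] L2 d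

variable {d : ℕ}

theorem norm_star_L2 (f : L2 d) : ‖star f‖ = ‖f‖ := by
  simp only [Lp.norm_def]
  congr 1
  refine eLpNorm_congr_norm_ae ?_
  filter_upwards [Lp.coeFn_star f] with x hx
  rw [hx]
  simp

theorem star_add_L2 (f g : L2 d) : star (f + g) = star f + star g := by
  apply Lp.ext
  filter_upwards [Lp.coeFn_star (f + g), Lp.coeFn_star f, Lp.coeFn_star g, Lp.coeFn_add f g,
    Lp.coeFn_add (star f) (star g)] with x h1 h2 h3 h4 h5
  rw [h1, h5, Pi.star_apply, h4, Pi.add_apply, Pi.add_apply, h2, h3, Pi.star_apply,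
    Pi.star_apply, star_add]

theorem star_smul_L2 (c : ℂ) (f : L2 d) : star (c • f) = star c • star f := by
  apply Lp.ext
  filter_upwards [Lp.coeFn_star (c • f), Lp.coeFn_star f, Lp.coeFn_smul c f,
    Lp.coeFn_smul (star c) (star f)] with x h1 h2 h3 h4
  rw [h1, h4]
  simp [h2, h3]

/-- The complex conjugate `Ā = C A C` of an operator, `C` being complex conjugation. -/
def conj (A : Op d) : Op d :=
  LinearMap.mkContinuous
    { toFun := fun f => star (A (star f))
      map_add' := fun f g => by rw [star_add_L2, map_add, star_add_L2]
      map_smul' := fun c f => by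
        rw [star_smul_L2, map_smul, star_smul_L2, star_star, RingHom.id_apply] }
    ‖A‖ (fun f => by
      change ‖star (A (star f))‖ ≤ _
      rw [norm_star_L2, ← norm_star_L2 f]
      exact A.le_opNorm _)

/-- The transpose `Aᵀ = C A* C`. -/
def transp (A : Op d) : Op d := conj (star A)

/-- The rank-one operator `|f⟩⟨g|`. -/
def ketbra (f g : L2 d) : Op d := InnerProductSpace.rankOne ℂ f g

open Classical in
/-- Multiplication by the function `w` (`0` if this is not a bounded operator). -/
def mulOp (w : E d → ℂ) : Op d :=
  if h : ∃ A : Op d, ∀ f : L2 d, ⇑(A f) =ᵐ[volume] fun x => w x * f x then h.choose else 0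

/-- The operator `A` has the square-integrable integral kernel `K`. -/
def HasKernel (A : Op d) (K : E d × E d → ℂ) : Prop :=
  MemLp K 2 (volume.prod volume) ∧
    ∀ f : L2 d, ⇑(A f) =ᵐ[volume] fun x => ∫ y, K (x, y) * f y

open Classical in
/-- The integral kernel `A(x, y)` of a Hilbert-Schmidt operator. -/
def kernel (A : Op d) : E d × E d → ℂ :=
  if h : ∃ K, HasKernel A K then h.choose else 0

open Classical in
/-- The Hilbert-Schmidt operator with integral kernel `K`. -/
def opOfKernel (K : E d × E d → ℂ) : Op d :=
  if h : ∃ A, HasKernel A K then h.choose else 0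

/-- An orthonormal basis of `L²`. -/
def onb (d : ℕ) : HilbertBasis (exists_hilbertBasis ℂ (L2 d)).choose ℂ (L2 d) :=
  (exists_hilbertBasis ℂ (L2 d)).choose_spec.choose

/-- The trace of a trace-class operator. -/
def trace (A : Op d) : ℂ := ∑' i, ⟪onb d i, A (onb d i)⟫

/-- The trace norm, in its nuclear form: the infimum of `∑ ‖xᵢ‖ ‖yᵢ‖` over all
representations `A = ∑ |xᵢ⟩⟨yᵢ|`. It is finite exactly on the trace-class operators. -/
def traceNorm (A : Op d) : ℝ≥0∞ :=
  ⨅ (x : ℕ → L2 d) (y : ℕ → L2 d) (_ : ∀ f, HasSum (fun i => ⟪y i, f⟫ • x i) (A f)),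
    ∑' i, ‖x i‖ₑ * ‖y i‖ₑ

/-- The Hilbert-Schmidt norm. It is finite exactly on the Hilbert-Schmidt operators. -/
def hsNorm (A : Op d) : ℝ≥0∞ := (∑' i, ‖A (onb d i)‖ₑ ^ 2) ^ (1 / 2 : ℝ)

/-! ### Sobolev weights

`M = √(1 - Δ)` and `J = M⁻¹`. An operator `T : H¹ → H⁻¹` is represented by the operator
`M⁻¹ T M⁻¹ = J T J` on `L²`. -/

/-- `J = M⁻¹ = (1 - Δ)^(-1/2)`, the Fourier multiplier `(1 + |2πξ|²)^(-1/2)`. -/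
def J (d : ℕ) : Op d :=
  ((Lp.fourierTransformₗᵢ (E d) ℂ).symm.toContinuousLinearEquiv : Op d) *
    mulOp (fun ξ : E d => (((1 + (2 * Real.pi * ‖ξ‖) ^ 2) ^ (-(1 / 2) : ℝ) : ℝ) : ℂ)) *
      ((Lp.fourierTransformₗᵢ (E d) ℂ).toContinuousLinearEquiv : Op d)

open Classical in
/-- `M f` for `f ∈ H¹` (`0` otherwise). -/
def Mvec (f : L2 d) : L2 d := if h : ∃ g, f = J d g then h.choose else 0

open Classical in
/-- `Mⁱ A Mʲ` for `A ∈ M⁻ⁱ 𝓑 M⁻ʲ` (`0` otherwise). -/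
def weight (i j : ℕ) (A : Op d) : Op d :=
  if h : ∃ B, A = J d ^ i * B * J d ^ j then h.choose else 0

/-- The norm of `Hʲ(ℝᵈ)`. -/
def sobolevNorm (j : ℕ) (f : L2 d) : ℝ≥0∞ := ⨅ (g : L2 d) (_ : f = (J d ^ j) g), ‖g‖ₑ

/-- The norm `‖Mʲ γ Mʲ‖₁` of `𝓗ʲ = M⁻ʲ 𝓛¹ M⁻ʲ`. -/
def calHNorm (j : ℕ) (A : Op d) : ℝ≥0∞ :=
  ⨅ (B : Op d) (_ : A = J d ^ j * B * J d ^ j), traceNorm B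

/-- The norm `‖(M² ⊗ 1 + 1 ⊗ M²)^(j/2) σ‖` of `Hʲ(ℝᵈ × ℝᵈ)`, an operator being identified
with its kernel; its square is `∑ᵢ (j choose i) ‖Mⁱ σ Mʲ⁻ⁱ‖₂²`. -/
def sobolevNorm₂ (j : ℕ) (A : Op d) : ℝ≥0∞ :=
  (∑ i ∈ Finset.range (j + 1), (j.choose i : ℝ≥0∞) *
    (⨅ (B : Op d) (_ : A = J d ^ i * B * J d ^ (j - i)), hsNorm B) ^ 2) ^ (1 / 2 : ℝ)

/-! ### The spaces `Xʲ` -/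

/-- Triples `ρ = (φ, γ, σ)`. -/
abbrev State (d : ℕ) : Type := L2 d × Op d × Op d

/-- The norm of `Xʲ`. -/
def normX (j : ℕ) (ρ : State d) : ℝ≥0∞ :=
  sobolevNorm j ρ.1 + calHNorm j ρ.2.1 + sobolevNorm₂ j ρ.2.2

/-- Membership in `Xʲ`: finite norm, `γ = γ*`, and `σ(x, y) = σ(y, x)`. -/
def MemX (j : ℕ) (ρ : State d) : Prop :=
  normX j ρ < ⊤ ∧ star ρ.2.1 = ρ.2.1 ∧ transp ρ.2.2 = ρ.2.2

/-- `ρ ∈ C⁰([0, T); Xʲ)`. -/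
def ContX (j : ℕ) (T : ℝ) (ρ : ℝ → State d) : Prop :=
  ∀ t ∈ Set.Ico 0 T, MemX j (ρ t) ∧
    Tendsto (fun s => normX j (ρ s - ρ t)) (𝓝[Set.Ico 0 T] t) (𝓝 0)

/-- `ρ' = ∂ₜρ` on `[0, T)` in the norm of `Xʲ`. -/
def HasDerivX (j : ℕ) (T : ℝ) (ρ ρ' : ℝ → State d) : Prop :=
  ∀ t ∈ Set.Ico 0 T,
    Tendsto (fun s => normX j ((s - t)⁻¹ • (ρ s - ρ t) - ρ' t)) (𝓝[Set.Ico 0 T \ {t}] t) (𝓝 0)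

/-! ### Potentials -/

/-- `V` is infinitesimally form-bounded with respect to `-Δ`. With `f = J g ∈ H¹` one has
`⟨f, -Δ f⟩ = ‖g‖² - ‖f‖²`. -/
def InfFormBounded (V : E d → ℝ) : Prop :=
  (∀ g : L2 d, Integrable (fun x => V x * ‖J d g x‖ ^ 2)) ∧
    ∀ ε > 0, ∃ C : ℝ, ∀ g : L2 d,
      |∫ x, V x * ‖J d g x‖ ^ 2| ≤ ε * (‖g‖ ^ 2 - ‖J d g‖ ^ 2) + C * ‖J d g‖ ^ 2

/-- `v² ≤ C M²` as quadratic forms, for some `C`. -/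
def SqLeM (v : E d → ℝ) : Prop :=
  ∃ C : ℝ, ∀ g : L2 d,
    ∫⁻ x, ENNReal.ofReal (v x ^ 2) * ‖J d g x‖ₑ ^ 2 ≤ ENNReal.ofReal C * ‖g‖ₑ ^ 2

open Classical in
/-- `M⁻¹ V M⁻¹` for a form-bounded `V`, defined through its sesquilinear form. -/
def potOp (V : E d → ℝ) : Op d :=
  if h : ∃ A : Op d, ∀ f g : L2 d,
      ⟪f, A g⟫ = ∫ x, (V x : ℂ) * (starRingEnd ℂ (J d f x) * J d g x)
    then h.choose else 0

/-- `M⁻¹ h M⁻¹` for `h = -Δ + V`; note that `M⁻¹ (-Δ) M⁻¹ = 1 - M⁻²`. -/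
def hOp (V : E d → ℝ) : Op d := 1 - J d ^ 2 + potOp V

open Classical in
/-- The density `d(γ)(x) = γ(x, x)` of a trace-class operator: the integrable function with
`∫_A d(γ) = Tr[1_A γ]` for all measurable `A`. -/
def density (γ : Op d) : E d → ℂ :=
  if h : ∃ n : E d → ℂ, Integrable n ∧ ∀ A : Set (E d), MeasurableSet A →
      ∫ x in A, n x = trace (mulOp (A.indicator fun _ => 1) * γ)
    then h.choose else 0

/-- `v ♯ α`, the operator with kernel `v(x - y) α(x, y)`. -/
def sharp (v : E d → ℝ) (α : Op d) : Op d :=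
  opOfKernel fun p => (v (p.1 - p.2) : ℂ) * kernel α p

/-- `b[γ] = v * d(γ) + v ♯ γ`. -/
def b (v : E d → ℝ) (γ : Op d) : Op d :=
  mulOp (fun x => ∫ y, (v (x - y) : ℂ) * density γ y) + sharp v γ

/-- `k[σ] = v ♯ σ`. -/
def k (v : E d → ℝ) (σ : Op d) : Op d := sharp v σ

/-- `M⁻¹ h(γ) M⁻¹` for `h(γ) = h + b[γ]`. -/
def hγOp (V v : E d → ℝ) (γ : Op d) : Op d := hOp V + J d * b v γ * J d

/-- `γ^φ = γ + |φ⟩⟨φ|`. -/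
def γφ (φ : L2 d) (γ : Op d) : Op d := γ + ketbra φ φ

/-- `σ^φ = σ + φ ⊗ φ`. -/
def σφ (φ : L2 d) (σ : Op d) : Op d := σ + ketbra φ (star φ)

/-! ### The HFB equations and the energy -/

/-- The HFB equations at one time for `ρ = (φ, γ, σ)` with time derivative `ρ'`, as identities
in `H⁻¹` and between operators `H¹ → H⁻¹`, respectively:
`i∂ₜφ = h(γ)φ + k(σ^φ)φ̄`,
`i∂ₜγ = [h(γ^φ), γ] + k(σ^φ)σ* - σ k(σ^φ)*`,
`i∂ₜσ = h(γ^φ)σᵀ + σ h(γ^φ)ᵀ + k(σ^φ)γᵀ + γ k(σ^φ)ᵀ + k(σ^φ)`. -/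
def HFBEq (V v : E d → ℝ) (ρ ρ' : State d) : Prop :=
  let φ := ρ.1
  let γ := ρ.2.1
  let σ := ρ.2.2
  let H := hγOp V v (γφ φ γ)
  let K := k v (σφ φ σ)
  Complex.I • J d ρ'.1 = hγOp V v γ (Mvec φ) + J d (K (star φ)) ∧
  Complex.I • (J d * ρ'.2.1 * J d) =
    H * (weight 1 0 γ * J d) - (J d * weight 0 1 γ) * H
      + J d * (K * star σ - σ * star K) * J d ∧
  Complex.I • (J d * ρ'.2.2 * J d) =
    H * (weight 1 0 (transp σ) * J d) + (J d * weight 0 1 σ) * transp H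
      + J d * (K * transp γ + γ * transp K + K) * J d

/-- `ρ ∈ C⁰([0, T); X³) ∩ C¹([0, T); X¹)` is a classical solution of the HFB equations,
with time derivative `ρ'`. -/
structure IsClassicalSolution (V v : E d → ℝ) (T : ℝ) (ρ ρ' : ℝ → State d) : Prop where
  cont : ContX 3 T ρ
  cont_deriv : ContX 1 T ρ'
  hasDeriv : HasDerivX 1 T ρ ρ'
  eqn : ∀ t ∈ Set.Ico 0 T, HFBEq V v (ρ t) (ρ' t)

/-- The energy
`Tr[h(γ + |φ⟩⟨φ|)] + Tr[b[|φ⟩⟨φ|]γ] + ½ Tr[b[γ]γ] + ½ ∫ v(x-y) |σ(x,y) + φ(x)φ(y)|² dx dy`,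
where `Tr[hα]` means `Tr[(M⁻¹ h M⁻¹)(M α M)]`. -/
def energy (V v : E d → ℝ) (ρ : State d) : ℂ :=
  trace (hOp V * weight 1 1 (γφ ρ.1 ρ.2.1)) + trace (b v (ketbra ρ.1 ρ.1) * ρ.2.1)
    + 1 / 2 * trace (b v ρ.2.1 * ρ.2.1)
    + 1 / 2 * ((∫ p : E d × E d,
        v (p.1 - p.2) * ‖kernel ρ.2.2 p + ρ.1 p.1 * ρ.1 p.2‖ ^ 2 : ℝ) : ℂ)

/-! ### Symplectomorphisms -/

/-- The block operator with rows `(u, v)` and `(v̄, ū)` on `L² × L²`. -/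
def blockU (u v : Op d) : Matrix (Fin 2) (Fin 2) (Op d) := !![u, v; conj v, conj u]

/-- `𝒮 = diag(1, -1)`. -/
def S (d : ℕ) : Matrix (Fin 2) (Fin 2) (Op d) := !![1, 0; 0, -1]

/-- `𝒰* 𝒮 𝒰 = 𝒮` and `𝒰 𝒮 𝒰* = 𝒮`. -/
def IsSymplecto (U : Matrix (Fin 2) (Fin 2) (Op d)) : Prop :=
  Uᴴ * S d * U = S d ∧ U * S d * Uᴴ = S d

/-- The block operator with rows `(a, b)` and `(b̄, ā)` is in `𝓗^{∞,2}`: `a` is bounded on `H¹`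
and `b` is Hilbert-Schmidt on `H¹`. -/
def MemHinf2 (a b : Op d) : Prop :=
  (∃ A, a * J d = J d * A) ∧ ∃ B, hsNorm B < ⊤ ∧ b * J d = J d * B

/-- `Γ`, with rows `(γ, σ)` and `(σ̄, 1 + γ̄)`. -/
def Gam (γ σ : Op d) : Matrix (Fin 2) (Fin 2) (Op d) := !![γ, σ; conj σ, 1 + conj γ]

/-- `M⁻¹ Λ M⁻¹`, where `Λ` has the rows `(h(γ^φ), k(σ^φ))` and their complex conjugates in
reverse order. -/
def lamOp (V v : E d → ℝ) (ρ : State d) : Matrix (Fin 2) (Fin 2) (Op d) :=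
  let H := hγOp V v (γφ ρ.1 ρ.2.1)
  let K := k v (σφ ρ.1 ρ.2.2)
  !![H, J d * K * J d; J d * conj K * J d, conj H]

/-- `∂ₜA = Ȧ` at time `t`, in the sense of operators `H¹ → H⁻¹` tested on `H¹`, where
`D = M⁻¹ Ȧ M⁻¹`. -/
def HasFormDeriv (T : ℝ) (A : ℝ → Op d) (D : Op d) (t : ℝ) : Prop :=
  ∀ f g : L2 d, HasDerivWithinAt (fun s => ⟪J d g, A s (J d f)⟫) ⟪g, D f⟫ (Set.Ico 0 T) t

/-- `M U* M⁻¹`, entrywise. -/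
def conjWeight (U : Matrix (Fin 2) (Fin 2) (Op d)) : Matrix (Fin 2) (Fin 2) (Op d) :=
  fun i j => weight 1 0 (Uᴴ i j * J d)

/-- A family of symplectomorphisms `𝒰ₜ` with entries `uₜ, vₜ`, in `𝓗^{∞,2}` together with its
adjoints, strongly continuous on `H¹ × H¹`, with `i∂ₜ𝒰ₜ* = 𝒮 Λₜ 𝒰ₜ*` in the sense of operators
`H¹ × H¹ → H⁻¹ × H⁻¹`, and with `Γ₀ = 𝒰₀* diag(γ₀', 1 + γ̄₀') 𝒰₀` at time `0`. -/
structure IsDiagonalizingFamily (V v : E d → ℝ) (T : ℝ) (ρ : ℝ → State d) (γ₀ : Op d)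
    (u w : ℝ → Op d) : Prop where
  symplecto : ∀ t ∈ Set.Ico 0 T, IsSymplecto (blockU (u t) (w t))
  mem : ∀ t ∈ Set.Ico 0 T, MemHinf2 (u t) (w t)
  mem_adjoint : ∀ t ∈ Set.Ico 0 T, MemHinf2 (star (u t)) (transp (w t))
  cont : ∀ i j, ∀ f : L2 d,
    ContinuousOn (fun t => conjWeight (blockU (u t) (w t)) i j f) (Set.Ico 0 T)
  evol : ∀ t ∈ Set.Ico 0 T, ∀ i j,
    HasFormDeriv T (fun s => (blockU (u s) (w s))ᴴ i j)
      ((-Complex.I) • (S d * lamOp V v (ρ t) * conjWeight (blockU (u t) (w t))) i j) t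
  initial : Gam (ρ 0).2.1 (ρ 0).2.2 = (blockU (u 0) (w 0))ᴴ * Gam γ₀ 0 * blockU (u 0) (w 0)

/-! ### The quasi-Hamiltonian functional and its partial derivatives -/

/-- `u* γ₀' u + wᵀ (1 + γ̄₀') w̄`. -/
def gamOf (γ₀ u w : Op d) : Op d := star u * γ₀ * u + transp w * (1 + conj γ₀) * conj w

/-- `u* γ₀' w + wᵀ (1 + γ̄₀') ū`. -/
def sigOf (γ₀ u w : Op d) : Op d := star u * γ₀ * w + transp w * (1 + conj γ₀) * conj u

/-- The functional `𝓗_{γ₀'}(φ, u, w)`. -/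
def ham (V v : E d → ℝ) (γ₀ : Op d) (φ : L2 d) (u w : Op d) : ℂ :=
  ⟪Mvec φ, hOp V (Mvec φ)⟫
    + (trace (weight 1 1 (gamOf γ₀ u w) * hOp V)
      + trace (gamOf γ₀ u w * b v (ketbra φ φ)))
    + 1 / 2 * trace (gamOf γ₀ u w * b v (gamOf γ₀ u w))
    + 1 / 2 * trace (k v (sigOf γ₀ u w + ketbra φ (star φ)) *
        (star w * γ₀ * u + transp u * (1 + conj γ₀) * conj w + ketbra (star φ) φ))

/-- Admissible `u`: the adjoint `u*` is bounded on `H¹`. -/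
def AdmU (u : Op d) : Prop := ∃ B, star u * J d = J d * B

/-- Admissible `w`: `w M` is Hilbert-Schmidt on `L²`, that is, the kernel `w(x, y)` has square
integrable first derivatives in `y`. -/
def AdmW (w : Op d) : Prop := ∃ B, hsNorm B < ⊤ ∧ w = B * J d

/-- `∂F/∂⟨φ| = a` at `φ`: `dF(φ)[η] = 2 Re ⟨η, a⟩` for all directions `η ∈ H¹`. -/
def HasGradKet (F : L2 d → ℂ) (φ a : L2 d) : Prop :=
  ∀ η : L2 d, sobolevNorm 1 η < ⊤ →
    HasDerivAt (fun ε : ℝ => F (φ + (ε : ℂ) • η)) ((2 * (⟪η, a⟫).re : ℝ) : ℂ) 0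

/-- `∂F/∂u* = A` at `u`, where `A : H¹ → L²` is given through `AJ = A M⁻¹`: for all directions
`δ` in the class `Adm`, `δ*A` is trace class on `H¹` and `dF(u)[δ] = 2 Re Tr[δ* A]`. The trace on
`H¹` is computed as that of `M δ* A M⁻¹` on `L²`. -/
def HasGradAdj (Adm : Op d → Prop) (F : Op d → ℂ) (u AJ : Op d) : Prop :=
  ∀ δ : Op d, Adm δ → ∃ B : Op d, traceNorm B < ⊤ ∧ star δ * AJ = J d * B ∧
    HasDerivAt (fun ε : ℝ => F (u + (ε : ℂ) • δ)) ((2 * (trace B).re : ℝ) : ℂ) 0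

end

end HFB

open MeasureTheory Filter Topology
open scoped ENNReal ComplexInnerProductSpace Matrix

namespace HFB

noncomputable section

variable {d : ℕ}

/-! ### Complex conjugation on `L²` -/

/-! Everything unbounded is removed by the weight `J` = M⁻¹. A state is encoded by f = Mφ, a = MγM
(trace class) and x = Mσ (Hilbert-Schmidt), and an operator T : H¹ → H⁻¹ by the bounded operator
JTJ. The bound v² ≤ CM², which is translation invariant because M is, makes b[JaJ] bounded and v ♯
(Jx) Hilbert-Schmidt. In these variables the energy is a continuous polynomial, `energyForm`, in a +
|f⟩⟨f|, |f⟩⟨f| and x + |f⟩⟨φ̄| (`PotBound.energy_eq`). The functional `ham` is the same polynomial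
as soon as γ_{u,w} = γ and σ_{u,w} = σ (`PotBound.ham_eq`).

Equality of energy and functional. The equations for γ and σ and their conjugates are the entries of
iΓ̇ = 𝒮ΛΓ − ΓΛ𝒮 (`IsLift.gam_eqn`). Together with i∂ₜ𝒰* = 𝒮Λ𝒰* this makes 𝒰𝒮Γ𝒮𝒰* constant in time,
and the symplectic relations turn the constancy into Γₜ = 𝒰ₜ* diag(γ₀', 1 + γ̄₀') 𝒰ₜ
(`IsLift.gam_eq`). The time derivatives exist only as forms on H¹. The product rule survives because
Γ preserves H¹ and weakly convergent difference quotients may be paired with strongly convergent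
vectors (`hasDerivWithinAt_sandwich`). Positivity of γ₀' gives ‖v̄f‖² ≤ ⟨f, γf⟩, hence vM is
Hilbert-Schmidt (`exists_hs_mul_J`).

Gradients. By the symmetry of the two interaction forms, the derivative of the energy is Tr[h(γ^φ)
δγ] + Re Tr[k (δσ)*] + 2 Re⟨δφ, h(γ)φ + kφ̄⟩ (`hasDerivWithinAt_energy`). For a direction in u or v,
δγ and δσ are explicit, and cyclicity and transposition of the trace bring the result to the form 2
Re Tr[δ*A]. The adjoint of the equation for 𝒰* identifies A with the time derivatives of u and v.

Conservation. The φ-term is Re⟨φ̇, iφ̇⟩ = 0. Formally Tr[h[h, γ]] = 0 and the remaining terms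
cancel, but h is only a form, so hγ and hσ need not make sense in the required classes. Two devices
repair this. First, the σ-equation says that hσ + σh̄ is Hilbert-Schmidt; after a shift making h
positive, the two summands have a nonnegative Hilbert-Schmidt pairing, so each is Hilbert-Schmidt by
itself (`IsResolvent.exists_J_mul`). Second, with the resolvents Q = (n+1)(n+1+h+c)⁻¹ the bounded
operator QhQ satisfies Tr[QhQ [h, γ]] = 0 rigorously, and n → ∞ gives the missing identity
(`IsResolvent.trace_H_mul`). -/

theorem inner_star_star (f g : L2 d) : ⟪star f, star g⟫ = ⟪g, f⟫ := by
  rw [L2.inner_def, L2.inner_def]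
  refine integral_congr_ae ?_
  filter_upwards [Lp.coeFn_star f, Lp.coeFn_star g] with x h1 h2
  rw [h1, h2]
  simp [mul_comm]

theorem inner_star_left (f g : L2 d) : ⟪star f, g⟫ = ⟪star g, f⟫ := by
  rw [← inner_star_star, star_star]

theorem conj_apply (A : Op d) (f : L2 d) : conj A f = star (A (star f)) := rfl

theorem transp_apply (A : Op d) (f : L2 d) : transp A f = star (star A (star f)) := rfl

theorem star_sub_L2 (f g : L2 d) : star (f - g) = star f - star g := by
  rw [sub_eq_add_neg, star_add_L2, sub_eq_add_neg, ← neg_one_smul ℂ g, star_smul_L2]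
  simp

theorem inner_adj (A : Op d) (f g : L2 d) : ⟪star A f, g⟫ = ⟪f, A g⟫ :=
  ContinuousLinearMap.adjoint_inner_left A g f

theorem inner_adj' (A : Op d) (f g : L2 d) : ⟪f, star A g⟫ = ⟪A f, g⟫ :=
  ContinuousLinearMap.adjoint_inner_right A f g

theorem conj_add (A B : Op d) : conj (A + B) = conj A + conj B := by
  ext1 f
  simp [conj_apply, star_add_L2]

theorem conj_smul (c : ℂ) (A : Op d) : conj (c • A) = star c • conj A := by
  ext1 f
  simp [conj_apply, star_smul_L2]

theorem conj_neg (A : Op d) : conj (-A) = -conj A := by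
  rw [← neg_one_smul ℂ A, conj_smul]
  simp

theorem conj_sub (A B : Op d) : conj (A - B) = conj A - conj B := by
  rw [sub_eq_add_neg, conj_add, conj_neg, ← sub_eq_add_neg]

theorem conj_mul (A B : Op d) : conj (A * B) = conj A * conj B := by
  ext1 f
  simp [conj_apply]

@[simp] theorem conj_one : conj (1 : Op d) = 1 := by
  ext1 f
  simp [conj_apply]

@[simp] theorem conj_zero : conj (0 : Op d) = 0 := by
  simpa using conj_smul 0 (0 : Op d)

@[simp] theorem conj_conj (A : Op d) : conj (conj A) = A := by
  ext1 f
  simp [conj_apply]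

theorem star_conj (A : Op d) : star (conj A) = conj (star A) := by
  ext1 f
  refine ext_inner_left ℂ fun g => ?_
  rw [inner_adj', conj_apply, conj_apply, inner_star_left, ← inner_adj, ← inner_star_star, star_star]

theorem transp_eq (A : Op d) : transp A = star (conj A) := (star_conj A).symm

theorem star_transp (A : Op d) : star (transp A) = conj A := by rw [transp_eq, star_star]

theorem conj_transp (A : Op d) : conj (transp A) = star A := conj_conj _

theorem transp_conj (A : Op d) : transp (conj A) = star A := by rw [transp_eq, conj_conj]

@[simp] theorem transp_transp (A : Op d) : transp (transp A) = A := by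
  rw [transp, star_transp, conj_conj]

theorem transp_mul (A B : Op d) : transp (A * B) = transp B * transp A := by
  rw [transp, star_mul, conj_mul]; rfl

theorem transp_add (A B : Op d) : transp (A + B) = transp A + transp B := by
  rw [transp, star_add, conj_add]; rfl

theorem transp_smul (c : ℂ) (A : Op d) : transp (c • A) = c • transp A := by
  rw [transp, star_smul, conj_smul, star_star]; rfl

theorem norm_conj_le (A : Op d) : ‖conj A‖ ≤ ‖A‖ :=
  LinearMap.mkContinuous_norm_le _ (norm_nonneg _) _

theorem norm_conj (A : Op d) : ‖conj A‖ = ‖A‖ :=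
  le_antisymm (norm_conj_le A) (by simpa using norm_conj_le (conj A))

theorem enorm_star_L2 (f : L2 d) : ‖star f‖ₑ = ‖f‖ₑ := by
  rw [← ofReal_norm, norm_star_L2, ofReal_norm]

theorem ketbra_apply (f g h : L2 d) : ketbra f g h = ⟪g, h⟫ • f := by
  simp [ketbra, InnerProductSpace.rankOne_apply]

theorem star_ketbra (f g : L2 d) : star (ketbra f g) = ketbra g f := by
  ext1 h
  refine ext_inner_left ℂ fun l => ?_
  rw [inner_adj', ketbra_apply, ketbra_apply, inner_smul_left, inner_smul_right,
    inner_conj_symm, mul_comm]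

theorem conj_ketbra (f g : L2 d) : conj (ketbra f g) = ketbra (star f) (star g) := by
  ext1 h
  rw [conj_apply, ketbra_apply, ketbra_apply, star_smul_L2]
  congr 1
  rw [← inner_conj_symm, starRingEnd_apply, star_star, inner_star_left]

theorem transp_ketbra (f g : L2 d) : transp (ketbra f g) = ketbra (star g) (star f) := by
  rw [transp, star_ketbra, conj_ketbra]

theorem mul_ketbra (A : Op d) (f g : L2 d) : A * ketbra f g = ketbra (A f) g := by
  ext1 h
  simp [ketbra_apply]

theorem ketbra_mul (A : Op d) (f g : L2 d) : ketbra f g * A = ketbra f (star A g) := by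
  ext1 h
  simp [ketbra_apply, inner_adj]

theorem ketbra_add_left (f f' g : L2 d) : ketbra (f + f') g = ketbra f g + ketbra f' g := by
  ext1 h
  simp [ketbra_apply]

theorem ketbra_smul_left (c : ℂ) (f g : L2 d) : ketbra (c • f) g = c • ketbra f g := by
  ext1 h
  simp [ketbra_apply, smul_smul, mul_comm]

theorem ketbra_smul_right (c : ℂ) (f g : L2 d) : ketbra f (c • g) = star c • ketbra f g := by
  ext1 h
  simp [ketbra_apply, inner_smul_left, smul_smul]

/-! ### Hilbert-Schmidt operators -/

/-- The index set of the basis `onb d`. -/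
abbrev Idx (d : ℕ) : Type := ↥(exists_hilbertBasis ℂ (L2 d)).choose

instance : SecondCountableTopology (L2 d) := by
  have : Fact ((2 : ℝ≥0∞) ≠ ⊤) := ⟨by simp⟩
  infer_instance

/-- Basis vectors lie at distance √2, so balls of radius 1/2 around them are disjoint open sets in a
separable space. Countability is needed because `traceNorm` admits only sequences, while products of
Hilbert-Schmidt operators are expanded along the basis. -/
instance : Countable (Idx d) := by
  have ho : Orthonormal ℂ (fun i => onb d i) := (onb d).orthonormal
  refine Pairwise.countable_of_isOpen_disjoint (s := fun i : Idx d => Metric.ball (onb d i) (1 / 2))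
    ?_ (fun i => Metric.isOpen_ball) (fun i => ⟨onb d i, Metric.mem_ball_self (by norm_num)⟩)
  intro i j hij
  refine Metric.ball_disjoint_ball ?_
  have h2 : ‖onb d i - onb d j‖ ^ 2 = 2 := by
    have h0 : ⟪onb d i, onb d j⟫ = 0 := ho.2 hij
    have hi : ‖onb d i‖ = 1 := ho.1 i
    have hj : ‖onb d j‖ = 1 := ho.1 j
    rw [@norm_sub_sq ℂ, h0, hi, hj]
    norm_num
  rw [dist_eq_norm]
  nlinarith [norm_nonneg (onb d i - onb d j)]

theorem tsum_mul_le_sqrt {ι : Type*} (a c : ι → ℝ≥0∞) :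
    ∑' i, a i * c i ≤ (∑' i, a i ^ 2) ^ (1 / 2 : ℝ) * (∑' i, c i ^ 2) ^ (1 / 2 : ℝ) := by
  let _ : MeasurableSpace ι := ⊤
  have := ENNReal.lintegral_mul_le_Lp_mul_Lq (μ := (Measure.count : Measure ι))
    (p := 2) (q := 2) (Real.HolderConjugate.two_two) (f := a) (g := c)
    (Measurable.aemeasurable (fun _ _ => trivial)) (Measurable.aemeasurable (fun _ _ => trivial))
  simpa [lintegral_count] using this

theorem hasSum_normSq_onb (x : L2 d) : HasSum (fun i => ‖⟪onb d i, x⟫‖ ^ 2) (‖x‖ ^ 2) := by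
  have h := (onb d).hasSum_inner_mul_inner x x
  have h2 := Complex.hasSum_re h
  rw [inner_self_eq_norm_sq_to_K] at h2
  convert h2 using 1
  · ext i
    rw [← inner_conj_symm x, ← Complex.normSq_eq_conj_mul_self, Complex.normSq_eq_norm_sq]
    exact (Complex.ofReal_re _).symm
  · norm_cast

theorem tsum_enorm_inner_onb (x : L2 d) : ∑' i, ‖⟪onb d i, x⟫‖ₑ ^ 2 = ‖x‖ₑ ^ 2 := by
  have h := hasSum_normSq_onb x
  have := ENNReal.ofReal_tsum_of_nonneg (fun i => by positivity) h.summable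
  rw [h.tsum_eq] at this
  simp_rw [← ofReal_norm, ← ENNReal.ofReal_pow (norm_nonneg _)]
  exact this.symm

theorem enorm_inner_le (x y : L2 d) : ‖⟪x, y⟫‖ₑ ≤ ‖x‖ₑ * ‖y‖ₑ := by
  rw [← ofReal_norm, ← ofReal_norm x, ← ofReal_norm y, ← ENNReal.ofReal_mul (norm_nonneg _)]
  exact ENNReal.ofReal_le_ofReal (norm_inner_le_norm x y)

theorem enorm_inner_comm (x y : L2 d) : ‖⟪x, y⟫‖ₑ = ‖⟪y, x⟫‖ₑ := by
  rw [← ofReal_norm, norm_inner_symm, ofReal_norm]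

theorem tsum_enorm_inner_onb' (x : L2 d) : ∑' i, ‖⟪x, onb d i⟫‖ₑ ^ 2 = ‖x‖ₑ ^ 2 := by
  simp_rw [enorm_inner_comm x]
  exact tsum_enorm_inner_onb x

theorem sq_rpow_half (a : ℝ≥0∞) : (a ^ 2) ^ (1 / 2 : ℝ) = a := by
  rw [← ENNReal.rpow_natCast, ← ENNReal.rpow_mul]
  norm_num

theorem rpow_half_sq (a : ℝ≥0∞) : (a ^ (1 / 2 : ℝ)) ^ 2 = a := by
  rw [← ENNReal.rpow_natCast, ← ENNReal.rpow_mul]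
  norm_num

/-- The square of the Hilbert-Schmidt norm. -/
def hsSq (A : Op d) : ℝ≥0∞ := ∑' i, ‖A (onb d i)‖ₑ ^ 2

theorem hsNorm_eq (A : Op d) : hsNorm A = hsSq A ^ (1 / 2 : ℝ) := rfl

theorem hsNorm_sq (A : Op d) : hsNorm A ^ 2 = hsSq A := rpow_half_sq _

theorem hsNorm_lt_top_iff {A : Op d} : hsNorm A < ⊤ ↔ hsSq A < ⊤ := by
  rw [hsNorm_eq, ENNReal.rpow_lt_top_iff_of_pos (by norm_num)]

theorem hsSq_eq_tsum_tsum (A : Op d) :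
    hsSq A = ∑' i, ∑' j, ‖⟪onb d j, A (onb d i)⟫‖ₑ ^ 2 := by
  simp_rw [tsum_enorm_inner_onb]; rfl

theorem hsSq_star (A : Op d) : hsSq (star A) = hsSq A := by
  rw [hsSq_eq_tsum_tsum, hsSq_eq_tsum_tsum, ENNReal.tsum_comm]
  simp_rw [inner_adj', enorm_inner_comm (A _)]

theorem hsNorm_star (A : Op d) : hsNorm (star A) = hsNorm A := by
  rw [hsNorm_eq, hsSq_star, hsNorm_eq]

/-- The conjugated basis is again orthonormal. Writing both sides as double sums of matrix elements
and applying Parseval in the other index avoids a separate proof of basis independence. -/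
theorem hsSq_conj (A : Op d) : hsSq (conj A) = hsSq A := by
  have : hsSq (conj A) = ∑' i, ∑' j, ‖⟪onb d j, A (star (onb d i))⟫‖ₑ ^ 2 := by
    simp_rw [tsum_enorm_inner_onb]
    simp [hsSq, conj_apply, enorm_star_L2]
  rw [this, ENNReal.tsum_comm, ← hsSq_star]
  refine tsum_congr fun j => ?_
  simp_rw [← inner_adj]
  conv_lhs => enter [1, i]; rw [enorm_inner_comm, inner_star_left, enorm_inner_comm]
  rw [tsum_enorm_inner_onb, enorm_star_L2]

theorem hsNorm_conj (A : Op d) : hsNorm (conj A) = hsNorm A := by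
  rw [hsNorm_eq, hsSq_conj, hsNorm_eq]

theorem hsNorm_transp (A : Op d) : hsNorm (transp A) = hsNorm A := by
  rw [transp, hsNorm_conj, hsNorm_star]

theorem enorm_apply_le (A : Op d) (f : L2 d) : ‖A f‖ₑ ≤ ‖A‖ₑ * ‖f‖ₑ := A.le_opENorm f

theorem hsNorm_mul_le (A B : Op d) : hsNorm (A * B) ≤ ‖A‖ₑ * hsNorm B := by
  have : hsSq (A * B) ≤ ‖A‖ₑ ^ 2 * hsSq B := by
    rw [hsSq, hsSq, ← ENNReal.tsum_mul_left]
    refine ENNReal.tsum_le_tsum fun i => ?_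
    rw [← mul_pow]
    gcongr
    exact enorm_apply_le A _
  rw [hsNorm_eq, hsNorm_eq]
  calc _ ≤ (‖A‖ₑ ^ 2 * hsSq B) ^ (1 / 2 : ℝ) := by gcongr
    _ = _ := by rw [ENNReal.mul_rpow_of_nonneg _ _ (by norm_num), sq_rpow_half]

theorem enorm_star_op (A : Op d) : ‖star A‖ₑ = ‖A‖ₑ := by
  rw [← ofReal_norm, ← ofReal_norm]
  congr 1
  exact ContinuousLinearMap.adjoint.norm_map A

theorem enorm_conj (A : Op d) : ‖conj A‖ₑ = ‖A‖ₑ := by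
  rw [← ofReal_norm, norm_conj, ofReal_norm]

theorem hsNorm_mul_le' (A B : Op d) : hsNorm (A * B) ≤ hsNorm A * ‖B‖ₑ := by
  rw [← hsNorm_star, star_mul, ← hsNorm_star A, ← enorm_star_op B, mul_comm]
  exact hsNorm_mul_le _ _

theorem hsNorm_add_le (A B : Op d) : hsNorm (A + B) ≤ hsNorm A + hsNorm B := by
  let _ : MeasurableSpace (Idx d) := ⊤
  have h : ∀ A : Op d, hsNorm A = eLpNorm (fun i : Idx d => A (onb d i)) 2 Measure.count := by
    intro A
    rw [eLpNorm_eq_lintegral_rpow_enorm_toReal (by simp) (by simp), lintegral_count]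
    simp [hsNorm]
  rw [h, h, h]
  exact eLpNorm_add_le (StronglyMeasurable.of_discrete).aestronglyMeasurable
    (StronglyMeasurable.of_discrete).aestronglyMeasurable (by simp)

theorem hsNorm_smul (c : ℂ) (A : Op d) : hsNorm (c • A) = ‖c‖ₑ * hsNorm A := by
  have : hsSq (c • A) = ‖c‖ₑ ^ 2 * hsSq A := by
    rw [hsSq, hsSq, ← ENNReal.tsum_mul_left]
    refine tsum_congr fun i => ?_
    simp [enorm_smul, mul_pow]
  rw [hsNorm_eq, hsNorm_eq, this, ENNReal.mul_rpow_of_nonneg _ _ (by norm_num), sq_rpow_half]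

@[simp] theorem hsNorm_zero : hsNorm (0 : Op d) = 0 := by simp [hsNorm]

theorem opNorm_le_hsNorm (A : Op d) : ‖A‖ₑ ≤ hsNorm A := by
  by_cases h : hsNorm A = ⊤
  · simp [h]
  rw [← ofReal_norm]
  refine ENNReal.ofReal_le_of_le_toReal (ContinuousLinearMap.opNorm_le_bound _ (by simp) fun f => ?_)
  suffices ‖A f‖ₑ ≤ hsNorm A * ‖f‖ₑ by
    rw [← ENNReal.toReal_ofReal (norm_nonneg (A f)), ← ENNReal.toReal_ofReal (norm_nonneg f),
      ← ENNReal.toReal_mul, ofReal_norm, ofReal_norm]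
    exact ENNReal.toReal_mono (ENNReal.mul_ne_top h (by simp)) this
  have h1 : ‖A f‖ₑ ^ 2 ≤ (hsNorm A * ‖f‖ₑ) ^ 2 := by
    rw [mul_pow, hsNorm_sq, ← hsSq_star, ← tsum_enorm_inner_onb, hsSq, ← ENNReal.tsum_mul_right]
    refine ENNReal.tsum_le_tsum fun i => ?_
    rw [← inner_adj, ← mul_pow]
    gcongr
    exact enorm_inner_le _ _
  simpa using (ENNReal.pow_le_pow_left_iff (by norm_num)).1 h1

/-- Hilbert-Schmidt operators. -/
def HS (A : Op d) : Prop := hsNorm A < ⊤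

protected theorem HS.star {A : Op d} (h : HS A) : HS (star A) := by rwa [HS, hsNorm_star]
protected theorem HS.conj {A : Op d} (h : HS A) : HS (conj A) := by rwa [HS, hsNorm_conj]
protected theorem HS.transp {A : Op d} (h : HS A) : HS (transp A) := by rwa [HS, hsNorm_transp]
protected theorem HS.add {A B : Op d} (hA : HS A) (hB : HS B) : HS (A + B) :=
  (hsNorm_add_le A B).trans_lt (ENNReal.add_lt_top.2 ⟨hA, hB⟩)
protected theorem HS.smul {A : Op d} (c : ℂ) (h : HS A) : HS (c • A) := by
  rw [HS, hsNorm_smul]; exact ENNReal.mul_lt_top (by simp) h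
protected theorem HS.neg {A : Op d} (h : HS A) : HS (-A) := by
  rw [← neg_one_smul ℂ A]; exact h.smul _
protected theorem HS.sub {A B : Op d} (hA : HS A) (hB : HS B) : HS (A - B) := by
  rw [sub_eq_add_neg]; exact hA.add hB.neg
protected theorem HS.mul_left {B : Op d} (A : Op d) (h : HS B) : HS (A * B) :=
  (hsNorm_mul_le A B).trans_lt (ENNReal.mul_lt_top (by simp) h)
protected theorem HS.mul_right {A : Op d} (h : HS A) (B : Op d) : HS (A * B) :=
  (hsNorm_mul_le' A B).trans_lt (ENNReal.mul_lt_top h (by simp))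
protected theorem HS.zero : HS (0 : Op d) := by simp [HS]

/-! ### Trace-class operators -/

/-- `A = ∑ |xᵢ⟩⟨yᵢ|` with strong convergence. -/
def IsRep {ι : Type*} (A : Op d) (x y : ι → L2 d) : Prop :=
  ∀ f, HasSum (fun i => ⟪y i, f⟫ • x i) (A f)

/-- Trace-class operators. -/
def Nuc (A : Op d) : Prop := traceNorm A < ⊤

theorem summable_of_tsum_enorm {ι F : Type*} [NormedAddCommGroup F] [CompleteSpace F] {f : ι → F}
    (h : ∑' i, ‖f i‖ₑ ≠ ⊤) : Summable f := by
  refine Summable.of_nnnorm ?_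
  rw [← ENNReal.tsum_coe_ne_top_iff_summable]
  exact h

/-- Extending a family by zero along an injection into ℕ changes neither the operator nor the sum,
so representations over any countable index set may compete in the infimum. -/
theorem traceNorm_le_tsum {ι : Type*} [Countable ι] {A : Op d} {x y : ι → L2 d}
    (h : IsRep A x y) : traceNorm A ≤ ∑' i, ‖x i‖ₑ * ‖y i‖ₑ := by
  obtain ⟨e, he⟩ := exists_injective_nat ι
  refine (iInf₂_le (Function.extend e x 0) (Function.extend e y 0)).trans
    ((iInf_le _ fun f => ?_).trans_eq ?_)
  · rw [← he.hasSum_iff]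
    · convert h f using 2
      simp [he.extend_apply]
    · intro n hn
      simp [Function.extend_apply' _ _ _ (by simpa using hn)]
  · rw [← he.tsum_eq]
    · simp [he.extend_apply]
    · intro n hn
      by_contra hc
      apply hn
      simp [Function.extend_apply' _ _ _ (by simpa using hc)]

theorem exists_rep_lt {A : Op d} {C : ℝ≥0∞} (h : traceNorm A < C) :
    ∃ x y : ℕ → L2 d, IsRep A x y ∧ ∑' i, ‖x i‖ₑ * ‖y i‖ₑ < C := by
  simp only [traceNorm, iInf_lt_iff] at h
  obtain ⟨x, y, h1, h2⟩ := h
  exact ⟨x, y, h1, h2⟩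

protected theorem Nuc.exists_rep {A : Op d} (h : Nuc A) :
    ∃ x y : ℕ → L2 d, IsRep A x y ∧ ∑' i, ‖x i‖ₑ * ‖y i‖ₑ < ⊤ := exists_rep_lt h

theorem le_traceNorm {A : Op d} {C : ℝ≥0∞}
    (h : ∀ x y : ℕ → L2 d, IsRep A x y → C ≤ ∑' i, ‖x i‖ₑ * ‖y i‖ₑ) : C ≤ traceNorm A :=
  le_iInf₂ fun x y => le_iInf fun hr => h x y hr

theorem tsum_enorm_inner_mul_inner_le (x y : L2 d) :
    ∑' j, ‖⟪onb d j, x⟫‖ₑ * ‖⟪y, onb d j⟫‖ₑ ≤ ‖x‖ₑ * ‖y‖ₑ := by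
  refine (tsum_mul_le_sqrt _ _).trans_eq ?_
  rw [tsum_enorm_inner_onb, tsum_enorm_inner_onb', sq_rpow_half, sq_rpow_half]

/-- The double family ⟨yᵢ, eⱼ⟩⟨eⱼ, xᵢ⟩ is absolutely summable by Cauchy–Schwarz in j, so Fubini
applies. Hence the trace can be computed from any nuclear representation, which is how all trace
rules below are obtained. -/
protected theorem IsRep.hasSum_onb {ι : Type*} {A : Op d} {x y : ι → L2 d} (h : IsRep A x y)
    (hs : ∑' i, ‖x i‖ₑ * ‖y i‖ₑ < ⊤) :
    Summable (fun j => ⟪onb d j, A (onb d j)⟫) ∧ trace A = ∑' i, ⟪y i, x i⟫ := by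
  have hF : Summable (Function.uncurry fun (i : ι) (j : Idx d) =>
      ⟪y i, onb d j⟫ * ⟪onb d j, x i⟫) := by
    refine summable_of_tsum_enorm (ne_top_of_le_ne_top hs.ne ?_)
    rw [ENNReal.tsum_prod']
    refine ENNReal.tsum_le_tsum fun i => ?_
    simp only [Function.uncurry, enorm_mul]
    simp_rw [mul_comm ‖⟪y i, _⟫‖ₑ]
    exact tsum_enorm_inner_mul_inner_le _ _
  have h1 : ∀ j : Idx d, ⟪onb d j, A (onb d j)⟫ = ∑' i, ⟪y i, onb d j⟫ * ⟪onb d j, x i⟫ := by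
    intro j
    have := ((h (onb d j)).mapL (innerSL ℂ (onb d j))).tsum_eq
    simp only [innerSL_apply_apply, inner_smul_right] at this
    exact this.symm
  constructor
  · simp_rw [h1]
    exact hF.prod_symm.prod
  · rw [trace]
    simp_rw [h1]
    rw [hF.tsum_comm]
    exact tsum_congr fun i => (onb d).tsum_inner_mul_inner _ _

protected theorem IsRep.trace_eq {ι : Type*} {A : Op d} {x y : ι → L2 d} (h : IsRep A x y)
    (hs : ∑' i, ‖x i‖ₑ * ‖y i‖ₑ < ⊤) : trace A = ∑' i, ⟪y i, x i⟫ := (h.hasSum_onb hs).2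

protected theorem IsRep.mul_left {ι : Type*} {A : Op d} {x y : ι → L2 d} (h : IsRep A x y) (B : Op d) :
    IsRep (B * A) (fun i => B (x i)) y := fun f => by
  simpa using (h f).mapL B

protected theorem IsRep.mul_right {ι : Type*} {A : Op d} {x y : ι → L2 d} (h : IsRep A x y) (B : Op d) :
    IsRep (A * B) x (fun i => star B (y i)) := fun f => by
  simpa [inner_adj] using h (B f)

theorem continuous_star_L2 : Continuous (star : L2 d → L2 d) :=
  (Isometry.of_dist_eq fun f g => by
    rw [dist_eq_norm, dist_eq_norm, ← star_sub_L2, norm_star_L2]).continuous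

protected theorem IsRep.conj {ι : Type*} {A : Op d} {x y : ι → L2 d} (h : IsRep A x y) :
    IsRep (conj A) (fun i => star (x i)) (fun i => star (y i)) := fun f => by
  let φ : L2 d →+ L2 d :=
    ⟨⟨fun f : L2 d => star f, by simpa using star_smul_L2 0 (0 : L2 d)⟩, star_add_L2⟩
  have h2 := (h (star f)).map φ continuous_star_L2
  suffices (fun i => ⟪star (y i), f⟫ • star (x i)) = φ ∘ fun i => ⟪y i, star f⟫ • x i by
    rw [this]; exact h2
  ext1 i
  change _ = star (⟪y i, star f⟫ • x i)
  rw [star_smul_L2]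
  congr 1
  rw [inner_star_left]
  exact (inner_conj_symm _ _).symm

protected theorem IsRep.summable {ι : Type*} {x y : ι → L2 d} (hs : ∑' i, ‖x i‖ₑ * ‖y i‖ₑ < ⊤) (f : L2 d) :
    Summable fun i => ⟪y i, f⟫ • x i := by
  refine summable_of_tsum_enorm (ne_top_of_le_ne_top (b := ‖f‖ₑ * ∑' i, ‖x i‖ₑ * ‖y i‖ₑ) ?_ ?_)
  · exact ENNReal.mul_ne_top (by simp) hs.ne
  · rw [← ENNReal.tsum_mul_left]
    refine ENNReal.tsum_le_tsum fun i => ?_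
    rw [enorm_smul]
    calc _ ≤ ‖y i‖ₑ * ‖f‖ₑ * ‖x i‖ₑ := by gcongr; exact enorm_inner_le _ _
      _ = _ := by ring

protected theorem IsRep.star {ι : Type*} {A : Op d} {x y : ι → L2 d} (h : IsRep A x y)
    (hs : ∑' i, ‖x i‖ₑ * ‖y i‖ₑ < ⊤) : IsRep (star A) y x := fun f => by
  have h1 := IsRep.summable (x := y) (y := x) (by simpa [mul_comm] using hs) f
  convert h1.hasSum using 1
  refine ext_inner_left ℂ fun g => ?_
  have h2 := (h1.hasSum.mapL (innerSL ℂ g)).tsum_eq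
  have h3 := ((h g).mapL (innerSL ℂ f)).tsum_eq
  simp only [innerSL_apply_apply, inner_smul_right] at h2 h3
  rw [inner_adj', ← h2, ← inner_conj_symm, ← h3, Complex.conj_tsum]
  refine tsum_congr fun i => ?_
  rw [map_mul, inner_conj_symm, inner_conj_symm, mul_comm]

protected theorem IsRep.opNorm_le {ι : Type*} {A : Op d} {x y : ι → L2 d} (h : IsRep A x y) :
    ‖A‖ₑ ≤ ∑' i, ‖x i‖ₑ * ‖y i‖ₑ := by
  by_cases hs : ∑' i, ‖x i‖ₑ * ‖y i‖ₑ = ⊤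
  · simp [hs]
  rw [← ofReal_norm]
  refine ENNReal.ofReal_le_of_le_toReal (ContinuousLinearMap.opNorm_le_bound _ (by simp) fun f => ?_)
  suffices ‖A f‖ₑ ≤ (∑' i, ‖x i‖ₑ * ‖y i‖ₑ) * ‖f‖ₑ by
    rw [← ENNReal.toReal_ofReal (norm_nonneg (A f)), ← ENNReal.toReal_ofReal (norm_nonneg f),
      ← ENNReal.toReal_mul, ofReal_norm, ofReal_norm]
    exact ENNReal.toReal_mono (ENNReal.mul_ne_top hs (by simp)) this
  rw [← (h f).tsum_eq, ← ENNReal.tsum_mul_right]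
  refine enorm_tsum_le_tsum_enorm.trans (ENNReal.tsum_le_tsum fun i => ?_)
  rw [enorm_smul]
  calc _ ≤ ‖y i‖ₑ * ‖f‖ₑ * ‖x i‖ₑ := by gcongr; exact enorm_inner_le _ _
    _ = _ := by ring

theorem opNorm_le_traceNorm (A : Op d) : ‖A‖ₑ ≤ traceNorm A :=
  le_traceNorm fun _ _ h => h.opNorm_le

/-- Expand ‖Aeⱼ‖² = ⟨Aeⱼ, Aeⱼ⟩ by inserting the representation in the second slot only, then sum
over j by Cauchy–Schwarz. With the operator-norm bound this yields that the Hilbert-Schmidt norm is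
at most the trace norm. -/
protected theorem IsRep.hsSq_le {ι : Type*} {A : Op d} {x y : ι → L2 d} (h : IsRep A x y) :
    hsSq A ≤ ‖A‖ₑ * ∑' i, ‖x i‖ₑ * ‖y i‖ₑ := by
  have h1 : ∀ j : Idx d, ‖A (onb d j)‖ₑ ^ 2 ≤
      ∑' i, ‖⟪onb d j, star A (x i)⟫‖ₑ * ‖⟪y i, onb d j⟫‖ₑ := by
    intro j
    have h3 := ((h (onb d j)).mapL (innerSL ℂ (A (onb d j)))).tsum_eq
    simp only [innerSL_apply_apply, inner_smul_right] at h3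
    clear h
    have : ‖A (onb d j)‖ₑ ^ 2 = ‖⟪A (onb d j), A (onb d j)⟫‖ₑ := by
      rw [inner_self_eq_norm_sq_to_K, enorm_pow, ← ofReal_norm, ← ofReal_norm]
      simp
    rw [this, ← h3]
    refine enorm_tsum_le_tsum_enorm.trans (ENNReal.tsum_le_tsum fun i => ?_)
    rw [enorm_mul, mul_comm, inner_adj']
  calc hsSq A ≤ ∑' j, ∑' i, ‖⟪onb d j, star A (x i)⟫‖ₑ * ‖⟪y i, onb d j⟫‖ₑ :=
        ENNReal.tsum_le_tsum h1
    _ = ∑' i, ∑' j, ‖⟪onb d j, star A (x i)⟫‖ₑ * ‖⟪y i, onb d j⟫‖ₑ := ENNReal.tsum_comm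
    _ ≤ ∑' i, ‖A‖ₑ * (‖x i‖ₑ * ‖y i‖ₑ) := by
        refine ENNReal.tsum_le_tsum fun i => (tsum_enorm_inner_mul_inner_le _ _).trans ?_
        rw [← mul_assoc, ← enorm_star_op A]
        gcongr
        exact enorm_apply_le _ _
    _ = _ := ENNReal.tsum_mul_left

theorem hsNorm_le_traceNorm (A : Op d) : hsNorm A ≤ traceNorm A := by
  refine le_traceNorm fun x y h => ?_
  have h1 : hsSq A ≤ (∑' i, ‖x i‖ₑ * ‖y i‖ₑ) ^ 2 := by
    rw [sq]
    refine h.hsSq_le.trans ?_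
    gcongr
    exact h.opNorm_le
  rw [← hsNorm_sq] at h1
  exact (ENNReal.pow_le_pow_left_iff (by norm_num)).1 h1

protected theorem Nuc.hs {A : Op d} (h : Nuc A) : HS A := (hsNorm_le_traceNorm A).trans_lt h

theorem traceNorm_star_le (A : Op d) : traceNorm (star A) ≤ traceNorm A := by
  refine le_traceNorm fun x y h => ?_
  by_cases hs : ∑' i, ‖x i‖ₑ * ‖y i‖ₑ = ⊤
  · simp [hs]
  refine (traceNorm_le_tsum (h.star (lt_top_iff_ne_top.2 hs))).trans_eq ?_
  simp_rw [mul_comm]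

theorem traceNorm_star (A : Op d) : traceNorm (star A) = traceNorm A :=
  le_antisymm (traceNorm_star_le A) (by simpa using traceNorm_star_le (star A))

theorem traceNorm_conj_le (A : Op d) : traceNorm (conj A) ≤ traceNorm A := by
  refine le_traceNorm fun x y h => ?_
  refine (traceNorm_le_tsum h.conj).trans_eq ?_
  simp_rw [enorm_star_L2]

theorem traceNorm_conj (A : Op d) : traceNorm (conj A) = traceNorm A :=
  le_antisymm (traceNorm_conj_le A) (by simpa using traceNorm_conj_le (conj A))

theorem traceNorm_mul_le (A B : Op d) : traceNorm (A * B) ≤ ‖A‖ₑ * traceNorm B := by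
  -- For A = 0 the right side is 0 even when `traceNorm B` is infinite, so this case needs the empty
  -- representation; otherwise one may divide by ‖A‖.
  by_cases hA : ‖A‖ₑ = 0
  · have : A = 0 := by
      rw [← ofReal_norm, ENNReal.ofReal_eq_zero] at hA
      exact norm_le_zero_iff.1 hA
    subst this
    have : IsRep (0 * B) (fun _ : Empty => (0 : L2 d)) (fun _ => 0) := fun f => by
      simp [hasSum_empty]
    exact (traceNorm_le_tsum this).trans (by simp)
  rw [mul_comm, ← ENNReal.div_le_iff hA (by simp)]
  refine le_traceNorm fun x y h => ?_
  rw [ENNReal.div_le_iff hA (by simp), ← ENNReal.tsum_mul_right]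
  refine (traceNorm_le_tsum (h.mul_left A)).trans (ENNReal.tsum_le_tsum fun i => ?_)
  calc _ ≤ ‖A‖ₑ * ‖x i‖ₑ * ‖y i‖ₑ := by gcongr; exact enorm_apply_le _ _
    _ = _ := by ring

theorem traceNorm_mul_le' (A B : Op d) : traceNorm (A * B) ≤ traceNorm A * ‖B‖ₑ := by
  rw [← traceNorm_star, star_mul, ← traceNorm_star A, ← enorm_star_op B, mul_comm]
  exact traceNorm_mul_le _ _

protected theorem IsRep.add {ι κ : Type*} {A B : Op d} {x y : ι → L2 d} {x' y' : κ → L2 d}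
    (hA : IsRep A x y) (hB : IsRep B x' y') :
    IsRep (A + B) (Sum.elim x x') (Sum.elim y y') := fun f => by
  rw [add_apply]
  refine HasSum.sum (f := fun i : ι ⊕ κ => ⟪Sum.elim y y' i, f⟫ • Sum.elim x x' i) ?_ ?_
  · exact hA f
  · exact hB f

theorem traceNorm_add_le (A B : Op d) : traceNorm (A + B) ≤ traceNorm A + traceNorm B := by
  refine ENNReal.le_of_forall_pos_le_add fun ε hε htop => ?_
  have hε' : (ε / 2 : ℝ≥0∞) ≠ 0 := by simp [hε.ne']
  obtain ⟨x, y, h, hs⟩ := exists_rep_lt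
    (ENNReal.lt_add_right (ENNReal.add_lt_top.1 htop).1.ne hε')
  obtain ⟨x', y', h', hs'⟩ := exists_rep_lt
    (ENNReal.lt_add_right (ENNReal.add_lt_top.1 htop).2.ne hε')
  refine (traceNorm_le_tsum (h.add h')).trans ?_
  rw [Summable.tsum_sum ENNReal.summable ENNReal.summable]
  refine (add_le_add hs.le hs'.le).trans_eq ?_
  rw [add_add_add_comm, ENNReal.add_halves]

theorem traceNorm_smul_le (c : ℂ) (A : Op d) : traceNorm (c • A) ≤ ‖c‖ₑ * traceNorm A := by
  have := traceNorm_mul_le (c • (1 : Op d)) A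
  rw [smul_mul_assoc, one_mul] at this
  refine this.trans ?_
  gcongr
  rw [enorm_smul]
  refine (mul_le_mul_right (a := ‖c‖ₑ) (b := ‖(1 : Op d)‖ₑ) (c := 1) ?_).trans_eq (mul_one _)
  rw [← ofReal_norm]
  exact ENNReal.ofReal_le_one.2 (ContinuousLinearMap.norm_id_le)

theorem traceNorm_zero : traceNorm (0 : Op d) = 0 := by
  simpa using traceNorm_smul_le 0 (0 : Op d)

theorem traceNorm_ketbra_le (f g : L2 d) : traceNorm (ketbra f g) ≤ ‖f‖ₑ * ‖g‖ₑ := by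
  have : IsRep (ketbra f g) (fun _ : Unit => f) (fun _ => g) := fun h => by
    rw [ketbra_apply]
    exact hasSum_unique (fun _ : Unit => ⟪g, h⟫ • f)
  simpa using traceNorm_le_tsum this

protected theorem Nuc.star {A : Op d} (h : Nuc A) : Nuc (star A) := by rwa [Nuc, traceNorm_star]
protected theorem Nuc.conj {A : Op d} (h : Nuc A) : Nuc (conj A) := by rwa [Nuc, traceNorm_conj]
protected theorem Nuc.add {A B : Op d} (hA : Nuc A) (hB : Nuc B) : Nuc (A + B) :=
  (traceNorm_add_le A B).trans_lt (ENNReal.add_lt_top.2 ⟨hA, hB⟩)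
protected theorem Nuc.smul {A : Op d} (c : ℂ) (h : Nuc A) : Nuc (c • A) :=
  (traceNorm_smul_le c A).trans_lt (ENNReal.mul_lt_top (by simp) h)
protected theorem Nuc.neg {A : Op d} (h : Nuc A) : Nuc (-A) := by
  rw [← neg_one_smul ℂ A]; exact h.smul _
protected theorem Nuc.sub {A B : Op d} (hA : Nuc A) (hB : Nuc B) : Nuc (A - B) := by
  rw [sub_eq_add_neg]; exact hA.add hB.neg
protected theorem Nuc.mul_left {B : Op d} (A : Op d) (h : Nuc B) : Nuc (A * B) :=
  (traceNorm_mul_le A B).trans_lt (ENNReal.mul_lt_top (by simp) h)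
protected theorem Nuc.mul_right {A : Op d} (h : Nuc A) (B : Op d) : Nuc (A * B) :=
  (traceNorm_mul_le' A B).trans_lt (ENNReal.mul_lt_top h (by simp))
protected theorem Nuc.ketbra (f g : L2 d) : Nuc (ketbra f g) :=
  (traceNorm_ketbra_le f g).trans_lt (ENNReal.mul_lt_top (by simp) (by simp))

/-- The product of two Hilbert-Schmidt operators, expanded in the basis. -/
theorem isRep_mul (A B : Op d) :
    IsRep (A * B) (fun i => A (onb d i)) (fun i => star B (onb d i)) := fun f => by
  have := ((onb d).hasSum_repr (B f)).mapL A
  simpa [(onb d).repr_apply_apply, inner_adj] using this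

theorem tsum_mul_onb_le (A B : Op d) :
    ∑' i, ‖A (onb d i)‖ₑ * ‖star B (onb d i)‖ₑ ≤ hsNorm A * hsNorm B := by
  rw [← hsNorm_star B]
  exact tsum_mul_le_sqrt _ _

theorem traceNorm_mul_le_hs (A B : Op d) : traceNorm (A * B) ≤ hsNorm A * hsNorm B :=
  (traceNorm_le_tsum (isRep_mul A B)).trans (tsum_mul_onb_le A B)

protected theorem HS.mul {A B : Op d} (hA : HS A) (hB : HS B) : Nuc (A * B) :=
  (traceNorm_mul_le_hs A B).trans_lt (ENNReal.mul_lt_top hA hB)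

/-! ### The trace -/

theorem enorm_trace_le (A : Op d) : ‖trace A‖ₑ ≤ traceNorm A := by
  refine le_traceNorm fun x y hr => ?_
  by_cases hs : ∑' i, ‖x i‖ₑ * ‖y i‖ₑ = ⊤
  · simp [hs]
  rw [hr.trace_eq (lt_top_iff_ne_top.2 hs)]
  refine enorm_tsum_le_tsum_enorm.trans (ENNReal.tsum_le_tsum fun i => ?_)
  rw [mul_comm]
  exact enorm_inner_le _ _

protected theorem Nuc.summable {A : Op d} (h : Nuc A) : Summable fun i => ⟪onb d i, A (onb d i)⟫ := by
  obtain ⟨x, y, hr, hs⟩ := h.exists_rep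
  exact (hr.hasSum_onb hs).1

theorem trace_add {A B : Op d} (hA : Nuc A) (hB : Nuc B) : trace (A + B) = trace A + trace B := by
  simp only [trace, add_apply, inner_add_right]
  exact hA.summable.tsum_add hB.summable

theorem trace_smul (c : ℂ) (A : Op d) : trace (c • A) = c * trace A := by
  simp only [trace, smul_apply, inner_smul_right]
  exact tsum_mul_left

theorem trace_neg (A : Op d) : trace (-A) = -trace A := by
  rw [← neg_one_smul ℂ A, trace_smul]; simp

theorem trace_sub {A B : Op d} (hA : Nuc A) (hB : Nuc B) : trace (A - B) = trace A - trace B := by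
  rw [sub_eq_add_neg, trace_add hA hB.neg, trace_neg, sub_eq_add_neg]

theorem trace_star (A : Op d) : trace (star A) = star (trace A) := by
  simp only [trace, inner_adj']
  rw [← starRingEnd_apply, Complex.conj_tsum]
  exact tsum_congr fun i => (inner_conj_symm _ _).symm

theorem trace_conj {A : Op d} (h : Nuc A) : trace (conj A) = star (trace A) := by
  obtain ⟨x, y, hr, hs⟩ := h.exists_rep
  rw [hr.trace_eq hs, hr.conj.trace_eq (by simpa only [enorm_star_L2] using hs),
    ← starRingEnd_apply, Complex.conj_tsum]
  refine tsum_congr fun i => ?_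
  rw [inner_star_star, inner_conj_symm]

theorem trace_transp {A : Op d} (h : Nuc A) : trace (transp A) = trace A := by
  rw [transp, trace_conj h.star, trace_star, star_star]

/-- If A = ∑ |xᵢ⟩⟨yᵢ|, then AB is represented by (xᵢ, B*yᵢ) and BA by (Bxᵢ, yᵢ), and both give ∑
⟨yᵢ, Bxᵢ⟩. Only one factor has to be trace class. -/
theorem trace_mul_comm_of_nuc {A : Op d} (h : Nuc A) (B : Op d) : trace (A * B) = trace (B * A) := by
  obtain ⟨x, y, hr, hs⟩ := h.exists_rep
  have h1 : ∑' i, ‖x i‖ₑ * ‖star B (y i)‖ₑ < ⊤ := by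
    refine lt_of_le_of_lt (b := (∑' i, ‖x i‖ₑ * ‖y i‖ₑ) * ‖star B‖ₑ) ?_
      (ENNReal.mul_lt_top hs (by simp))
    rw [← ENNReal.tsum_mul_right]
    refine ENNReal.tsum_le_tsum fun i => ?_
    rw [mul_assoc, mul_comm ‖y i‖ₑ]
    gcongr
    exact enorm_apply_le _ _
  have h2 : ∑' i, ‖B (x i)‖ₑ * ‖y i‖ₑ < ⊤ := by
    refine lt_of_le_of_lt (b := ‖B‖ₑ * (∑' i, ‖x i‖ₑ * ‖y i‖ₑ)) ?_
      (ENNReal.mul_lt_top (by simp) hs)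
    rw [← ENNReal.tsum_mul_left]
    refine ENNReal.tsum_le_tsum fun i => ?_
    rw [← mul_assoc]
    gcongr
    exact enorm_apply_le _ _
  rw [(hr.mul_right B).trace_eq h1, (hr.mul_left B).trace_eq h2]
  exact tsum_congr fun i => inner_adj _ _ _

theorem trace_mul_eq_tsum {A B : Op d} (hA : HS A) (hB : HS B) :
    trace (A * B) = ∑' i, ⟪star B (onb d i), A (onb d i)⟫ :=
  (isRep_mul A B).trace_eq ((tsum_mul_onb_le A B).trans_lt (ENNReal.mul_lt_top hA hB))

theorem trace_mul_comm_of_hs {A B : Op d} (hA : HS A) (hB : HS B) :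
    trace (A * B) = trace (B * A) := by
  have hF : Summable (Function.uncurry fun (i j : Idx d) =>
      ⟪star B (onb d i), onb d j⟫ * ⟪onb d j, A (onb d i)⟫) := by
    refine summable_of_tsum_enorm (ne_top_of_le_ne_top (ENNReal.mul_lt_top hA hB).ne
      (le_trans ?_ (tsum_mul_onb_le A B)))
    rw [ENNReal.tsum_prod']
    refine ENNReal.tsum_le_tsum fun i => ?_
    simp only [Function.uncurry, enorm_mul]
    simp_rw [mul_comm ‖⟪star B _, _⟫‖ₑ]
    exact tsum_enorm_inner_mul_inner_le _ _
  rw [trace_mul_eq_tsum hA hB, trace_mul_eq_tsum hB hA]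
  simp_rw [← fun i => (onb d).tsum_inner_mul_inner (star B (onb d i)) (A (onb d i)),
    ← fun i => (onb d).tsum_inner_mul_inner (star A (onb d i)) (B (onb d i))]
  refine hF.tsum_comm.symm.trans ?_
  refine tsum_congr fun j => tsum_congr fun i => ?_
  rw [inner_adj, inner_adj, mul_comm]

theorem trace_ketbra (f g : L2 d) : trace (ketbra f g) = ⟪g, f⟫ := by
  have : IsRep (ketbra f g) (fun _ : Unit => f) (fun _ => g) := fun h => by
    rw [ketbra_apply]
    exact hasSum_unique (fun _ : Unit => ⟪g, h⟫ • f)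
  rw [this.trace_eq]
  · simp
  · simp [ENNReal.mul_lt_top]

/-- Dominated convergence along a nuclear representation: uniformly bounded strong convergence
suffices under the trace. This removes the resolvent regularization at the end. -/
theorem tendsto_trace_mul {W : ℕ → Op d} {L D : Op d} (hD : Nuc D) {C : ℝ}
    (hW : ∀ n, ‖W n‖ ≤ C) (hl : ∀ f, Tendsto (fun n => W n f) atTop (𝓝 (L f))) :
    Tendsto (fun n => trace (W n * D)) atTop (𝓝 (trace (L * D))) := by
  obtain ⟨x, y, hr, hs⟩ := hD.exists_rep
  have h2 : ∀ B : Op d, ∑' i, ‖B (x i)‖ₑ * ‖y i‖ₑ < ⊤ := by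
    intro B
    refine lt_of_le_of_lt (b := ‖B‖ₑ * (∑' i, ‖x i‖ₑ * ‖y i‖ₑ)) ?_
      (ENNReal.mul_lt_top (by simp) hs)
    rw [← ENNReal.tsum_mul_left]
    refine ENNReal.tsum_le_tsum fun i => ?_
    rw [← mul_assoc]
    gcongr
    exact enorm_apply_le _ _
  simp_rw [fun B : Op d => (hr.mul_left B).trace_eq (h2 B)]
  have hsum : Summable fun i => ‖x i‖ * ‖y i‖ := by
    have : Summable fun i => (‖x i‖ * ‖y i‖ : ℝ) := by
      refine summable_of_tsum_enorm ?_
      simpa [enorm_mul] using hs.ne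
    exact this
  refine tendsto_tsum_of_dominated_convergence (bound := fun i => C * (‖x i‖ * ‖y i‖))
    (hsum.mul_left C) (fun i => ((continuous_const.inner continuous_id).tendsto _).comp (hl (x i)))
    (Eventually.of_forall fun n i => (norm_inner_le_norm _ _).trans ?_)
  rw [mul_comm, ← mul_assoc]
  gcongr
  exact (W n).le_of_opNorm_le (hW n) _

/-! ### Operators with square-integrable kernels -/

theorem lintegral_enorm_sq {α : Type*} [MeasurableSpace α] {μ : Measure α} (f : α → ℂ) :
    ∫⁻ x, ‖f x‖ₑ ^ 2 ∂μ = eLpNorm f 2 μ ^ 2 := by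
  rw [eLpNorm_eq_lintegral_rpow_enorm_toReal (by simp) (by simp)]
  simp only [ENNReal.toReal_ofNat, ENNReal.rpow_ofNat]
  rw [rpow_half_sq]

theorem enorm_sq_eq_lintegral (f : L2 d) : ‖f‖ₑ ^ 2 = ∫⁻ x, ‖f x‖ₑ ^ 2 := by
  rw [lintegral_enorm_sq, Lp.enorm_def]

theorem memLp_two_iff {α : Type*} [MeasurableSpace α] {μ : Measure α} {f : α → ℂ}
    (hf : AEStronglyMeasurable f μ) : MemLp f 2 μ ↔ ∫⁻ x, ‖f x‖ₑ ^ 2 ∂μ < ⊤ := by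
  rw [lintegral_enorm_sq]
  exact ⟨fun h => ENNReal.pow_lt_top h.2, fun h => ⟨hf, by simpa using h⟩⟩

theorem memLp_slice {K : E d × E d → ℂ} (hK : MemLp K 2 (volume.prod volume)) :
    ∀ᵐ x, MemLp (fun y => K (x, y)) 2 volume := by
  have h1 := (memLp_two_iff hK.1).1 hK
  rw [lintegral_prod _ (hK.1.enorm.pow_const 2)] at h1
  have h2 := ae_lt_top' (AEMeasurable.lintegral_prod_right' (hK.1.enorm.pow_const 2)) h1.ne
  filter_upwards [h2, hK.1.prodMk_left] with x hx hm
  exact (memLp_two_iff hm).2 hx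

theorem integrable_slice_mul {K : E d × E d → ℂ} (hK : MemLp K 2 (volume.prod volume)) :
    ∀ᵐ x, ∀ f : L2 d, Integrable fun y => K (x, y) * f y := by
  filter_upwards [memLp_slice hK] with x hx f
  exact hx.integrable_mul (Lp.memLp f)

theorem aestronglyMeasurable_kernel_integral {K : E d × E d → ℂ}
    (hK : AEStronglyMeasurable K (volume.prod volume)) (f : L2 d) :
    AEStronglyMeasurable (fun x => ∫ y, K (x, y) * f y) volume :=
  (hK.mul (Lp.aestronglyMeasurable f).comp_snd).integral_prod_right'

theorem enorm_integral_mul_le {g : E d → ℂ} (hg : MemLp g 2 volume) (f : L2 d) :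
    ‖∫ y, g y * f y‖ₑ ≤ eLpNorm g 2 volume * ‖f‖ₑ := by
  have h : ∫ y, g y * f y = ⟪star hg.toLp, f⟫ := by
    rw [L2.inner_def]
    refine integral_congr_ae ?_
    filter_upwards [Lp.coeFn_star hg.toLp, hg.coeFn_toLp] with y h1 h2
    rw [h1, Pi.star_apply, h2]
    simp [mul_comm]
  rw [h]
  refine (enorm_inner_le _ _).trans_eq ?_
  rw [enorm_star_L2, Lp.enorm_toLp]

theorem eLpNorm_kernel_integral_le {K : E d × E d → ℂ} (hK : MemLp K 2 (volume.prod volume))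
    (f : L2 d) : eLpNorm (fun x => ∫ y, K (x, y) * f y) 2 volume ≤
      eLpNorm K 2 (volume.prod volume) * ‖f‖ₑ := by
  rw [← ENNReal.pow_le_pow_left_iff (two_ne_zero), mul_pow, ← lintegral_enorm_sq,
    ← lintegral_enorm_sq, lintegral_prod _ (hK.1.enorm.pow_const 2), ← lintegral_mul_const' _ _
      (by simp)]
  refine lintegral_mono_ae ?_
  filter_upwards [memLp_slice hK] with x hx
  rw [lintegral_enorm_sq, ← mul_pow]
  gcongr
  exact enorm_integral_mul_le hx f

theorem exists_hasKernel {K : E d × E d → ℂ} (hK : MemLp K 2 (volume.prod volume)) :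
    ∃ A : Op d, HasKernel A K := by
  have hm : ∀ f : L2 d, MemLp (fun x => ∫ y, K (x, y) * f y) 2 volume := fun f =>
    ⟨aestronglyMeasurable_kernel_integral hK.1 f, (eLpNorm_kernel_integral_le hK f).trans_lt
      (ENNReal.mul_lt_top hK.2 (by simp))⟩
  let L : L2 d →ₗ[ℂ] L2 d :=
    { toFun := fun f => (hm f).toLp
      map_add' := fun f g => by
        apply Lp.ext
        filter_upwards [(hm (f + g)).coeFn_toLp, (hm f).coeFn_toLp, (hm g).coeFn_toLp,
          Lp.coeFn_add (hm f).toLp (hm g).toLp, integrable_slice_mul hK] with x h1 h2 h3 h4 h5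
        rw [h1, h4, Pi.add_apply, h2, h3, ← integral_add (h5 f) (h5 g)]
        refine integral_congr_ae ?_
        filter_upwards [Lp.coeFn_add f g] with y hy
        rw [hy, Pi.add_apply, mul_add]
      map_smul' := fun c f => by
        apply Lp.ext
        filter_upwards [(hm (c • f)).coeFn_toLp, (hm f).coeFn_toLp,
          Lp.coeFn_smul c (hm f).toLp] with x h1 h2 h4
        rw [h1, RingHom.id_apply, h4, Pi.smul_apply, h2, smul_eq_mul, ← integral_const_mul]
        refine integral_congr_ae ?_
        filter_upwards [Lp.coeFn_smul c f] with y hy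
        rw [hy, Pi.smul_apply, smul_eq_mul]
        ring }
  refine ⟨L.mkContinuous (eLpNorm K 2 (volume.prod volume)).toReal fun f => ?_, hK, fun f => ?_⟩
  · change ‖(hm f).toLp‖ ≤ _
    rw [Lp.norm_toLp, ← ENNReal.toReal_ofReal (norm_nonneg f), ← ENNReal.toReal_mul, ofReal_norm]
    exact ENNReal.toReal_mono (ENNReal.mul_ne_top hK.2.ne (by simp))
      (eLpNorm_kernel_integral_le hK f)
  · exact (hm f).coeFn_toLp

theorem HasKernel.congr {A : Op d} {K L : E d × E d → ℂ} (h : HasKernel A K)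
    (hKL : K =ᵐ[volume.prod volume] L) : HasKernel A L := by
  refine ⟨h.1.ae_eq hKL, fun f => ?_⟩
  filter_upwards [h.2 f, Measure.ae_ae_of_ae_prod hKL] with x h1 h2
  rw [h1]
  refine integral_congr_ae ?_
  filter_upwards [h2] with y hy
  rw [hy]

theorem HasKernel.add {A B : Op d} {K L : E d × E d → ℂ} (hA : HasKernel A K)
    (hB : HasKernel B L) : HasKernel (A + B) (K + L) := by
  refine ⟨hA.1.add hB.1, fun f => ?_⟩
  filter_upwards [hA.2 f, hB.2 f, Lp.coeFn_add (A f) (B f), integrable_slice_mul hA.1,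
    integrable_slice_mul hB.1] with x h1 h2 h3 h4 h5
  rw [add_apply, h3, Pi.add_apply, h1, h2, ← integral_add (h4 f) (h5 f)]
  simp [add_mul]

theorem HasKernel.smul {A : Op d} {K : E d × E d → ℂ} (c : ℂ) (hA : HasKernel A K) :
    HasKernel (c • A) (c • K) := by
  refine ⟨hA.1.const_smul c, fun f => ?_⟩
  filter_upwards [hA.2 f, Lp.coeFn_smul c (A f)] with x h1 h3
  rw [smul_apply, h3, Pi.smul_apply, h1, smul_eq_mul, ← integral_const_mul]
  simp [mul_assoc]

theorem HasKernel.sub {A B : Op d} {K L : E d × E d → ℂ} (hA : HasKernel A K)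
    (hB : HasKernel B L) : HasKernel (A - B) (K - L) := by
  have := hA.add (hB.smul (-1))
  simpa [sub_eq_add_neg] using this

theorem HasKernel.zero : HasKernel (0 : Op d) 0 :=
  ⟨MemLp.zero, fun f => by simpa using! Lp.coeFn_zero ℂ 2 volume⟩

theorem HasKernel.sum {ι : Type*} (s : Finset ι) {A : ι → Op d} {K : ι → E d × E d → ℂ}
    (h : ∀ i, HasKernel (A i) (K i)) : HasKernel (∑ i ∈ s, A i) (∑ i ∈ s, K i) := by
  classical
  induction s using Finset.induction_on with
  | empty => simpa using HasKernel.zero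
  | insert i s hi ih => rw [Finset.sum_insert hi, Finset.sum_insert hi]; exact (h i).add ih

theorem HasKernel.conj {A : Op d} {K : E d × E d → ℂ} (h : HasKernel A K) :
    HasKernel (conj A) (star K) := by
  refine ⟨h.1.star, fun f => ?_⟩
  filter_upwards [h.2 (star f), Lp.coeFn_star (A (star f))] with x h1 h2
  rw [conj_apply, h2, Pi.star_apply, h1, ← starRingEnd_apply, ← integral_conj]
  refine integral_congr_ae ?_
  filter_upwards [Lp.coeFn_star f] with y hy
  rw [hy]
  simp

/-- The Hilbert-Schmidt norm is the `L²` norm of the kernel. -/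
theorem HasKernel.hsSq_eq {A : Op d} {K : E d × E d → ℂ} (h : HasKernel A K) :
    hsSq A = ∫⁻ p, ‖K p‖ₑ ^ 2 ∂(volume.prod volume) := by
  have h1 : ∀ i : Idx d, ‖A (onb d i)‖ₑ ^ 2 = ∫⁻ x, ‖∫ y, K (x, y) * onb d i y‖ₑ ^ 2 := by
    intro i
    rw [enorm_sq_eq_lintegral]
    refine lintegral_congr_ae ?_
    filter_upwards [h.2 (onb d i)] with x hx
    rw [hx]
  rw [hsSq]
  simp_rw [h1]
  rw [← lintegral_tsum fun i =>
    ((aestronglyMeasurable_kernel_integral h.1.1 _).enorm.pow_const 2),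
    lintegral_prod _ (h.1.1.enorm.pow_const 2)]
  refine lintegral_congr_ae ?_
  filter_upwards [memLp_slice h.1] with x hx
  -- For almost every x the i-th integral pairs eᵢ with the conjugated slice K(x, ·), so the sum
  -- over i is Parseval.
  have h3 : ∀ i : Idx d, ∫ y, K (x, y) * onb d i y = ⟪star hx.toLp, onb d i⟫ := by
    intro i
    rw [L2.inner_def]
    refine integral_congr_ae ?_
    filter_upwards [Lp.coeFn_star hx.toLp, hx.coeFn_toLp] with y h1 h2
    rw [h1, Pi.star_apply, h2]
    simp [mul_comm]
  simp_rw [h3]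
  rw [tsum_enorm_inner_onb', enorm_star_L2, Lp.enorm_toLp, lintegral_enorm_sq]

theorem HasKernel.hsNorm_eq {A : Op d} {K : E d × E d → ℂ} (h : HasKernel A K) :
    hsNorm A = eLpNorm K 2 (volume.prod volume) := by
  rw [HFB.hsNorm_eq, h.hsSq_eq, lintegral_enorm_sq, sq_rpow_half]

theorem HasKernel.hs {A : Op d} {K : E d × E d → ℂ} (h : HasKernel A K) : HS A := by
  rw [HS, h.hsNorm_eq]; exact h.1.2

theorem HasKernel.ae_eq {A : Op d} {K L : E d × E d → ℂ} (hK : HasKernel A K)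
    (hL : HasKernel A L) : K =ᵐ[volume.prod volume] L := by
  have h := (hK.sub hL).hsNorm_eq
  rw [sub_self, hsNorm_zero] at h
  have := (eLpNorm_eq_zero_iff (hK.1.1.sub hL.1.1) (by simp)).1 h.symm
  filter_upwards [this] with p hp
  simpa [sub_eq_zero] using hp

theorem HasKernel.op_eq {A B : Op d} {K : E d × E d → ℂ} (hA : HasKernel A K)
    (hB : HasKernel B K) : A = B := by
  ext1 f
  apply Lp.ext
  filter_upwards [hA.2 f, hB.2 f] with x h1 h2
  rw [h1, h2]

theorem memLp_tensor (f g : L2 d) :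
    MemLp (fun p : E d × E d => f p.1 * star (g p.2)) 2 (volume.prod volume) := by
  have hm : AEStronglyMeasurable (fun p : E d × E d => f p.1 * star (g p.2))
      (volume.prod volume) :=
    (Lp.aestronglyMeasurable f).comp_fst.mul (Lp.aestronglyMeasurable g).comp_snd.star
  rw [memLp_two_iff hm, lintegral_prod _ (hm.enorm.pow_const 2)]
  simp only [enorm_mul, mul_pow]
  have : ∀ x : E d, ∫⁻ y, ‖f x‖ₑ ^ 2 * ‖star (g y)‖ₑ ^ 2 = ‖f x‖ₑ ^ 2 * ‖g‖ₑ ^ 2 := by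
    intro x
    rw [lintegral_const_mul' _ _ (by simp), enorm_sq_eq_lintegral]
    simp [← ofReal_norm]
  simp_rw [this]
  rw [lintegral_mul_const' _ _ (by simp), ← enorm_sq_eq_lintegral]
  exact ENNReal.mul_lt_top (by simp) (by simp)

theorem hasKernel_ketbra (f g : L2 d) :
    HasKernel (ketbra f g) fun p => f p.1 * star (g p.2) := by
  refine ⟨memLp_tensor f g, fun h => ?_⟩
  filter_upwards [Lp.coeFn_smul ⟪g, h⟫ f] with x hx
  rw [ketbra_apply, hx, Pi.smul_apply, smul_eq_mul, mul_comm, L2.inner_def, ← integral_const_mul]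
  refine integral_congr_ae (Eventually.of_forall fun y => ?_)
  simp
  ring

/-- The partial sums of the expansion of an operator in the basis. -/
def basisTrunc (A : Op d) (s : Finset (Idx d)) : Op d :=
  ∑ i ∈ s, ketbra (A (onb d i)) (onb d i)

theorem basisTrunc_apply_onb (A : Op d) (s : Finset (Idx d)) (j : Idx d) [Decidable (j ∈ s)] :
    basisTrunc A s (onb d j) = if j ∈ s then A (onb d j) else 0 := by
  classical
  have h := orthonormal_iff_ite.1 (onb d).orthonormal
  simp only [basisTrunc, sum_apply, ketbra_apply]
  have : ∀ i : Idx d, ⟪onb d i, onb d j⟫ = if i = j then 1 else 0 := fun i => h i j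
  simp_rw [this]
  simp

theorem hsSq_basisTrunc (A : Op d) (s : Finset (Idx d)) :
    hsSq (basisTrunc A s) = ∑ i ∈ s, ‖A (onb d i)‖ₑ ^ 2 := by
  classical
  rw [hsSq, tsum_eq_sum (s := s)]
  · refine Finset.sum_congr rfl fun i hi => ?_
    rw [basisTrunc_apply_onb, if_pos hi]
  · intro i hi
    rw [basisTrunc_apply_onb, if_neg hi]
    simp

theorem HS.tendsto_basisTrunc {A : Op d} (h : HS A) :
    Tendsto (fun s => hsNorm (A - basisTrunc A s)) atTop (𝓝 0) := by
  classical
  have h1 : ∀ s, hsSq (A - basisTrunc A s) = ∑' i : { i // i ∉ s }, ‖A (onb d i)‖ₑ ^ 2 := by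
    intro s
    rw [hsSq, ← tsum_subtype_eq_of_support_subset (s := { i | i ∉ s })]
    · refine tsum_congr fun i => ?_
      rw [sub_apply, basisTrunc_apply_onb, if_neg i.2, sub_zero]
    · intro i hi hc
      apply hi
      change ‖(A - basisTrunc A s) (onb d i)‖ₑ ^ 2 = 0
      rw [sub_apply, basisTrunc_apply_onb, if_pos hc]
      simp
  have h2 := ENNReal.tendsto_tsum_compl_atTop_zero (hsNorm_lt_top_iff.1 h).ne
  simp_rw [← h1] at h2
  have h3 := h2.ennrpow_const (1 / 2 : ℝ)
  simpa [HFB.hsNorm_eq] using h3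

/-- The kernel is the L² sum of the tensors Aeᵢ ⊗ ēᵢ, whose finite partial sums have squared norm ∑
‖Aeᵢ‖². The operator of the limit kernel and A are both Hilbert-Schmidt limits of the same
truncations, hence equal. -/
theorem HS.exists_hasKernel {A : Op d} (h : HS A) : ∃ K, HasKernel A K := by
  classical
  let κ : Idx d → Lp ℂ 2 ((volume : Measure (E d)).prod volume) :=
    fun i => (memLp_tensor (A (onb d i)) (onb d i)).toLp
  have hκ : ∀ s, HasKernel (basisTrunc A s) (⇑(∑ i ∈ s, κ i)) := by
    intro s
    have h1 := HasKernel.sum s fun i => hasKernel_ketbra (A (onb d i)) (onb d i)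
    refine h1.congr ?_
    induction s using Finset.induction_on with
    | empty =>
      simp only [Finset.sum_empty]
      exact (Lp.coeFn_zero _ _ _).symm
    | insert i s hi ih =>
      rw [Finset.sum_insert hi, Finset.sum_insert hi]
      have ih' := ih (HasKernel.sum s fun i => hasKernel_ketbra (A (onb d i)) (onb d i))
      filter_upwards [ih', Lp.coeFn_add (κ i) (∑ j ∈ s, κ j),
        (memLp_tensor (A (onb d i)) (onb d i)).coeFn_toLp] with p h2 h3 h4
      rw [h3, Pi.add_apply, Pi.add_apply, h2, h4]
  have hsum : Summable κ := by
    rw [summable_iff_vanishing_norm]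
    intro ε hε
    have hs : Summable fun i : Idx d => ‖A (onb d i)‖ ^ 2 := by
      refine summable_of_tsum_enorm ?_
      have := (hsNorm_lt_top_iff.1 h).ne
      simpa [hsSq, enorm_pow] using this
    obtain ⟨s, hs⟩ := summable_iff_vanishing_norm.1 hs (ε ^ 2) (by positivity)
    refine ⟨s, fun t ht => ?_⟩
    have h1 := (hκ t).hsNorm_eq
    rw [← Lp.enorm_def] at h1
    have h2 : ‖∑ i ∈ t, κ i‖ₑ ^ 2 = ENNReal.ofReal (∑ i ∈ t, ‖A (onb d i)‖ ^ 2) := by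
      rw [← h1, hsNorm_sq, hsSq_basisTrunc, ENNReal.ofReal_sum_of_nonneg (fun i _ => by positivity)]
      simp [ENNReal.ofReal_pow]
    have h3 := hs t ht
    rw [Real.norm_of_nonneg (Finset.sum_nonneg fun i _ => by positivity)] at h3
    rw [← ofReal_norm, ← ENNReal.ofReal_pow (norm_nonneg _),
      ENNReal.ofReal_eq_ofReal_iff (by positivity)
        (Finset.sum_nonneg fun i _ => by positivity)] at h2
    rw [← h2] at h3
    exact lt_of_pow_lt_pow_left₀ 2 hε.le h3
  obtain ⟨K, hK⟩ := hsum
  obtain ⟨B, hB⟩ := HFB.exists_hasKernel (Lp.memLp K)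
  refine ⟨K, ?_⟩
  suffices A = B by rwa [this]
  have h1 : Tendsto (fun s => hsNorm (B - basisTrunc A s)) atTop (𝓝 0) := by
    have h2 : ∀ s, hsNorm (B - basisTrunc A s) = ‖K - ∑ i ∈ s, κ i‖ₑ := by
      intro s
      rw [(hB.sub (hκ s)).hsNorm_eq, Lp.enorm_def]
      exact eLpNorm_congr_ae (Lp.coeFn_sub _ _).symm
    simp_rw [h2]
    have h3 : Tendsto (fun s => K - ∑ i ∈ s, κ i) atTop (𝓝 (K - K)) := tendsto_const_nhds.sub hK
    rw [sub_self] at h3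
    simpa using h3.enorm
  have h2 : hsNorm (A - B) = 0 := by
    refine le_antisymm ?_ bot_le
    have h4 : ∀ s, hsNorm (A - B) ≤ hsNorm (A - basisTrunc A s) + hsNorm (B - basisTrunc A s) := by
      intro s
      have : A - B = (A - basisTrunc A s) + (-1 : ℂ) • (B - basisTrunc A s) := by simp
      rw [this]
      refine (hsNorm_add_le _ _).trans_eq ?_
      rw [hsNorm_smul]
      simp
    have h5 := h.tendsto_basisTrunc.add h1
    rw [add_zero] at h5
    exact ge_of_tendsto' h5 h4
  have h3 := opNorm_le_hsNorm (A - B)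
  rw [h2, ← ofReal_norm] at h3
  have h4 : ‖A - B‖ ≤ 0 := ENNReal.ofReal_eq_zero.1 (le_antisymm h3 bot_le)
  exact sub_eq_zero.1 (norm_le_zero_iff.1 h4)

theorem hasKernel_kernel {A : Op d} (h : HS A) : HasKernel A (kernel A) := by
  have h1 := h.exists_hasKernel
  rw [kernel, dif_pos h1]
  exact h1.choose_spec

theorem HasKernel.kernel_ae_eq {A : Op d} {K : E d × E d → ℂ} (h : HasKernel A K) :
    kernel A =ᵐ[volume.prod volume] K := (hasKernel_kernel h.hs).ae_eq h

theorem hasKernel_opOfKernel {K : E d × E d → ℂ} (hK : MemLp K 2 (volume.prod volume)) :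
    HasKernel (opOfKernel K) K := by
  have h1 := HFB.exists_hasKernel hK
  rw [opOfKernel, dif_pos h1]
  exact h1.choose_spec

theorem HasKernel.hasSum_normSq {A : Op d} {K : Lp ℂ 2 ((volume : Measure (E d)).prod volume)}
    (h : HasKernel A K) : HasSum (fun i => ‖A (onb d i)‖ ^ 2) (‖K‖ ^ 2) := by
  have h1 : hsSq A = ‖K‖ₑ ^ 2 := by
    rw [← hsNorm_sq, h.hsNorm_eq, Lp.enorm_def]
  have hs : Summable fun i : Idx d => ‖A (onb d i)‖ ^ 2 := by
    refine summable_of_tsum_enorm ?_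
    have := (hsNorm_lt_top_iff.1 h.hs).ne
    simpa [hsSq, enorm_pow] using this
  have h2 : ENNReal.ofReal (∑' i, ‖A (onb d i)‖ ^ 2) = ENNReal.ofReal (‖K‖ ^ 2) := by
    rw [ENNReal.ofReal_tsum_of_nonneg (fun i => by positivity) hs,
      ENNReal.ofReal_pow (norm_nonneg _), ofReal_norm, ← h1, hsSq]
    simp [ENNReal.ofReal_pow]
  rw [ENNReal.ofReal_eq_ofReal_iff (tsum_nonneg fun i => by positivity) (by positivity)] at h2
  rw [← h2]
  exact hs.hasSum

/-- Polarization of the norm identity `HasKernel.hasSum_normSq`. -/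
theorem HasKernel.hasSum_inner {A B : Op d} {K L : Lp ℂ 2 ((volume : Measure (E d)).prod volume)}
    (hA : HasKernel A K) (hB : HasKernel B L) :
    HasSum (fun i => ⟪B (onb d i), A (onb d i)⟫) ⟪L, K⟫ := by
  have hadd : HasKernel (B + A) (L + K :) := (hB.add hA).congr (Lp.coeFn_add _ _).symm
  have hsub : HasKernel (B - A) (L - K :) := (hB.sub hA).congr (Lp.coeFn_sub _ _).symm
  have hI : HasKernel (Complex.I • A) (Complex.I • K :) :=
    (hA.smul _).congr (Lp.coeFn_smul _ _).symm
  have haddI : HasKernel (B + Complex.I • A) (L + Complex.I • K :) :=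
    (hB.add hI).congr (Lp.coeFn_add _ _).symm
  have hsubI : HasKernel (B - Complex.I • A) (L - Complex.I • K :) :=
    (hB.sub hI).congr (Lp.coeFn_sub _ _).symm
  have e : ∀ {A : Op d} {K : Lp ℂ 2 ((volume : Measure (E d)).prod volume)}, HasKernel A K →
      HasSum (fun i => ((‖A (onb d i)‖ : ℂ)) ^ 2) ((‖K‖ : ℂ) ^ 2) := by
    intro A K h
    exact_mod_cast Complex.hasSum_ofReal.2 h.hasSum_normSq
  have := (((e hadd).sub (e hsub)).add (((e hsubI).sub (e haddI)).mul_right Complex.I)).div_const 4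
  rw [inner_eq_sum_norm_sq_div_four L K]
  simp_rw [fun i => inner_eq_sum_norm_sq_div_four (𝕜 := ℂ) (B (onb d i)) (A (onb d i))]
  exact this

theorem trace_mul_star_eq_integral {A B : Op d} {K L : E d × E d → ℂ} (hA : HasKernel A K)
    (hB : HasKernel B L) :
    trace (A * star B) = ∫ p, K p * star (L p) ∂(volume.prod volume) := by
  have h1 := (hA.congr hA.1.coeFn_toLp.symm).hasSum_inner (hB.congr hB.1.coeFn_toLp.symm)
  rw [trace_mul_eq_tsum hA.hs hB.hs.star, star_star, h1.tsum_eq, L2.inner_def]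
  refine integral_congr_ae ?_
  filter_upwards [hA.1.coeFn_toLp, hB.1.coeFn_toLp] with p h2 h3
  rw [h2, h3]
  rfl

theorem HasKernel.inner_eq {A : Op d} {K : E d × E d → ℂ} (h : HasKernel A K) (f g : L2 d) :
    ⟪f, A g⟫ = ∫ p, K p * (star (f p.1) * g p.2) ∂(volume.prod volume) := by
  have h1 := trace_mul_star_eq_integral h (hasKernel_ketbra f g)
  rw [star_ketbra, mul_ketbra, trace_ketbra] at h1
  rw [h1]
  simp

theorem star_coe_L2 (f : L2 d) : ⇑(star f) =ᵐ[volume] fun x => star (f x) := Lp.coeFn_star f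

theorem ae_prod_fst {p : E d → Prop} (h : ∀ᵐ x, p x) :
    ∀ᵐ z ∂((volume : Measure (E d)).prod (volume : Measure (E d))), p z.1 :=
  Measure.quasiMeasurePreserving_fst.ae h

theorem ae_prod_snd {p : E d → Prop} (h : ∀ᵐ x, p x) :
    ∀ᵐ z ∂((volume : Measure (E d)).prod (volume : Measure (E d))), p z.2 :=
  Measure.quasiMeasurePreserving_snd.ae h

theorem memLp_swap {K : E d × E d → ℂ} (hK : MemLp K 2 (volume.prod volume)) :
    MemLp (fun p => K p.swap) 2 (volume.prod volume) :=
  hK.comp_measurePreserving (Measure.measurePreserving_swap)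

protected theorem HasKernel.transp {A : Op d} {K : E d × E d → ℂ} (h : HasKernel A K) :
    HasKernel (transp A) fun p => K p.swap := by
  obtain ⟨B, hB⟩ := HFB.exists_hasKernel (memLp_swap h.1)
  suffices HFB.transp A = B by rwa [this]
  ext1 g
  refine ext_inner_left ℂ fun f => ?_
  have h1 : ⟪f, HFB.transp A g⟫ = ⟪star g, A (star f)⟫ := by
    rw [transp_apply, ← inner_adj, ← inner_star_star, star_star]
  rw [h1, h.inner_eq, hB.inner_eq,
    ← integral_prod_swap (fun p : E d × E d => K p * (star ((star g : L2 d) p.1) * (star f : L2 d) p.2))]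
  refine integral_congr_ae ?_
  filter_upwards [ae_prod_fst (star_coe_L2 f), ae_prod_snd (star_coe_L2 g)] with p h2 h3
  simp only [Prod.fst_swap, Prod.snd_swap]
  rw [h2, h3, star_star, mul_comm (g p.2)]

protected theorem HasKernel.star {A : Op d} {K : E d × E d → ℂ} (h : HasKernel A K) :
    HasKernel (star A) fun p => star (K p.swap) := by
  rw [← conj_transp]
  exact h.transp.conj

/-! ### Multiplication operators -/

theorem exists_mulOp {w : E d → ℂ} (hw : AEStronglyMeasurable w volume) {C : ℝ}
    (hC : ∀ᵐ x, ‖w x‖ ≤ C) :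
    ∃ A : Op d, ∀ f : L2 d, ⇑(A f) =ᵐ[volume] fun x => w x * f x := by
  have hm : ∀ f : L2 d, MemLp (fun x => w x * f x) 2 volume := fun f =>
    (Lp.memLp f).of_le_mul (c := C) (hw.mul (Lp.aestronglyMeasurable f)) (by
      filter_upwards [hC] with x hx
      rw [norm_mul]
      gcongr)
  let L : L2 d →ₗ[ℂ] L2 d :=
    { toFun := fun f => (hm f).toLp
      map_add' := fun f g => by
        apply Lp.ext
        filter_upwards [(hm (f + g)).coeFn_toLp, (hm f).coeFn_toLp, (hm g).coeFn_toLp,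
          Lp.coeFn_add (hm f).toLp (hm g).toLp, Lp.coeFn_add f g] with x h1 h2 h3 h4 h5
        rw [h1, h4, Pi.add_apply, h2, h3, h5, Pi.add_apply, mul_add]
      map_smul' := fun c f => by
        apply Lp.ext
        filter_upwards [(hm (c • f)).coeFn_toLp, (hm f).coeFn_toLp,
          Lp.coeFn_smul c (hm f).toLp, Lp.coeFn_smul c f] with x h1 h2 h4 h5
        rw [h1, RingHom.id_apply, h4, Pi.smul_apply, h2, h5, Pi.smul_apply, smul_eq_mul,
          smul_eq_mul]
        ring }
  refine ⟨L.mkContinuous (max C 0) fun f => ?_, fun f => (hm f).coeFn_toLp⟩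
  refine Lp.norm_le_mul_norm_of_ae_le_mul ?_
  filter_upwards [hC, (hm f).coeFn_toLp] with x hx h1
  change ‖(((hm f).toLp _ : L2 d) : E d → ℂ) x‖ ≤ _
  rw [h1, norm_mul]
  gcongr
  exact hx.trans (le_max_left _ _)

theorem mulOp_apply {w : E d → ℂ} (hw : AEStronglyMeasurable w volume) {C : ℝ}
    (hC : ∀ᵐ x, ‖w x‖ ≤ C) (f : L2 d) : ⇑(mulOp w f) =ᵐ[volume] fun x => w x * f x := by
  have h := exists_mulOp hw hC
  rw [mulOp, dif_pos h]
  exact h.choose_spec f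

theorem norm_mulOp_le {w : E d → ℂ} (hw : AEStronglyMeasurable w volume) {C : ℝ} (h0 : 0 ≤ C)
    (hC : ∀ᵐ x, ‖w x‖ ≤ C) : ‖mulOp w‖ ≤ C := by
  refine ContinuousLinearMap.opNorm_le_bound _ h0 fun f => Lp.norm_le_mul_norm_of_ae_le_mul ?_
  filter_upwards [hC, mulOp_apply hw hC f] with x hx h1
  rw [h1, norm_mul]
  gcongr

theorem inner_mulOp {w : E d → ℂ} (hw : AEStronglyMeasurable w volume) {C : ℝ}
    (hC : ∀ᵐ x, ‖w x‖ ≤ C) (f g : L2 d) : ⟪f, mulOp w g⟫ = ∫ x, w x * (g x * star (f x)) := by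
  rw [L2.inner_def]
  refine integral_congr_ae ?_
  filter_upwards [mulOp_apply hw hC g] with x h1
  rw [h1]
  simp only [RCLike.inner_apply, ← starRingEnd_apply]
  ring

theorem star_mulOp {w : E d → ℂ} (hw : AEStronglyMeasurable w volume) {C : ℝ}
    (hC : ∀ᵐ x, ‖w x‖ ≤ C) : star (mulOp w) = mulOp fun x => star (w x) := by
  ext1 f
  refine ext_inner_left ℂ fun g => ?_
  rw [inner_adj', inner_mulOp (w := fun x => star (w x)) hw.star (C := C) (by simpa using hC),
    ← inner_conj_symm, inner_mulOp hw hC, ← integral_conj]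
  refine integral_congr_ae (Eventually.of_forall fun x => ?_)
  simp only [← starRingEnd_apply, map_mul, Complex.conj_conj]
  ring

/-! ### Densities -/

theorem lintegral_enorm_mul_le (f g : L2 d) : ∫⁻ x, ‖f x * star (g x)‖ₑ ≤ ‖f‖ₑ * ‖g‖ₑ := by
  simp only [enorm_mul]
  have := ENNReal.lintegral_mul_le_Lp_mul_Lq (μ := (volume : Measure (E d)))
    (p := 2) (q := 2) (Real.HolderConjugate.two_two) (f := fun x => ‖f x‖ₑ)
    (g := fun x => ‖star (g x)‖ₑ) (Lp.aestronglyMeasurable f).enorm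
    (Lp.aestronglyMeasurable g).star.enorm
  refine this.trans_eq ?_
  have h : ∀ f : L2 d, (∫⁻ x, ‖f x‖ₑ ^ (2 : ℝ)) ^ (1 / 2 : ℝ) = ‖f‖ₑ := fun f => by
    simp only [ENNReal.rpow_ofNat]
    rw [← enorm_sq_eq_lintegral, sq_rpow_half]
  rw [h, ← h g]
  simp [← ofReal_norm]

/-- The density of `∑ |xᵢ⟩⟨yᵢ|`. -/
def repDensity (x y : ℕ → L2 d) (z : E d) : ℂ := ∑' i, x i z * star (y i z)

theorem aestronglyMeasurable_tensor (f g : L2 d) :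
    AEStronglyMeasurable (fun z => f z * star (g z)) volume :=
  (Lp.aestronglyMeasurable f).mul (Lp.aestronglyMeasurable g).star

theorem integrable_repDensity {x y : ℕ → L2 d} (hs : ∑' i, ‖x i‖ₑ * ‖y i‖ₑ < ⊤) :
    Integrable (repDensity x y) := by
  have h1 : ∫⁻ z, ∑' i, ‖x i z * star (y i z)‖ₑ < ⊤ := by
    rw [lintegral_tsum fun i => (aestronglyMeasurable_tensor _ _).enorm]
    exact (ENNReal.tsum_le_tsum fun i => lintegral_enorm_mul_le _ _).trans_lt hs
  have h2 := ae_lt_top' (AEMeasurable.tsum fun i =>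
    (aestronglyMeasurable_tensor (x i) (y i)).enorm) h1.ne
  refine ⟨aestronglyMeasurable_of_tendsto_ae atTop
    (f := fun n z => ∑ i ∈ Finset.range n, x i z * star (y i z)) (fun n => ?_) ?_, ?_⟩
  · exact Finset.aestronglyMeasurable_fun_sum _ fun i _ => aestronglyMeasurable_tensor _ _
  · filter_upwards [h2] with z hz
    exact (summable_of_tsum_enorm hz.ne).hasSum.tendsto_sum_nat
  · exact (lintegral_mono fun z => enorm_tsum_le_tsum_enorm).trans_lt h1

theorem integral_mul_repDensity {x y : ℕ → L2 d} (hs : ∑' i, ‖x i‖ₑ * ‖y i‖ₑ < ⊤)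
    {w : E d → ℂ} (hw : AEStronglyMeasurable w volume) {C : ℝ} (hC : ∀ᵐ x, ‖w x‖ ≤ C) :
    ∫ z, w z * repDensity x y z = ∑' i, ⟪y i, mulOp w (x i)⟫ := by
  simp_rw [inner_mulOp hw hC, repDensity]
  rw [← integral_tsum]
  · refine integral_congr_ae (Eventually.of_forall fun z => ?_)
    exact tsum_mul_left.symm
  · exact fun i => hw.mul (aestronglyMeasurable_tensor _ _)
  · refine ne_top_of_le_ne_top (b := ENNReal.ofReal C * ∑' i, ‖x i‖ₑ * ‖y i‖ₑ)
      (ENNReal.mul_ne_top (by simp) hs.ne) ?_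
    rw [← ENNReal.tsum_mul_left]
    refine ENNReal.tsum_le_tsum fun i => ?_
    refine le_trans ?_ (mul_le_mul_right (lintegral_enorm_mul_le _ _) _)
    rw [← lintegral_const_mul' _ _ (by simp)]
    refine lintegral_mono_ae ?_
    filter_upwards [hC] with z hz
    rw [enorm_mul]
    gcongr
    rw [← ofReal_norm]
    exact ENNReal.ofReal_le_ofReal hz

theorem IsRep.trace_mulOp {A : Op d} {x y : ℕ → L2 d} (hr : IsRep A x y)
    (hs : ∑' i, ‖x i‖ₑ * ‖y i‖ₑ < ⊤) {w : E d → ℂ} (hw : AEStronglyMeasurable w volume) {C : ℝ}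
    (hC : ∀ᵐ x, ‖w x‖ ≤ C) : trace (mulOp w * A) = ∫ z, w z * repDensity x y z := by
  rw [integral_mul_repDensity hs hw hC, (hr.mul_left (mulOp w)).trace_eq]
  refine lt_of_le_of_lt (b := ‖mulOp w‖ₑ * (∑' i, ‖x i‖ₑ * ‖y i‖ₑ)) ?_
    (ENNReal.mul_lt_top (by simp) hs)
  rw [← ENNReal.tsum_mul_left]
  refine ENNReal.tsum_le_tsum fun i => ?_
  rw [← mul_assoc]
  gcongr
  exact enorm_apply_le _ _

theorem setIntegral_eq_integral_indicator_mul (n : E d → ℂ) {A : Set (E d)}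
    (hA : MeasurableSet A) : ∫ x in A, n x = ∫ x, A.indicator (fun _ => (1 : ℂ)) x * n x := by
  rw [← integral_indicator hA]
  refine integral_congr_ae (Eventually.of_forall fun z => ?_)
  by_cases hz : z ∈ A <;> simp [hz]

/-- Integrable functions with equal integrals over all measurable sets agree almost everywhere. So
the chosen density may be replaced by the concrete series of any nuclear representation. -/
theorem IsRep.density_ae_eq {A : Op d} {x y : ℕ → L2 d} (hr : IsRep A x y)
    (hs : ∑' i, ‖x i‖ₑ * ‖y i‖ₑ < ⊤) : density A =ᵐ[volume] repDensity x y := by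
  have h0 : ∀ s : Set (E d), MeasurableSet s →
      ∫ z in s, repDensity x y z = trace (mulOp (s.indicator fun _ => 1) * A) := by
    intro s hms
    rw [hr.trace_mulOp hs (C := 1) (aestronglyMeasurable_const.indicator hms) (Eventually.of_forall
      fun z => ?_), setIntegral_eq_integral_indicator_mul _ hms]
    by_cases hz : z ∈ s <;> simp [hz]
  have h : ∃ n : E d → ℂ, Integrable n ∧ ∀ s : Set (E d), MeasurableSet s →
      ∫ x in s, n x = trace (mulOp (s.indicator fun _ => 1) * A) :=
    ⟨_, integrable_repDensity hs, h0⟩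
  rw [density, dif_pos h]
  refine Integrable.ae_eq_of_forall_setIntegral_eq _ _ h.choose_spec.1 (integrable_repDensity hs)
    fun s hms _ => ?_
  rw [h.choose_spec.2 s hms, h0 s hms]

/-! ### The operator `J` -/

open FourierTransform SchwartzMap

theorem J_apply (f : L2 d) : J d f = (Lp.fourierTransformₗᵢ (E d) ℂ).symm
    (mulOp (fun ξ : E d => (((1 + (2 * Real.pi * ‖ξ‖) ^ 2) ^ (-(1 / 2) : ℝ) : ℝ) : ℂ))
      (Lp.fourierTransformₗᵢ (E d) ℂ f)) := rfl

/-- The Fourier multiplier of `J`. -/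
def jMul (ξ : E d) : ℝ := (1 + (2 * Real.pi * ‖ξ‖) ^ 2) ^ (-(1 / 2) : ℝ)

theorem jMul_pos (ξ : E d) : 0 < jMul ξ := Real.rpow_pos_of_pos (by positivity) _

theorem jMul_le_one (ξ : E d) : jMul ξ ≤ 1 :=
  Real.rpow_le_one_of_one_le_of_nonpos (by nlinarith [sq_nonneg (2 * Real.pi * ‖ξ‖)]) (by norm_num)

theorem jMul_neg (ξ : E d) : jMul (-ξ) = jMul ξ := by simp [jMul]

theorem measurable_jMul : Measurable (jMul (d := d)) := by
  unfold jMul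
  fun_prop

theorem aesm_jMul : AEStronglyMeasurable (fun ξ : E d => (jMul ξ : ℂ)) volume :=
  (Complex.measurable_ofReal.comp measurable_jMul).aestronglyMeasurable

theorem jMul_bound : ∀ᵐ ξ : E d, ‖(jMul ξ : ℂ)‖ ≤ 1 := Eventually.of_forall fun ξ => by
  rw [Complex.norm_real, Real.norm_of_nonneg (jMul_pos ξ).le]
  exact jMul_le_one ξ

theorem J_apply' (f : L2 d) : J d f = 𝓕⁻ (mulOp (fun ξ : E d => (jMul ξ : ℂ)) (𝓕 f)) := rfl

theorem mulOp_jMul (f : L2 d) :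
    ⇑(mulOp (fun ξ : E d => (jMul ξ : ℂ)) f) =ᵐ[volume] fun ξ => (jMul ξ : ℂ) * f ξ :=
  mulOp_apply aesm_jMul jMul_bound f

theorem inner_fourierInv_left (f g : L2 d) : ⟪𝓕⁻ f, g⟫ = ⟪f, 𝓕 g⟫ := by
  rw [← Lp.inner_fourier_eq, fourier_fourierInv_eq]

@[simp] theorem star_J : star (J d) = J d := by
  ext1 f
  refine ext_inner_left ℂ fun g => ?_
  rw [inner_adj', J_apply', J_apply', inner_fourierInv_left, ← inner_adj',
    star_mulOp aesm_jMul jMul_bound]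
  have : (fun x : E d => star (jMul x : ℂ)) = fun x => (jMul x : ℂ) := by
    ext x
    simp
  rw [this, ← inner_conj_symm, ← inner_fourierInv_left, inner_conj_symm]

theorem norm_J_le : ‖J d‖ ≤ 1 := by
  refine ContinuousLinearMap.opNorm_le_bound _ zero_le_one fun f => ?_
  rw [J_apply]
  rw [LinearIsometryEquiv.norm_map]
  have := (mulOp (fun ξ : E d => (jMul ξ : ℂ))).le_of_opNorm_le
    (norm_mulOp_le aesm_jMul zero_le_one jMul_bound) (𝓕 f)
  refine this.trans_eq ?_
  rw [Lp.norm_fourier_eq]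

theorem J_injective : Function.Injective (J d) := by
  rw [injective_iff_map_eq_zero]
  intro f hf
  rw [J_apply, LinearIsometryEquiv.map_eq_zero_iff] at hf
  have h1 := mulOp_jMul (𝓕 f)
  have h2 : mulOp (fun ξ : E d => (jMul ξ : ℂ)) (𝓕 f) = 0 := hf
  rw [h2] at h1
  have h3 : 𝓕 f = 0 := by
    apply Lp.ext
    filter_upwards [h1, Lp.coeFn_zero ℂ 2 (volume : Measure (E d))] with ξ h4 h5
    rw [h5] at h4 ⊢
    have := (jMul_pos ξ).ne'
    simpa [this] using h4.symm
  have := congrArg (fun g : L2 d => 𝓕⁻ g) h3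
  simpa using this

theorem J_inner (f g : L2 d) : ⟪J d f, g⟫ = ⟪f, J d g⟫ := by
  rw [← inner_adj, star_J]

/-- The orthogonal complement of the range of a self-adjoint operator is its kernel, which is
trivial here. -/
theorem J_denseRange : DenseRange (J d) := by
  have h : (LinearMap.range (J d).toLinearMap)ᗮ = ⊥ := by
    rw [Submodule.eq_bot_iff]
    intro x hx
    apply J_injective
    rw [map_zero]
    refine ext_inner_left ℂ fun y => ?_
    rw [← J_inner, inner_zero_right]
    exact (Submodule.mem_orthogonal _ _).1 hx _ ⟨y, rfl⟩
  have := (Submodule.topologicalClosure_eq_top_iff).2 h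
  rw [DenseRange, dense_iff_closure_eq]
  exact congrArg (fun S : Submodule ℂ (L2 d) => (S : Set (L2 d))) this

theorem toLp_coe (f : 𝓢(E d, ℂ)) : ⇑(f.toLp 2 : L2 d) =ᵐ[volume] f := f.coeFn_toLp 2

theorem denseRange_toLp : DenseRange (fun f : 𝓢(E d, ℂ) => (f.toLp 2 : L2 d)) :=
  SchwartzMap.denseRange_toLpCLM (F := ℂ) (p := 2) (μ := (volume : Measure (E d))) ENNReal.ofNat_ne_top

/-- Both sides are continuous in f, so it suffices to conjugate the Fourier integral of a Schwartz
function. -/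
theorem star_fourier (f : L2 d) : star (𝓕 f) = 𝓕⁻ (star f) := by
  refine denseRange_toLp.induction_on (p := fun f : L2 d => star (𝓕 f) = 𝓕⁻ (star f)) f ?_ ?_
  · refine isClosed_eq (continuous_star_L2.comp (Lp.fourierTransformₗᵢ (E d) ℂ).continuous)
      ((Lp.fourierTransformₗᵢ (E d) ℂ).symm.continuous.comp continuous_star_L2)
  · intro f
    let g : 𝓢(E d, ℂ) := f.postcompCLM (𝕜 := ℝ) (Complex.conjCLE : ℂ →L[ℝ] ℂ)
    have hg : star (f.toLp 2 : L2 d) = g.toLp 2 := by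
      apply Lp.ext
      filter_upwards [star_coe_L2 (f.toLp 2 : L2 d), toLp_coe f, toLp_coe g] with x h1 h2 h3
      rw [h1, h2, h3]
      rfl
    rw [hg, SchwartzMap.toLp_fourier_eq, SchwartzMap.toLp_fourierInv_eq]
    apply Lp.ext
    filter_upwards [star_coe_L2 ((𝓕 f).toLp 2 : L2 d), toLp_coe (𝓕 f), toLp_coe (𝓕⁻ g)]
      with x h1 h2 h3
    rw [h1, h2, h3, SchwartzMap.fourier_coe, SchwartzMap.fourierInv_coe, Real.fourier_eq',
      Real.fourierInv_eq', ← starRingEnd_apply, ← integral_conj]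
    refine integral_congr_ae (Eventually.of_forall fun v => ?_)
    change _ = _ • (starRingEnd ℂ) (f v)
    simp only [smul_eq_mul, map_mul, ← Complex.exp_conj]
    congr 2
    simp [Complex.conj_ofNat]

/-- The reflection `f ↦ f(-·)`. -/
def reflL2 (f : L2 d) : L2 d :=
  Lp.compMeasurePreserving (fun x => -x) (Measure.measurePreserving_neg volume) f

theorem reflL2_coe (f : L2 d) : ⇑(reflL2 f) =ᵐ[volume] fun x => f (-x) :=
  Lp.coeFn_compMeasurePreserving f _

theorem continuous_reflL2 : Continuous (reflL2 (d := d)) :=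
  (Lp.isometry_compMeasurePreserving (Measure.measurePreserving_neg volume)).continuous

theorem ae_neg {p : E d → Prop} (h : ∀ᵐ x, p x) : ∀ᵐ x : E d, p (-x) :=
  (Measure.measurePreserving_neg (volume : Measure (E d))).quasiMeasurePreserving.ae h

theorem fourierInv_eq_refl (f : L2 d) : 𝓕⁻ f = reflL2 (𝓕 f) := by
  refine denseRange_toLp.induction_on (p := fun f : L2 d => 𝓕⁻ f = reflL2 (𝓕 f)) f ?_ ?_
  · exact isClosed_eq (Lp.fourierTransformₗᵢ (E d) ℂ).symm.continuous
      (continuous_reflL2.comp (Lp.fourierTransformₗᵢ (E d) ℂ).continuous)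
  · intro f
    rw [SchwartzMap.toLp_fourier_eq, SchwartzMap.toLp_fourierInv_eq]
    apply Lp.ext
    filter_upwards [reflL2_coe ((𝓕 f).toLp 2 : L2 d), ae_neg (toLp_coe (𝓕 f)), toLp_coe (𝓕⁻ f)]
      with x h1 h2 h3
    rw [h1, h2, h3, SchwartzMap.fourier_coe, SchwartzMap.fourierInv_coe,
      Real.fourierInv_eq_fourier_neg]

theorem fourierInv_eq_fourier_refl (f : L2 d) : 𝓕⁻ f = 𝓕 (reflL2 f) := by
  have h : reflL2 (𝓕 (𝓕⁻ f)) = 𝓕⁻ (𝓕⁻ f) := (fourierInv_eq_refl _).symm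
  rw [fourier_fourierInv_eq] at h
  rw [h, fourier_fourierInv_eq]

theorem reflL2_mulOp_jMul (f : L2 d) : reflL2 (mulOp (fun ξ : E d => (jMul ξ : ℂ)) f) =
    mulOp (fun ξ : E d => (jMul ξ : ℂ)) (reflL2 f) := by
  apply Lp.ext
  filter_upwards [reflL2_coe (mulOp (fun ξ : E d => (jMul ξ : ℂ)) f), ae_neg (mulOp_jMul f),
    mulOp_jMul (reflL2 f), reflL2_coe f] with x h1 h2 h3 h4
  rw [h1, h2, h3, h4, jMul_neg]

theorem star_mulOp_jMul (f : L2 d) : star (mulOp (fun ξ : E d => (jMul ξ : ℂ)) f) =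
    mulOp (fun ξ : E d => (jMul ξ : ℂ)) (star f) := by
  apply Lp.ext
  filter_upwards [star_coe_L2 (mulOp (fun ξ : E d => (jMul ξ : ℂ)) f), mulOp_jMul f,
    mulOp_jMul (star f), star_coe_L2 f] with x h1 h2 h3 h4
  rw [h1, h2, h3, h4, star_mul', ← starRingEnd_apply, Complex.conj_ofReal]

theorem star_fourierInv (f : L2 d) : star (𝓕⁻ f) = 𝓕 (star f) := by
  have h := star_fourier (𝓕⁻ f)
  rw [fourier_fourierInv_eq] at h
  rw [h, fourier_fourierInv_eq]

-- The multiplier is real and even: conjugation exchanges 𝓕 and 𝓕⁻¹, these differ by the reflection,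
-- and the reflection commutes with multiplication by `jMul`.
@[simp] theorem conj_J : conj (J d) = J d := by
  ext1 f
  rw [conj_apply, J_apply', J_apply', star_fourierInv, star_mulOp_jMul, star_fourier, star_star,
    fourierInv_eq_refl, ← reflL2_mulOp_jMul, ← fourierInv_eq_fourier_refl]

@[simp] theorem transp_J : transp (J d) = J d := by rw [transp, star_J, conj_J]

/-! ### Translations -/

/-- The translation `f ↦ f(· - a)`. -/
def transL2 (a : E d) (f : L2 d) : L2 d :=
  Lp.compMeasurePreserving (fun x => x - a) (measurePreserving_sub_right volume a) f

theorem transL2_coe (a : E d) (f : L2 d) : ⇑(transL2 a f) =ᵐ[volume] fun x => f (x - a) :=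
  Lp.coeFn_compMeasurePreserving f _

theorem enorm_transL2 (a : E d) (f : L2 d) : ‖transL2 a f‖ₑ = ‖f‖ₑ := by
  rw [← ofReal_norm, ← ofReal_norm]
  congr 1
  exact Lp.norm_compMeasurePreserving f _

theorem continuous_transL2 (a : E d) : Continuous (transL2 a) :=
  (Lp.isometry_compMeasurePreserving (measurePreserving_sub_right volume a)).continuous

/-- The phase in the Fourier transform of a translate. -/
def phase (a ξ : E d) : ℂ := Complex.exp ((-2 * Real.pi * inner ℝ a ξ : ℝ) * Complex.I)

theorem aesm_phase (a : E d) : AEStronglyMeasurable (phase a) volume := by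
  refine Continuous.aestronglyMeasurable ?_
  unfold phase
  fun_prop

theorem phase_bound (a : E d) : ∀ᵐ ξ, ‖phase a ξ‖ ≤ 1 :=
  Eventually.of_forall fun _ => (Complex.norm_exp_ofReal_mul_I _).le

theorem fourier_transL2 (a : E d) (f : L2 d) : 𝓕 (transL2 a f) = mulOp (phase a) (𝓕 f) := by
  refine denseRange_toLp.induction_on (p := fun f : L2 d => 𝓕 (transL2 a f) = mulOp (phase a) (𝓕 f))
    f ?_ ?_
  · exact isClosed_eq ((Lp.fourierTransformₗᵢ (E d) ℂ).continuous.comp (continuous_transL2 a))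
      ((mulOp (phase a)).continuous.comp (Lp.fourierTransformₗᵢ (E d) ℂ).continuous)
  · intro f
    have hg : transL2 a (f.toLp 2 : L2 d) = (f.compSubConstCLM ℂ a).toLp 2 := by
      apply Lp.ext
      filter_upwards [transL2_coe a (f.toLp 2 : L2 d), toLp_coe (f.compSubConstCLM ℂ a),
        (measurePreserving_sub_right (volume : Measure (E d)) a).quasiMeasurePreserving.ae
          (toLp_coe f)] with x h1 h2 h3
      rw [h1, h2, h3]
      rfl
    rw [hg, SchwartzMap.toLp_fourier_eq, SchwartzMap.toLp_fourier_eq]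
    apply Lp.ext
    filter_upwards [mulOp_apply (aesm_phase a) (phase_bound a) ((𝓕 f).toLp 2 : L2 d),
      toLp_coe (𝓕 f), toLp_coe (𝓕 (f.compSubConstCLM ℂ a))] with ξ h1 h2 h3
    rw [h1, h2, h3, SchwartzMap.fourier_coe, SchwartzMap.fourier_coe, Real.fourier_eq',
      Real.fourier_eq', ← integral_const_mul]
    rw [← integral_add_right_eq_self _ a]
    refine integral_congr_ae (Eventually.of_forall fun v => ?_)
    simp only [SchwartzMap.compSubConstCLM_apply, smul_eq_mul, phase, ← mul_assoc, ← Complex.exp_add]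
    rw [add_sub_cancel_right]
    congr 2
    rw [inner_add_left]
    push_cast
    ring

/-- Translations become multiplication by phases on the Fourier side and commute with the multiplier
of `J`. This is what makes the bound on v uniform over its translates. -/
theorem J_transL2 (a : E d) (f : L2 d) : J d (transL2 a f) = transL2 a (J d f) := by
  have h : 𝓕 (J d (transL2 a f)) = 𝓕 (transL2 a (J d f)) := by
    rw [fourier_transL2, J_apply', J_apply', fourier_fourierInv_eq, fourier_fourierInv_eq,
      fourier_transL2]
    apply Lp.ext
    filter_upwards [mulOp_jMul (mulOp (phase a) (𝓕 f)),
      mulOp_apply (aesm_phase a) (phase_bound a) (𝓕 f), mulOp_jMul (𝓕 f),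
      mulOp_apply (aesm_phase a) (phase_bound a) (mulOp (fun ξ : E d => (jMul ξ : ℂ)) (𝓕 f))]
      with ξ h1 h2 h3 h4
    rw [h1, h2, h4, h3]
    ring
  have := congrArg (fun g : L2 d => 𝓕⁻ g) h
  simpa using this

/-! ### Weights -/

theorem J_mul_cancel {A B : Op d} (h : J d * A = J d * B) : A = B := by
  ext1 f
  exact J_injective (congrArg (fun C : Op d => C f) h)

theorem mul_J_cancel {A B : Op d} (h : A * J d = B * J d) : A = B := by
  have := congrArg star h
  rw [star_mul, star_mul, star_J] at this
  exact star_injective (J_mul_cancel this)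

theorem J_pow_mul_cancel (n : ℕ) {A B : Op d} (h : J d ^ n * A = J d ^ n * B) : A = B := by
  induction n with
  | zero => simpa using h
  | succ n ih =>
    rw [pow_succ', mul_assoc, mul_assoc] at h
    exact ih (J_mul_cancel h)

theorem mul_J_pow_cancel (n : ℕ) {A B : Op d} (h : A * J d ^ n = B * J d ^ n) : A = B := by
  induction n with
  | zero => simpa using h
  | succ n ih =>
    rw [pow_succ, ← mul_assoc, ← mul_assoc] at h
    exact ih (mul_J_cancel h)

/-- `weight` picks an operator by choice. Injectivity of `J`, and its adjoint version for
cancellation on the right, leave only one candidate. -/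
theorem weight_eq (i j : ℕ) (B : Op d) : weight i j (J d ^ i * B * J d ^ j) = B := by
  have h : ∃ B', J d ^ i * B * J d ^ j = J d ^ i * B' * J d ^ j := ⟨B, rfl⟩
  rw [weight, dif_pos h]
  exact (J_pow_mul_cancel i (mul_J_pow_cancel j h.choose_spec)).symm

theorem weight_one_one (B : Op d) : weight 1 1 (J d * B * J d) = B := by
  simpa using weight_eq 1 1 B

theorem weight_one_zero (B : Op d) : weight 1 0 (J d * B) = B := by
  simpa using weight_eq 1 0 B

theorem weight_zero_one (B : Op d) : weight 0 1 (B * J d) = B := by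
  simpa using weight_eq 0 1 B

theorem Mvec_J (f : L2 d) : Mvec (J d f) = f := by
  have h : ∃ g, J d f = J d g := ⟨f, rfl⟩
  rw [Mvec, dif_pos h]
  exact (J_injective h.choose_spec).symm

theorem sobolevNorm_J (f : L2 d) : sobolevNorm 1 (J d f) = ‖f‖ₑ := by
  refine le_antisymm (iInf₂_le _ (by simp)) (le_iInf₂ fun g hg => ?_)
  rw [J_injective (by simpa using hg : J d f = J d g)]

theorem calHNorm_J (B : Op d) : calHNorm 1 (J d * B * J d) = traceNorm B := by
  refine le_antisymm (iInf₂_le _ (by simp)) (le_iInf₂ fun B' h => ?_)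
  rw [J_mul_cancel (mul_J_cancel (by simpa using h : J d * B * J d = J d * B' * J d))]

/-- A bounded operator dominated by `J` factors through `J`. -/
theorem exists_eq_mul_J {X : Op d} {C : ℝ} (h : ∀ f, ‖X f‖ ≤ C * ‖J d f‖) : ∃ B, X = B * J d := by
  -- Jf ↦ Xf is well defined and bounded on the dense range of `J`; B is its continuous extension.
  refine ⟨X.toLinearMap.extendOfNorm (J d).toLinearMap, ?_⟩
  ext1 f
  exact (LinearMap.extendOfNorm_eq J_denseRange ⟨C, h⟩ f).symm

/-! ### Interaction potentials -/

/-- An even measurable potential with `v(· - a)² ≤ c² M²` for all `a`. -/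
structure PotBound (v : E d → ℝ) (c : NNReal) : Prop where
  meas : Measurable v
  even : ∀ x, v (-x) = v x
  bound : ∀ (a : E d) (g : L2 d), ∫⁻ x, ‖(v (x - a) : ℂ) * J d g x‖ₑ ^ 2 ≤ (c * ‖g‖ₑ) ^ 2

theorem exists_potBound {v : E d → ℝ} (hv : Measurable v) (he : ∀ x, v (-x) = v x)
    (hvb : SqLeM v) : ∃ c, PotBound v c := by
  obtain ⟨C, hC⟩ := hvb
  -- The bound at a follows from the bound at 0 applied to g translated by −a. If C is negative,
  -- both C and √C are truncated to 0 and nothing is lost.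
  refine ⟨(Real.sqrt C).toNNReal, hv, he, fun a g => ?_⟩
  have h1 := hC (transL2 (-a) g)
  rw [enorm_transL2, J_transL2] at h1
  have h2 : ENNReal.ofReal C ≤ (((Real.sqrt C).toNNReal : NNReal) : ℝ≥0∞) ^ 2 := by
    rw [← ENNReal.ofReal, ← ENNReal.ofReal_pow (Real.sqrt_nonneg _)]
    refine ENNReal.ofReal_le_ofReal ?_
    by_cases h : 0 ≤ C
    · rw [Real.sq_sqrt h]
    · exact (not_le.1 h).le.trans (sq_nonneg _)
  rw [mul_pow]
  refine le_trans (le_of_eq ?_) (h1.trans (mul_le_mul_left h2 _))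
  rw [← lintegral_add_right_eq_self _ a]
  refine lintegral_congr_ae ?_
  filter_upwards [transL2_coe (-a) (J d g)] with x hx
  rw [hx, add_sub_cancel_right, sub_neg_eq_add, enorm_mul, mul_pow]
  congr 1
  rw [← ofReal_norm, ← ENNReal.ofReal_pow (norm_nonneg _), Complex.norm_real, Real.norm_eq_abs,
    sq_abs]

/-- The kernel of `v ♯ A`. -/
def vKer (v : E d → ℝ) (K : E d × E d → ℂ) (p : E d × E d) : ℂ := (v (p.1 - p.2) : ℂ) * K p

theorem aesm_vKer {v : E d → ℝ} (hv : Measurable v) {K : E d × E d → ℂ}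
    (hK : AEStronglyMeasurable K (volume.prod volume)) :
    AEStronglyMeasurable (vKer v K) (volume.prod volume) := by
  refine AEStronglyMeasurable.mul ?_ hK
  exact (Complex.measurable_ofReal.comp
    (hv.comp (measurable_fst.sub measurable_snd))).aestronglyMeasurable

theorem vKer_congr (v : E d → ℝ) {K L : E d × E d → ℂ} (h : K =ᵐ[volume.prod volume] L) :
    vKer v K =ᵐ[volume.prod volume] vKer v L := by
  filter_upwards [h] with p hp
  rw [vKer, vKer, hp]

/-- The operator `A` has a kernel `K` such that `v ♯ K` is square integrable. -/
def IsSharp (v : E d → ℝ) (A : Op d) : Prop :=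
  ∃ K, HasKernel A K ∧ MemLp (vKer v K) 2 (volume.prod volume)

/-- `sharp` uses a chosen kernel. Kernels are unique almost everywhere, so any kernel of A may be
used, and the junk value of `opOfKernel` is excluded by square integrability. -/
theorem IsSharp.hasKernel {v : E d → ℝ} {A : Op d} (h : IsSharp v A) {L : E d × E d → ℂ}
    (hL : HasKernel A L) : HasKernel (sharp v A) (vKer v L) := by
  obtain ⟨K, hK, hm⟩ := h
  have h1 : vKer v (kernel A) =ᵐ[volume.prod volume] vKer v K := vKer_congr v hK.kernel_ae_eq
  have h2 := hasKernel_opOfKernel (hm.ae_eq h1.symm)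
  exact h2.congr (h1.trans (vKer_congr v (hK.ae_eq hL)))

theorem vKer_add (v : E d → ℝ) (K L : E d × E d → ℂ) : vKer v (K + L) = vKer v K + vKer v L := by
  ext p
  simp [vKer, mul_add]

theorem vKer_star (v : E d → ℝ) (K : E d × E d → ℂ) : vKer v (star K) = star (vKer v K) := by
  ext p
  simp [vKer]

theorem vKer_swap {v : E d → ℝ} (he : ∀ x, v (-x) = v x) (K : E d × E d → ℂ) :
    vKer v (fun p => K p.swap) = fun p => vKer v K p.swap := by
  ext p
  simp only [vKer, Prod.fst_swap, Prod.snd_swap]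
  rw [← he (p.2 - p.1), neg_sub]

protected theorem IsSharp.add {v : E d → ℝ} {A B : Op d} (hA : IsSharp v A) (hB : IsSharp v B) :
    IsSharp v (A + B) := by
  obtain ⟨K, hK, hm⟩ := hA
  obtain ⟨L, hL, hm'⟩ := hB
  exact ⟨_, hK.add hL, by rw [vKer_add]; exact hm.add hm'⟩

protected theorem IsSharp.conj {v : E d → ℝ} {A : Op d} (hA : IsSharp v A) :
    IsSharp v (conj A) := by
  obtain ⟨K, hK, hm⟩ := hA
  exact ⟨_, hK.conj, by rw [vKer_star]; exact hm.star⟩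

protected theorem IsSharp.transp {v : E d → ℝ} (he : ∀ x, v (-x) = v x) {A : Op d}
    (hA : IsSharp v A) : IsSharp v (transp A) := by
  obtain ⟨K, hK, hm⟩ := hA
  exact ⟨_, hK.transp, by rw [vKer_swap he]; exact memLp_swap hm⟩

theorem sharp_add {v : E d → ℝ} {A B : Op d} (hA : IsSharp v A) (hB : IsSharp v B) :
    sharp v (A + B) = sharp v A + sharp v B := by
  obtain ⟨K, hK, hm⟩ := id hA
  obtain ⟨L, hL, hm'⟩ := id hB
  have h := (hA.add hB).hasKernel (hK.add hL)
  rw [vKer_add] at h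
  exact h.op_eq ((hA.hasKernel hK).add (hB.hasKernel hL))

theorem sharp_conj {v : E d → ℝ} {A : Op d} (hA : IsSharp v A) :
    sharp v (conj A) = conj (sharp v A) := by
  obtain ⟨K, hK, hm⟩ := id hA
  have h := hA.conj.hasKernel hK.conj
  rw [vKer_star] at h
  exact h.op_eq (hA.hasKernel hK).conj

theorem sharp_transp {v : E d → ℝ} (he : ∀ x, v (-x) = v x) {A : Op d} (hA : IsSharp v A) :
    sharp v (transp A) = transp (sharp v A) := by
  obtain ⟨K, hK, hm⟩ := id hA
  have h := (hA.transp he).hasKernel hK.transp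
  rw [vKer_swap he] at h
  exact h.op_eq (hA.hasKernel hK).transp

theorem sharp_star {v : E d → ℝ} (he : ∀ x, v (-x) = v x) {A : Op d} (hA : IsSharp v A) :
    sharp v (star A) = star (sharp v A) := by
  rw [← conj_transp, sharp_conj (hA.transp he), sharp_transp he hA, conj_transp]

theorem trace_sharp_mul_star {v : E d → ℝ} {A B : Op d} (hA : IsSharp v A) {K L : E d × E d → ℂ}
    (hK : HasKernel A K) (hL : HasKernel B L) : trace (sharp v A * star B) =
      ∫ p, (v (p.1 - p.2) : ℂ) * (K p * star (L p)) ∂(volume.prod volume) := by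
  rw [trace_mul_star_eq_integral (hA.hasKernel hK) hL]
  simp only [vKer, mul_assoc]

theorem trace_sharp_mul_star_comm {v : E d → ℝ} {A B : Op d} (hA : IsSharp v A)
    (hB : IsSharp v B) : trace (sharp v B * star A) = star (trace (sharp v A * star B)) := by
  obtain ⟨K, hK, -⟩ := id hA
  obtain ⟨L, hL, -⟩ := id hB
  rw [trace_sharp_mul_star hA hK hL, trace_sharp_mul_star hB hL hK, ← starRingEnd_apply,
    ← integral_conj]
  refine integral_congr_ae (Eventually.of_forall fun p => ?_)
  simp [mul_comm]

/-- Both traces are ∫∫ v(x − y) K(x, y) L(y, x) up to the exchange of x and y, under which v(x − y)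
is invariant. -/
theorem trace_sharp_mul_comm {v : E d → ℝ} (he : ∀ x, v (-x) = v x) {A B : Op d}
    (hA : IsSharp v A) (hB : IsSharp v B) : trace (sharp v A * B) = trace (sharp v B * A) := by
  obtain ⟨K, hK, -⟩ := id hA
  obtain ⟨L, hL, -⟩ := id hB
  have h1 := trace_sharp_mul_star hA hK hL.star
  have h2 := trace_sharp_mul_star hB hL hK.star
  rw [star_star] at h1 h2
  rw [h1, h2, ← integral_prod_swap]
  refine integral_congr_ae (Eventually.of_forall fun p => ?_)
  simp only [Prod.fst_swap, Prod.snd_swap, Prod.swap_swap, star_star]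
  rw [← he (p.2 - p.1), neg_sub, mul_comm (L p)]

/-! ### Hilbert-Schmidt bound for the exchange term -/

theorem hasKernel_basisTrunc (A : Op d) (s : Finset (Idx d)) :
    HasKernel (basisTrunc A s) fun p => ∑ i ∈ s, A (onb d i) p.1 * star (onb d i p.2) := by
  have := HasKernel.sum s fun i => hasKernel_ketbra (A (onb d i)) (onb d i)
  have h : (fun p : E d × E d => ∑ i ∈ s, A (onb d i) p.1 * star (onb d i p.2)) =
      ∑ i ∈ s, fun p : E d × E d => A (onb d i) p.1 * star (onb d i p.2) := by
    ext p
    rw [Finset.sum_apply]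
  rw [h]
  exact this

theorem coeFn_sum_smul {ι : Type*} (s : Finset ι) (c : ι → ℂ) (f : ι → L2 d) :
    ⇑(∑ i ∈ s, c i • f i) =ᵐ[volume] fun x => ∑ i ∈ s, c i * f i x := by
  classical
  induction s using Finset.induction_on with
  | empty => simpa using! Lp.coeFn_zero ℂ 2 volume
  | insert i s hi ih =>
    rw [Finset.sum_insert hi]
    filter_upwards [ih, Lp.coeFn_add (c i • f i) (∑ j ∈ s, c j • f j), Lp.coeFn_smul (c i) (f i)]
      with x h1 h2 h3
    rw [h2, Pi.add_apply, h1, h3, Finset.sum_insert hi, Pi.smul_apply, smul_eq_mul]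

/-- For fixed y the slice x ↦ (JB)(x, y) is `J` applied to the slice of B, so the form bound for v(·
− y) holds slice by slice and can be integrated in y. Truncation makes the slices finite linear
combinations, for which this is literally true. -/
theorem PotBound.basisTrunc_bound {v : E d → ℝ} {c : NNReal} (hv : PotBound v c) (B : Op d)
    (s : Finset (Idx d)) :
    ∫⁻ p, ‖vKer v (fun p => ∑ i ∈ s, (J d * B) (onb d i) p.1 * star (onb d i p.2)) p‖ₑ ^ 2
      ∂(volume.prod volume) ≤ (c * hsNorm B) ^ 2 := by
  have hm1 := (hasKernel_basisTrunc (J d * B) s).1.1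
  have hm2 := (hasKernel_basisTrunc B s).1.1
  rw [lintegral_prod_symm _ ((aesm_vKer hv.meas hm1).enorm.pow_const 2)]
  have h1 : ∀ y, ∫⁻ x, ‖vKer v (fun p => ∑ i ∈ s, (J d * B) (onb d i) p.1 *
      star (onb d i p.2)) (x, y)‖ₑ ^ 2 ≤ (c : ℝ≥0∞) ^ 2 *
        ∫⁻ x, ‖∑ i ∈ s, B (onb d i) x * star (onb d i y)‖ₑ ^ 2 := by
    intro y
    have h2 := hv.bound y (∑ i ∈ s, star (onb d i y) • B (onb d i))
    rw [mul_pow, enorm_sq_eq_lintegral] at h2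
    refine le_trans (le_of_eq ?_) (h2.trans (le_of_eq ?_))
    · refine lintegral_congr_ae ?_
      rw [map_sum]
      simp only [map_smul]
      filter_upwards [coeFn_sum_smul s (fun i => star (onb d i y)) fun i => J d (B (onb d i))]
        with x hx
      rw [hx, vKer]
      simp only [mul_comm (star _)]
      rfl
    · congr 1
      refine lintegral_congr_ae ?_
      filter_upwards [coeFn_sum_smul s (fun i => star (onb d i y)) fun i => B (onb d i)]
        with x hx
      rw [hx]
      simp only [mul_comm (star _)]
  refine (lintegral_mono h1).trans ?_
  rw [lintegral_const_mul' _ _ (by simp), mul_pow]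
  gcongr
  rw [← lintegral_prod_symm (fun p => ‖∑ i ∈ s, B (onb d i) p.1 * star (onb d i p.2)‖ₑ ^ 2)
    (hm2.enorm.pow_const 2), ← (hasKernel_basisTrunc B s).hsSq_eq, hsSq_basisTrunc, hsNorm_sq, hsSq]
  exact ENNReal.sum_le_tsum s

/-- The truncated kernels converge in L², hence almost everywhere along a subsequence, and Fatou
carries the uniform bound of the truncations to the limit. -/
theorem PotBound.eLpNorm_vKer_le {v : E d → ℝ} {c : NNReal} (hv : PotBound v c) {B : Op d}
    (hB : HS B) {K : E d × E d → ℂ} (hK : HasKernel (J d * B) K) :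
    eLpNorm (vKer v K) 2 (volume.prod volume) ≤ c * hsNorm B := by
  obtain ⟨s, hs⟩ := exists_seq_tendsto (atTop : Filter (Finset (Idx d)))
  let κ : ℕ → E d × E d → ℂ := fun n p =>
    ∑ i ∈ s n, (J d * B) (onb d i) p.1 * star (onb d i p.2)
  have hκ : ∀ n, HasKernel (basisTrunc (J d * B) (s n)) (κ n) := fun n => hasKernel_basisTrunc _ _
  have h1 : Tendsto (fun n => eLpNorm (κ n - K) 2 (volume.prod volume)) atTop (𝓝 0) := by
    have h2 := (HS.tendsto_basisTrunc (hB.mul_left (J d))).comp hs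
    refine h2.congr fun n => ?_
    rw [Function.comp_apply, (hK.sub (hκ n)).hsNorm_eq, eLpNorm_sub_comm]
  obtain ⟨φ, -, hφ⟩ := (tendstoInMeasure_of_tendsto_eLpNorm (by simp) (fun n => (hκ n).1.1)
    hK.1.1 h1).exists_seq_tendsto_ae
  rw [← ENNReal.pow_le_pow_left_iff two_ne_zero, ← lintegral_enorm_sq]
  have h3 : ∀ᵐ p ∂((volume : Measure (E d)).prod volume), ‖vKer v K p‖ₑ ^ 2 ≤
      liminf (fun n => ‖vKer v (κ (φ n)) p‖ₑ ^ 2) atTop := by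
    filter_upwards [hφ] with p hp
    have : Tendsto (fun n => ‖vKer v (κ (φ n)) p‖ₑ ^ 2) atTop (𝓝 (‖vKer v K p‖ₑ ^ 2)) :=
      ENNReal.Tendsto.pow ((tendsto_const_nhds.mul hp).enorm)
    rw [this.liminf_eq]
  refine (lintegral_mono_ae h3).trans ((lintegral_liminf_le' fun n =>
    (aesm_vKer hv.meas (hκ _).1.1).enorm.pow_const 2).trans ?_)
  refine liminf_le_of_le (by isBoundedDefault) fun b hb => ?_
  obtain ⟨n, hn⟩ := hb.exists
  exact hn.trans (hv.basisTrunc_bound B _)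

theorem PotBound.isSharp {v : E d → ℝ} {c : NNReal} (hv : PotBound v c) {B : Op d}
    (hB : HS B) : IsSharp v (J d * B) := by
  obtain ⟨K, hK⟩ := (hB.mul_left (J d)).exists_hasKernel
  exact ⟨K, hK, aesm_vKer hv.meas hK.1.1,
    (hv.eLpNorm_vKer_le hB hK).trans_lt (ENNReal.mul_lt_top (by simp) hB)⟩

theorem PotBound.hsNorm_sharp_le {v : E d → ℝ} {c : NNReal} (hv : PotBound v c) {B : Op d}
    (hB : HS B) : hsNorm (sharp v (J d * B)) ≤ c * hsNorm B := by
  obtain ⟨K, hK⟩ := (hB.mul_left (J d)).exists_hasKernel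
  rw [((hv.isSharp hB).hasKernel hK).hsNorm_eq]
  exact hv.eLpNorm_vKer_le hB hK

/-! ### The direct term -/

theorem Nuc.density_spec {A : Op d} (h : Nuc A) : Integrable (density A) ∧
    ∀ s : Set (E d), MeasurableSet s →
      ∫ x in s, density A x = trace (mulOp (s.indicator fun _ => 1) * A) := by
  obtain ⟨x, y, hr, hs⟩ := h.exists_rep
  have h0 : ∀ s : Set (E d), MeasurableSet s →
      ∫ z in s, repDensity x y z = trace (mulOp (s.indicator fun _ => 1) * A) := by
    intro s hms
    rw [hr.trace_mulOp hs (C := 1) (aestronglyMeasurable_const.indicator hms) (Eventually.of_forall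
      fun z => ?_), setIntegral_eq_integral_indicator_mul _ hms]
    by_cases hz : z ∈ s <;> simp [hz]
  have h1 := hr.density_ae_eq hs
  refine ⟨(integrable_repDensity hs).congr h1.symm, fun s hms => ?_⟩
  rw [← h0 s hms]
  exact integral_congr_ae (ae_restrict_of_ae h1)

theorem density_add {A B : Op d} (hA : Nuc A) (hB : Nuc B) :
    density (A + B) =ᵐ[volume] density A + density B := by
  refine Integrable.ae_eq_of_forall_setIntegral_eq _ _ (hA.add hB).density_spec.1
    (hA.density_spec.1.add hB.density_spec.1) fun s hms _ => ?_
  rw [(hA.add hB).density_spec.2 s hms, mul_add, trace_add (hA.mul_left _) (hB.mul_left _),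
    ← hA.density_spec.2 s hms, ← hB.density_spec.2 s hms]
  exact (integral_add hA.density_spec.1.integrableOn hB.density_spec.1.integrableOn).symm

theorem density_star {A : Op d} (hA : Nuc A) :
    density (star A) =ᵐ[volume] star (density A) := by
  obtain ⟨x, y, hr, hs⟩ := hA.exists_rep
  have hs' : ∑' i, ‖y i‖ₑ * ‖x i‖ₑ < ⊤ := by simpa only [mul_comm] using hs
  filter_upwards [hr.density_ae_eq hs, (hr.star hs).density_ae_eq hs'] with z h1 h2
  rw [h2, Pi.star_apply, h1, repDensity, repDensity, ← starRingEnd_apply, Complex.conj_tsum]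
  simp [mul_comm]

theorem Nuc.trace_mulOp {A : Op d} (h : Nuc A) {w : E d → ℂ}
    (hw : AEStronglyMeasurable w volume) {C : ℝ} (hC : ∀ᵐ x, ‖w x‖ ≤ C) :
    trace (mulOp w * A) = ∫ z, w z * density A z := by
  obtain ⟨x, y, hr, hs⟩ := h.exists_rep
  rw [hr.trace_mulOp hs hw hC]
  refine integral_congr_ae ?_
  filter_upwards [hr.density_ae_eq hs] with z hz
  rw [hz]

/-- The direct potential `v * d(γ)`. -/
def direct (v : E d → ℝ) (γ : Op d) (x : E d) : ℂ := ∫ y, (v (x - y) : ℂ) * density γ y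

theorem b_eq (v : E d → ℝ) (γ : Op d) : b v γ = mulOp (direct v γ) + sharp v γ := rfl

section

variable {v : E d → ℝ} {c : NNReal}

theorem Nuc.weight {a : Op d} (h : Nuc a) : Nuc (J d * a * J d) := (h.mul_left _).mul_right _

theorem enorm_op_add_le (A B : Op d) : ‖A + B‖ₑ ≤ ‖A‖ₑ + ‖B‖ₑ := by
  rw [← ofReal_norm, ← ofReal_norm, ← ofReal_norm, ← ENNReal.ofReal_add (norm_nonneg _)
    (norm_nonneg _)]
  exact ENNReal.ofReal_le_ofReal (norm_add_le A B)

theorem enorm_J_apply_le (f : L2 d) : ‖J d f‖ₑ ≤ ‖f‖ₑ := by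
  rw [← ofReal_norm, ← ofReal_norm]
  refine ENNReal.ofReal_le_ofReal (((J d).le_of_opNorm_le norm_J_le f).trans_eq (one_mul _))

/-- The density of JaJ is a sum of products of Jfᵢ and the conjugate of Jgᵢ. Cauchy–Schwarz together
with ‖v(x − ·) Jfᵢ‖ ≤ c‖fᵢ‖ uses the weight on one side only, uniformly in x. -/
theorem PotBound.lintegral_direct_le (hv : PotBound v c) {a : Op d} (ha : Nuc a) (x : E d) :
    ∫⁻ y, ‖(v (x - y) : ℂ) * density (J d * a * J d) y‖ₑ ≤ c * traceNorm a := by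
  have key : ∀ f g : ℕ → L2 d, IsRep a f g → ∑' i, ‖f i‖ₑ * ‖g i‖ₑ < ⊤ →
      ∫⁻ y, ‖(v (x - y) : ℂ) * density (J d * a * J d) y‖ₑ ≤ c * ∑' i, ‖f i‖ₑ * ‖g i‖ₑ := by
    intro f g hr hs
    have hr' : IsRep (J d * a * J d) (fun i => J d (f i)) (fun i => J d (g i)) := by
      simpa using (hr.mul_left (J d)).mul_right (J d)
    have hs' : ∑' i, ‖J d (f i)‖ₑ * ‖J d (g i)‖ₑ < ⊤ :=
      lt_of_le_of_lt (ENNReal.tsum_le_tsum fun i =>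
        mul_le_mul' (enorm_J_apply_le _) (enorm_J_apply_le _)) hs
    have h1 : ∀ᵐ y, ‖(v (x - y) : ℂ) * density (J d * a * J d) y‖ₑ ≤
        ∑' i, ‖(v (x - y) : ℂ) * J d (f i) y‖ₑ * ‖J d (g i) y‖ₑ := by
      filter_upwards [hr'.density_ae_eq hs'] with y hy
      rw [hy, repDensity, ← tsum_mul_left]
      refine enorm_tsum_le_tsum_enorm.trans (le_of_eq (tsum_congr fun i => ?_))
      simp only [enorm_mul, ← mul_assoc]
      simp [← ofReal_norm]
    have hmv : Measurable fun y => (v (x - y) : ℂ) :=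
      Complex.measurable_ofReal.comp (hv.meas.comp (measurable_const.sub measurable_id))
    have hm : ∀ i, AEStronglyMeasurable (fun y => (v (x - y) : ℂ) * J d (f i) y) volume := fun i =>
      hmv.aestronglyMeasurable.mul (Lp.aestronglyMeasurable _)
    refine (lintegral_mono_ae h1).trans ?_
    have hme : ∀ i, AEMeasurable (fun y => ‖(v (x - y) : ℂ) * J d (f i) y‖ₑ * ‖J d (g i) y‖ₑ)
        volume := fun i => (hm i).enorm.mul (Lp.aestronglyMeasurable _).enorm
    rw [lintegral_tsum hme,
      ← ENNReal.tsum_mul_left]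
    refine ENNReal.tsum_le_tsum fun i => ?_
    have h2 := ENNReal.lintegral_mul_le_Lp_mul_Lq (μ := (volume : Measure (E d)))
      (p := 2) (q := 2) (Real.HolderConjugate.two_two)
      (f := fun y => ‖(v (x - y) : ℂ) * J d (f i) y‖ₑ)
      (g := fun y => ‖J d (g i) y‖ₑ) (hm i).enorm (Lp.aestronglyMeasurable _).enorm
    refine h2.trans ?_
    simp only [ENNReal.rpow_ofNat]
    rw [← enorm_sq_eq_lintegral, sq_rpow_half, ← mul_assoc]
    refine mul_le_mul' ?_ (enorm_J_apply_le _)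
    have h3 := hv.bound x (f i)
    have h4 : ∀ y, v (x - y) = v (y - x) := fun y => by rw [← hv.even, neg_sub]
    simp_rw [h4]
    calc _ ≤ (((c : ℝ≥0∞) * ‖f i‖ₑ) ^ 2) ^ (1 / 2 : ℝ) := by gcongr
      _ = _ := sq_rpow_half _
  refine ENNReal.le_of_forall_pos_le_add fun ε hε _ => ?_
  -- Slack for a nearly optimal nuclear representation; dividing by c + 1 rather than c also covers
  -- c = 0.
  obtain ⟨δ, hδ, hδε⟩ : ∃ δ : NNReal, 0 < δ ∧ c * δ ≤ ε := by
    refine ⟨ε / (c + 1), by positivity, ?_⟩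
    rw [mul_div_assoc', div_le_iff₀ (by positivity), mul_comm]
    gcongr
    exact le_self_add
  obtain ⟨f, g, hr, hs⟩ := exists_rep_lt
    (ENNReal.lt_add_right ha.ne (ENNReal.coe_ne_zero.2 hδ.ne'))
  refine (key f g hr (hs.trans_le le_top)).trans ?_
  calc (c : ℝ≥0∞) * ∑' i, ‖f i‖ₑ * ‖g i‖ₑ ≤ c * (traceNorm a + δ) := by gcongr
    _ = c * traceNorm a + (c * δ : NNReal) := by rw [mul_add, ENNReal.coe_mul]
    _ ≤ _ := by gcongr

theorem aesm_direct_integrand (hv : Measurable v) {n : E d → ℂ}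
    (hn : AEStronglyMeasurable n volume) :
    AEStronglyMeasurable (fun p : E d × E d => (v (p.1 - p.2) : ℂ) * n p.2)
      (volume.prod volume) :=
  (Complex.measurable_ofReal.comp
    (hv.comp (measurable_fst.sub measurable_snd))).aestronglyMeasurable.mul hn.comp_snd

theorem aesm_direct (hv : Measurable v) {γ : Op d} (h : Nuc γ) :
    AEStronglyMeasurable (direct v γ) volume :=
  (aesm_direct_integrand hv h.density_spec.1.1).integral_prod_right'

theorem PotBound.integrable_direct (hv : PotBound v c) {a : Op d} (ha : Nuc a) (x : E d) :
    Integrable fun y => (v (x - y) : ℂ) * density (J d * a * J d) y := by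
  refine ⟨?_, (hv.lintegral_direct_le ha x).trans_lt (ENNReal.mul_lt_top (by simp) ha)⟩
  exact (Complex.measurable_ofReal.comp (hv.meas.comp
    (measurable_const.sub measurable_id))).aestronglyMeasurable.mul ha.weight.density_spec.1.1

theorem PotBound.norm_direct_le (hv : PotBound v c) {a : Op d} (ha : Nuc a) (x : E d) :
    ‖direct v (J d * a * J d) x‖ ≤ (c * traceNorm a).toReal := by
  rw [← ENNReal.ofReal_le_iff_le_toReal (ENNReal.mul_ne_top (by simp) ha.ne), ofReal_norm]
  exact (enorm_integral_le_lintegral_enorm _).trans (hv.lintegral_direct_le ha x)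

theorem PotBound.norm_direct_le_ae (hv : PotBound v c) {a : Op d} (ha : Nuc a) :
    ∀ᵐ x, ‖direct v (J d * a * J d) x‖ ≤ (c * traceNorm a).toReal :=
  Eventually.of_forall (hv.norm_direct_le ha)

theorem mulOp_congr_apply {w w' : E d → ℂ} (hw : AEStronglyMeasurable w volume) {C : ℝ}
    (hC : ∀ᵐ x, ‖w x‖ ≤ C) {A : Op d} (hA : ∀ f : L2 d, ⇑(A f) =ᵐ[volume] fun x => w' x * f x)
    (h : w =ᵐ[volume] w') : mulOp w = A := by
  ext1 f
  apply Lp.ext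
  filter_upwards [mulOp_apply hw hC f, hA f, h] with x h1 h2 h3
  rw [h1, h2, h3]

theorem weight_add (a a' : Op d) : J d * (a + a') * J d = J d * a * J d + J d * a' * J d := by
  rw [mul_add, add_mul]

theorem weight_smul (z : ℂ) (a : Op d) : J d * (z • a) * J d = z • (J d * a * J d) := by
  rw [mul_smul_comm, smul_mul_assoc]

theorem star_weight (a : Op d) : star (J d * a * J d) = J d * star a * J d := by
  simp [mul_assoc]

theorem PotBound.isSharp_weight (hv : PotBound v c) {a : Op d} (ha : Nuc a) :
    IsSharp v (J d * a * J d) := by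
  rw [mul_assoc]
  exact hv.isSharp (ha.hs.mul_right _)

theorem PotBound.b_add (hv : PotBound v c) {a a' : Op d} (ha : Nuc a) (ha' : Nuc a') :
    b v (J d * (a + a') * J d) = b v (J d * a * J d) + b v (J d * a' * J d) := by
  rw [weight_add, b_eq, b_eq, b_eq, sharp_add (hv.isSharp_weight ha) (hv.isSharp_weight ha'),
    add_add_add_comm]
  congr 1
  have h := hv.norm_direct_le_ae (ha.add ha')
  rw [weight_add] at h
  refine mulOp_congr_apply (w' := direct v (J d * a * J d) + direct v (J d * a' * J d))
    (aesm_direct hv.meas (ha.weight.add ha'.weight)) h (fun f => ?_)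
    (Eventually.of_forall fun x => ?_)
  · filter_upwards [mulOp_apply (aesm_direct hv.meas ha.weight) (hv.norm_direct_le_ae ha) f,
      mulOp_apply (aesm_direct hv.meas ha'.weight) (hv.norm_direct_le_ae ha') f,
      Lp.coeFn_add (mulOp (direct v (J d * a * J d)) f) (mulOp (direct v (J d * a' * J d)) f)]
      with x h1 h2 h3
    rw [add_apply, h3, Pi.add_apply, h1, h2, Pi.add_apply, add_mul]
  · rw [Pi.add_apply, direct, direct, direct,
      ← integral_add (hv.integrable_direct ha x) (hv.integrable_direct ha' x)]
    refine integral_congr_ae ?_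
    filter_upwards [density_add ha.weight ha'.weight] with y hy
    rw [hy, Pi.add_apply, mul_add]

theorem PotBound.star_b (hv : PotBound v c) {a : Op d} (ha : Nuc a) :
    star (b v (J d * a * J d)) = b v (J d * star a * J d) := by
  have h := hv.norm_direct_le_ae ha.star
  rw [b_eq, b_eq, star_add, ← sharp_star hv.even (hv.isSharp_weight ha), star_weight,
    star_mulOp (aesm_direct hv.meas ha.weight) (hv.norm_direct_le_ae ha)]
  congr 1
  symm
  refine mulOp_congr_apply (w' := fun x => star (direct v (J d * a * J d) x))
    (aesm_direct hv.meas ha.star.weight) h (fun f => ?_) (Eventually.of_forall fun x => ?_)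
  · exact mulOp_apply (C := (c * traceNorm a).toReal) (aesm_direct hv.meas ha.weight).star
      (by simpa using hv.norm_direct_le_ae ha) f
  · change direct v (J d * star a * J d) x = star (direct v (J d * a * J d) x)
    rw [direct, direct, ← starRingEnd_apply, ← integral_conj]
    refine integral_congr_ae ?_
    filter_upwards [density_star ha.weight] with y hy
    rw [← star_weight, hy]
    simp

theorem PotBound.norm_b_le (hv : PotBound v c) {a : Op d} (ha : Nuc a) :
    ‖b v (J d * a * J d)‖ₑ ≤ 2 * c * traceNorm a := by
  have h1 : ‖mulOp (direct v (J d * a * J d))‖ₑ ≤ c * traceNorm a := by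
    rw [← ofReal_norm]
    refine ENNReal.ofReal_le_of_le_toReal ?_
    exact norm_mulOp_le (aesm_direct hv.meas ha.weight) ENNReal.toReal_nonneg
      (hv.norm_direct_le_ae ha)
  have h2 : ‖sharp v (J d * a * J d)‖ₑ ≤ c * traceNorm a := by
    rw [mul_assoc]
    refine (opNorm_le_hsNorm _).trans ((hv.hsNorm_sharp_le (ha.hs.mul_right _)).trans ?_)
    gcongr
    refine (hsNorm_mul_le' _ _).trans ?_
    have : ‖J d‖ₑ ≤ 1 := by
      rw [← ofReal_norm]
      exact ENNReal.ofReal_le_one.2 norm_J_le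
    exact (mul_le_mul' (hsNorm_le_traceNorm a) this).trans_eq (mul_one _)
  rw [b_eq]
  refine (enorm_op_add_le _ _).trans ((add_le_add h1 h2).trans_eq ?_)
  ring

/-- The direct part is ∫∫ v(x − y) n(y) n'(x), symmetric by Fubini and evenness of v; the exchange
part is `trace_sharp_mul_comm`. This symmetry is why ½ Tr[b[γ]γ] has derivative Tr[b[γ] δγ]. -/
theorem PotBound.trace_b_comm (hv : PotBound v c) {a a' : Op d} (ha : Nuc a) (ha' : Nuc a') :
    trace (b v (J d * a * J d) * (J d * a' * J d)) =
      trace (b v (J d * a' * J d) * (J d * a * J d)) := by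
  rw [b_eq, b_eq, add_mul, add_mul, trace_add (ha'.weight.mul_left _) (ha'.weight.mul_left _),
    trace_add (ha.weight.mul_left _) (ha.weight.mul_left _),
    trace_sharp_mul_comm hv.even (hv.isSharp_weight ha) (hv.isSharp_weight ha')]
  congr 1
  rw [ha'.weight.trace_mulOp (aesm_direct hv.meas ha.weight) (hv.norm_direct_le_ae ha),
    ha.weight.trace_mulOp (aesm_direct hv.meas ha'.weight) (hv.norm_direct_le_ae ha')]
  simp only [direct, ← integral_mul_const]
  rw [integral_integral_swap]
  · refine integral_congr_ae (Eventually.of_forall fun y => ?_)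
    refine integral_congr_ae (Eventually.of_forall fun x => ?_)
    simp only
    rw [← hv.even (x - y), neg_sub]
    ring
  · have hm : AEStronglyMeasurable (fun p : E d × E d => (v (p.1 - p.2) : ℂ) *
        density (J d * a * J d) p.2 * density (J d * a' * J d) p.1) (volume.prod volume) :=
      (aesm_direct_integrand hv.meas ha.weight.density_spec.1.1).mul
        ha'.weight.density_spec.1.1.comp_fst
    refine ⟨hm, ?_⟩
    rw [hasFiniteIntegral_iff_enorm]
    change ∫⁻ p, ‖(v (p.1 - p.2) : ℂ) * density (J d * a * J d) p.2 *
      density (J d * a' * J d) p.1‖ₑ ∂(volume.prod volume) < ⊤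
    rw [lintegral_prod _ hm.enorm]
    have h1 : ∀ x, ∫⁻ y, ‖(v (x - y) : ℂ) * density (J d * a * J d) y *
        density (J d * a' * J d) x‖ₑ ≤ c * traceNorm a * ‖density (J d * a' * J d) x‖ₑ := by
      intro x
      simp_rw [enorm_mul _ (density (J d * a' * J d) x)]
      rw [lintegral_mul_const' _ _ (by simp)]
      gcongr
      exact hv.lintegral_direct_le ha x
    refine (lintegral_mono h1).trans_lt ?_
    rw [lintegral_const_mul' _ _ (ENNReal.mul_ne_top (by simp) ha.ne)]
    exact ENNReal.mul_lt_top (ENNReal.mul_lt_top (by simp) ha) ha'.weight.density_spec.1.2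

end

/-! ### The one-particle operator -/

theorem integrable_form {V : E d → ℝ} (hV : Measurable V) (hVb : InfFormBounded V) (f g : L2 d) :
    Integrable fun x => (V x : ℂ) * (starRingEnd ℂ (J d f x) * J d g x) := by
  have h1 := (hVb.1 f).norm.add (hVb.1 g).norm
  refine h1.mono' ?_ (Eventually.of_forall fun x => ?_)
  · exact (Complex.measurable_ofReal.comp hV).aestronglyMeasurable.mul
      ((Lp.aestronglyMeasurable _).star.mul (Lp.aestronglyMeasurable _))
  · simp only [norm_mul, Complex.norm_real, RCLike.norm_conj, Pi.add_apply, norm_pow, norm_norm]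
    rw [← mul_add]
    gcongr
    nlinarith [sq_nonneg (‖J d f x‖ - ‖J d g x‖), sq_nonneg (‖J d f x‖), sq_nonneg (‖J d g x‖)]

/-- The sesquilinear form of `M⁻¹ V M⁻¹`. -/
def potForm (V : E d → ℝ) (f g : L2 d) : ℂ :=
  ∫ x, (V x : ℂ) * (starRingEnd ℂ (J d f x) * J d g x)

section

variable {V : E d → ℝ}

theorem potForm_add_right (hV : Measurable V) (hVb : InfFormBounded V) (f g g' : L2 d) :
    potForm V f (g + g') = potForm V f g + potForm V f g' := by
  rw [potForm, potForm, potForm, ← integral_add (integrable_form hV hVb f g)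
    (integrable_form hV hVb f g'), map_add]
  refine integral_congr_ae ?_
  filter_upwards [Lp.coeFn_add (J d g) (J d g')] with x hx
  rw [hx, Pi.add_apply]
  ring

theorem potForm_smul_right (z : ℂ) (f g : L2 d) : potForm V f (z • g) = z * potForm V f g := by
  rw [potForm, potForm, ← integral_const_mul, map_smul]
  refine integral_congr_ae ?_
  filter_upwards [Lp.coeFn_smul z (J d g)] with x hx
  rw [hx, Pi.smul_apply, smul_eq_mul]
  ring

theorem potForm_conj (f g : L2 d) : star (potForm V f g) = potForm V g f := by
  rw [potForm, potForm, ← starRingEnd_apply, ← integral_conj]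
  refine integral_congr_ae (Eventually.of_forall fun x => ?_)
  simp only [map_mul, Complex.conj_ofReal, Complex.conj_conj]
  ring

theorem potForm_add_left (hV : Measurable V) (hVb : InfFormBounded V) (f f' g : L2 d) :
    potForm V (f + f') g = potForm V f g + potForm V f' g := by
  rw [← potForm_conj, potForm_add_right hV hVb, star_add, potForm_conj, potForm_conj]

theorem potForm_smul_left (z : ℂ) (f g : L2 d) :
    potForm V (z • f) g = star z * potForm V f g := by
  rw [← potForm_conj, potForm_smul_right, star_mul', potForm_conj]

theorem potForm_self (g : L2 d) : potForm V g g = ((∫ x, V x * ‖J d g x‖ ^ 2 : ℝ) : ℂ) := by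
  rw [potForm, ← integral_complex_ofReal]
  refine integral_congr_ae (Eventually.of_forall fun x => ?_)
  simp only [Complex.conj_mul']
  push_cast
  rfl

theorem exists_potForm_bound (hV : Measurable V) (hVb : InfFormBounded V) :
    ∃ K : ℝ, 0 ≤ K ∧ ∀ f g, ‖potForm V f g‖ ≤ K * ‖f‖ * ‖g‖ := by
  -- With ε = 1 the quadratic form is at most ‖g‖² − ‖Jg‖² + C‖Jg‖² ≤ (1 + |C|)‖g‖².
  obtain ⟨C, hC⟩ := hVb.2 1 one_pos
  have h1 : ∀ g : L2 d, ‖potForm V g g‖ ≤ (1 + |C|) * ‖g‖ ^ 2 := by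
    intro g
    rw [potForm_self, Complex.norm_real, Real.norm_eq_abs]
    refine (hC g).trans ?_
    have h2 : ‖J d g‖ ≤ ‖g‖ := ((J d).le_of_opNorm_le norm_J_le g).trans_eq (one_mul _)
    have h3 : ‖J d g‖ ^ 2 ≤ ‖g‖ ^ 2 := by gcongr
    have h4 : C * ‖J d g‖ ^ 2 ≤ |C| * ‖g‖ ^ 2 := by
      gcongr
      exact le_abs_self C
    nlinarith [sq_nonneg ‖J d g‖]
  -- Polarization for unit vectors: the two mixed terms have arguments of norm at most 2 and
  -- contribute 4 each, the diagonal ones at most 2 · 2, and the total 12 is halved.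
  have h2 : ∀ f g : L2 d, ‖f‖ = 1 → ‖g‖ = 1 → ‖potForm V f g‖ ≤ 6 * (1 + |C|) := by
    intro f g hf hg
    have e : potForm V f g = (potForm V (f + g) (f + g)
        - Complex.I * potForm V (f + Complex.I • g) (f + Complex.I • g)
        - (1 - Complex.I) * (potForm V f f + potForm V g g)) / 2 := by
      simp only [potForm_add_right hV hVb, potForm_add_left hV hVb, potForm_smul_left,
        potForm_smul_right, ← starRingEnd_apply, Complex.conj_I]
      ring_nf
      simp only [Complex.I_sq, Complex.I_pow_three]
      ring
    have n1 := h1 (f + g)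
    have n2 := h1 (f + Complex.I • g)
    have n3 := h1 f
    have n4 := h1 g
    have m1 : ‖f + g‖ ≤ 2 := (norm_add_le _ _).trans (by rw [hf, hg]; norm_num)
    have m2 : ‖f + Complex.I • g‖ ≤ 2 := (norm_add_le _ _).trans (by
      rw [norm_smul, hf, hg]; norm_num)
    have m3 : ‖f + g‖ ^ 2 ≤ 4 := by nlinarith [norm_nonneg (f + g)]
    have m4 : ‖f + Complex.I • g‖ ^ 2 ≤ 4 := by nlinarith [norm_nonneg (f + Complex.I • g)]
    rw [hf] at n3
    rw [hg] at n4
    have hC0 : 0 ≤ 1 + |C| := by positivity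
    have n1' : ‖potForm V (f + g) (f + g)‖ ≤ (1 + |C|) * 4 := n1.trans (by gcongr)
    have n2' : ‖potForm V (f + Complex.I • g) (f + Complex.I • g)‖ ≤ (1 + |C|) * 4 :=
      n2.trans (by gcongr)
    have o1 : ‖(1 - Complex.I : ℂ)‖ ≤ 2 := (norm_sub_le _ _).trans (by simp; norm_num)
    rw [e, norm_div]
    have o2 : ‖(2 : ℂ)‖ = 2 := by simp
    rw [o2, div_le_iff₀ two_pos]
    calc _ ≤ ‖potForm V (f + g) (f + g)‖
        + ‖Complex.I * potForm V (f + Complex.I • g) (f + Complex.I • g)‖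
        + ‖(1 - Complex.I) * (potForm V f f + potForm V g g)‖ :=
          (norm_sub_le _ _).trans (by gcongr; exact norm_sub_le _ _)
      _ ≤ (1 + |C|) * 4 + (1 + |C|) * 4 - (0 : ℝ) + 2 * ((1 + |C|) * 1 ^ 2 + (1 + |C|) * 1 ^ 2) := by
          rw [sub_zero, norm_mul, norm_mul, Complex.norm_I, one_mul]
          gcongr
          exact (norm_add_le _ _).trans (add_le_add n3 n4)
      _ ≤ _ := by nlinarith
  refine ⟨6 * (1 + |C|), by positivity, fun f g => ?_⟩
  by_cases hf : f = 0
  · have : potForm V f g = 0 := by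
      rw [hf, ← zero_smul ℂ (0 : L2 d), potForm_smul_left]; simp
    rw [this, norm_zero]
    positivity
  by_cases hg : g = 0
  · have : potForm V f g = 0 := by
      rw [hg, ← zero_smul ℂ (0 : L2 d), potForm_smul_right]; simp
    rw [this, norm_zero]
    positivity
  have hf' : ‖f‖ ≠ 0 := norm_ne_zero_iff.2 hf
  have hg' : ‖g‖ ≠ 0 := norm_ne_zero_iff.2 hg
  have h3 := h2 ((‖f‖ : ℂ)⁻¹ • f) ((‖g‖ : ℂ)⁻¹ • g) (by simp [norm_smul, hf'])
    (by simp [norm_smul, hg'])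
  rw [potForm_smul_left, potForm_smul_right, norm_mul, norm_mul, norm_star, norm_inv, norm_inv,
    Complex.norm_real, Complex.norm_real, norm_norm, norm_norm] at h3
  have h4 : ‖potForm V f g‖ = ‖f‖ * ‖g‖ * (‖f‖⁻¹ * (‖g‖⁻¹ * ‖potForm V f g‖)) := by
    field_simp
  rw [h4]
  calc _ ≤ ‖f‖ * ‖g‖ * (6 * (1 + |C|)) := by gcongr
    _ = _ := by ring

theorem inner_potOp (hV : Measurable V) (hVb : InfFormBounded V) (f g : L2 d) :
    ⟪f, potOp V g⟫ = potForm V f g := by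
  obtain ⟨K, hK, hb⟩ := exists_potForm_bound hV hVb
  let B : L2 d →L⋆[ℂ] L2 d →L[ℂ] ℂ :=
    LinearMap.mkContinuous₂
      (LinearMap.mk₂'ₛₗ (starRingEnd ℂ) (RingHom.id ℂ) (potForm V)
        (potForm_add_left hV hVb) (fun z f g => by rw [potForm_smul_left]; rfl)
        (potForm_add_right hV hVb) (fun z f g => potForm_smul_right z f g)) K hb
  have h : ∃ A : Op d, ∀ f g : L2 d,
      ⟪f, A g⟫ = ∫ x, (V x : ℂ) * (starRingEnd ℂ (J d f x) * J d g x) := by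
    refine ⟨star (InnerProductSpace.continuousLinearMapOfBilin B), fun f g => ?_⟩
    rw [inner_adj', InnerProductSpace.continuousLinearMapOfBilin_apply]
    rfl
  rw [potOp, dif_pos h]
  exact h.choose_spec f g

theorem star_potOp (hV : Measurable V) (hVb : InfFormBounded V) : star (potOp V) = potOp V := by
  ext1 f
  refine ext_inner_left ℂ fun g => ?_
  rw [inner_adj', inner_potOp hV hVb, ← inner_conj_symm, inner_potOp hV hVb]
  exact potForm_conj f g

theorem star_hOp (hV : Measurable V) (hVb : InfFormBounded V) : star (hOp V) = hOp V := by
  rw [hOp, star_add, star_sub, star_pow, star_J, star_one, star_potOp hV hVb]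

/-- This is h + c ≥ ½M² as forms: infinitesimal boundedness with ε = 1/2 costs half of the kinetic
energy. It supplies the coercivity behind the resolvents. -/
theorem exists_hOp_lower (hV : Measurable V) (hVb : InfFormBounded V) :
    ∃ c : ℝ, ∀ g : L2 d, (1 / 2) * ‖g‖ ^ 2 ≤ (⟪g, hOp V g⟫).re + c * ‖J d g‖ ^ 2 := by
  obtain ⟨C, hC⟩ := hVb.2 (1 / 2) (by norm_num)
  refine ⟨1 / 2 + C, fun g => ?_⟩
  have h1 : (⟪g, hOp V g⟫).re = ‖g‖ ^ 2 - ‖J d g‖ ^ 2 + ∫ x, V x * ‖J d g x‖ ^ 2 := by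
    have h2 : ⟪g, hOp V g⟫ = ⟪g, g⟫ - ⟪J d g, J d g⟫ + ⟪g, potOp V g⟫ := by
      rw [hOp, add_apply, sub_apply, inner_add_right, inner_sub_right, pow_two, J_inner]
      rfl
    rw [h2, inner_potOp hV hVb, potForm_self, Complex.add_re, Complex.sub_re, Complex.ofReal_re,
      inner_self_eq_norm_sq_to_K, inner_self_eq_norm_sq_to_K]
    norm_cast
  have h3 := (abs_le.1 (hC g)).1
  rw [h1]
  linarith

end

theorem star_hγOp {V v : E d → ℝ} {c : NNReal} (hV : Measurable V) (hVb : InfFormBounded V)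
    (hv : PotBound v c) {a : Op d} (ha : Nuc a) (hs : star a = a) :
    star (hγOp V v (J d * a * J d)) = hγOp V v (J d * a * J d) := by
  rw [hγOp, star_add, star_hOp hV hVb, star_mul, star_mul, star_J, hv.star_b ha, hs, ← mul_assoc]

/-! ### Differentiable families of trace-class and Hilbert-Schmidt operators -/

/-- A family with values of finite `N`-norm, differentiable at `t` within `s`. -/
structure HasDerivN (N : Op d → ℝ≥0∞) (a : ℝ → Op d) (a' : Op d) (S : Set ℝ) (t : ℝ) : Prop where
  mem : ∀ s ∈ S, N (a s) < ⊤
  mem_deriv : N a' < ⊤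
  tendsto : Tendsto (fun s => N ((((s - t)⁻¹ : ℝ) : ℂ) • (a s - a t) - a')) (𝓝[S \ {t}] t) (𝓝 0)

/-- Difference quotients pass through ℓ. Linearity is asked only on elements of finite norm, because
traces and the interaction forms are controlled there and are junk values elsewhere. -/
theorem HasDerivN.linear {N : Op d → ℝ≥0∞} {a : ℝ → Op d} {a' : Op d} {S : Set ℝ} {t : ℝ}
    (h : HasDerivN N a a' S t) (ht : t ∈ S)
    (hadd : ∀ x y, N (x + y) ≤ N x + N y) (hsmul : ∀ (z : ℂ) x, N (z • x) ≤ ‖z‖ₑ * N x)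
    {ℓ : Op d → ℂ} (l_sub : ∀ x y, N x < ⊤ → N y < ⊤ → ℓ (x - y) = ℓ x - ℓ y)
    (l_smul : ∀ (r : ℝ) x, N x < ⊤ → ℓ ((r : ℂ) • x) = r * ℓ x)
    {C : ℝ≥0∞} (hC : C ≠ ⊤) (l_bound : ∀ x, N x < ⊤ → ‖ℓ x‖ₑ ≤ C * N x) :
    HasDerivWithinAt (fun s => ℓ (a s)) (ℓ a') S t := by
  have fsmul : ∀ (z : ℂ) x, N x < ⊤ → N (z • x) < ⊤ := fun z x hx =>
    (hsmul z x).trans_lt (ENNReal.mul_lt_top (by simp) hx)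
  have fsub : ∀ x y, N x < ⊤ → N y < ⊤ → N (x - y) < ⊤ := fun x y hx hy => by
    rw [sub_eq_add_neg, ← neg_one_smul ℂ y]
    exact (hadd _ _).trans_lt (ENNReal.add_lt_top.2 ⟨hx, fsmul _ _ hy⟩)
  rw [hasDerivWithinAt_iff_tendsto_slope]
  rw [tendsto_iff_edist_tendsto_0]
  have h1 : Tendsto (fun s => C * N ((((s - t)⁻¹ : ℝ) : ℂ) • (a s - a t) - a')) (𝓝[S \ {t}] t) (𝓝 0) := by
    have := ENNReal.Tendsto.const_mul h.tendsto (Or.inr hC)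
    simpa using this
  refine tendsto_of_tendsto_of_tendsto_of_le_of_le' tendsto_const_nhds h1
    (Eventually.of_forall fun _ => bot_le) ?_
  filter_upwards [self_mem_nhdsWithin] with s hs
  have hs' := h.mem s hs.1
  have ht' := h.mem t ht
  have e : slope (fun s => ℓ (a s)) t s - ℓ a' = ℓ ((((s - t)⁻¹ : ℝ) : ℂ) • (a s - a t) - a') := by
    rw [l_sub _ _ (fsmul _ _ (fsub _ _ hs' ht')) h.mem_deriv, l_smul _ _ (fsub _ _ hs' ht'),
      l_sub _ _ hs' ht', slope_def_module, Complex.real_smul]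
  rw [edist_eq_enorm_sub, e]
  exact l_bound _ (fsub _ _ (fsmul _ _ (fsub _ _ hs' ht')) h.mem_deriv)

theorem HasDerivN.tendsto_sub {N : Op d → ℝ≥0∞} {a : ℝ → Op d} {a' : Op d} {S : Set ℝ} {t : ℝ}
    (h : HasDerivN N a a' S t)
    (hadd : ∀ x y, N (x + y) ≤ N x + N y) (hsmul : ∀ (z : ℂ) x, N (z • x) ≤ ‖z‖ₑ * N x) :
    Tendsto (fun s => N (a s - a t)) (𝓝[S \ {t}] t) (𝓝 0) := by
  have h1 : Tendsto (fun s : ℝ => ‖((s - t : ℝ) : ℂ)‖ₑ *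
      (N ((((s - t)⁻¹ : ℝ) : ℂ) • (a s - a t) - a') + N a')) (𝓝[S \ {t}] t) (𝓝 0) := by
    have h2 : Tendsto (fun s : ℝ => ‖((s - t : ℝ) : ℂ)‖ₑ) (𝓝[S \ {t}] t) (𝓝 0) := by
      have : Continuous fun s : ℝ => ‖((s - t : ℝ) : ℂ)‖ₑ := by fun_prop
      have h3 := (this.tendsto t).mono_left (nhdsWithin_le_nhds (s := S \ {t}))
      simpa using h3
    have h3 := h.tendsto.add (tendsto_const_nhds (x := N a'))
    rw [zero_add] at h3
    have := ENNReal.Tendsto.mul h2 (Or.inr h.mem_deriv.ne) h3 (Or.inr (by simp))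
    simpa using this
  refine tendsto_of_tendsto_of_tendsto_of_le_of_le' tendsto_const_nhds h1
    (Eventually.of_forall fun _ => bot_le) ?_
  filter_upwards [self_mem_nhdsWithin] with s hs
  have hne : ((s : ℂ) - t) ≠ 0 := by
    rw [← Complex.ofReal_sub]
    exact_mod_cast sub_ne_zero.2 hs.2
  have e : a s - a t = ((s - t : ℝ) : ℂ) • (((((s - t)⁻¹ : ℝ) : ℂ) • (a s - a t) - a') + a') := by
    rw [sub_add_cancel, smul_smul]
    push_cast
    rw [mul_inv_cancel₀ hne, one_smul]
  conv_lhs => rw [e]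
  refine (hsmul _ _).trans ?_
  gcongr
  exact hadd _ _

/-- Expand β(aₛ, cₛ) around (aₜ, cₜ): two linear terms, and β(aₛ − aₜ, cₛ − cₜ), which has
derivative 0. Only real homogeneity is required, so the conjugate-linear slot of `kForm` is covered.
-/
theorem HasDerivN.bilin {N N' : Op d → ℝ≥0∞} {a c : ℝ → Op d} {a' c' : Op d} {S : Set ℝ} {t : ℝ}
    (h : HasDerivN N a a' S t) (h' : HasDerivN N' c c' S t) (ht : t ∈ S)
    (hadd : ∀ x y, N (x + y) ≤ N x + N y) (hsmul : ∀ (z : ℂ) x, N (z • x) ≤ ‖z‖ₑ * N x)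
    (hadd' : ∀ x y, N' (x + y) ≤ N' x + N' y) (hsmul' : ∀ (z : ℂ) x, N' (z • x) ≤ ‖z‖ₑ * N' x)
    {β : Op d → Op d → ℂ}
    (l_sub : ∀ x y w, N x < ⊤ → N y < ⊤ → N' w < ⊤ → β (x - y) w = β x w - β y w)
    (l_smul : ∀ (r : ℝ) x w, N x < ⊤ → N' w < ⊤ → β ((r : ℂ) • x) w = r * β x w)
    (r_sub : ∀ x w y, N x < ⊤ → N' w < ⊤ → N' y < ⊤ → β x (w - y) = β x w - β x y)
    (r_smul : ∀ (r : ℝ) x w, N x < ⊤ → N' w < ⊤ → β x ((r : ℂ) • w) = r * β x w)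
    {C : ℝ≥0∞} (hC : C ≠ ⊤) (l_bound : ∀ x w, N x < ⊤ → N' w < ⊤ → ‖β x w‖ₑ ≤ C * N x * N' w) :
    HasDerivWithinAt (fun s => β (a s) (c s)) (β a' (c t) + β (a t) c') S t := by
  have ht1 := h.mem t ht
  have ht2 := h'.mem t ht
  have d1 := h.linear ht hadd hsmul (ℓ := fun x => β x (c t))
    (fun x y hx hy => l_sub x y _ hx hy ht2) (fun r x hx => l_smul r x _ hx ht2)
    (C := C * N' (c t)) (ENNReal.mul_ne_top hC ht2.ne)
    (fun x hx => (l_bound x _ hx ht2).trans_eq (by ring))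
  have d2 := h'.linear ht hadd' hsmul' (ℓ := fun x => β (a t) x)
    (fun x y hx hy => r_sub _ x y ht1 hx hy) (fun r x hx => r_smul r _ x ht1 hx)
    (C := C * N (a t)) (ENNReal.mul_ne_top hC ht1.ne)
    (fun x hx => (l_bound _ x ht1 hx))
  have fsmul : ∀ (z : ℂ) x, N x < ⊤ → N (z • x) < ⊤ := fun z x hx =>
    (hsmul z x).trans_lt (ENNReal.mul_lt_top (by simp) hx)
  have fsub : ∀ x y, N x < ⊤ → N y < ⊤ → N (x - y) < ⊤ := fun x y hx hy => by
    rw [sub_eq_add_neg, ← neg_one_smul ℂ y]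
    exact (hadd _ _).trans_lt (ENNReal.add_lt_top.2 ⟨hx, fsmul _ _ hy⟩)
  have fsmul' : ∀ (z : ℂ) x, N' x < ⊤ → N' (z • x) < ⊤ := fun z x hx =>
    (hsmul' z x).trans_lt (ENNReal.mul_lt_top (by simp) hx)
  have fsub' : ∀ x y, N' x < ⊤ → N' y < ⊤ → N' (x - y) < ⊤ := fun x y hx hy => by
    rw [sub_eq_add_neg, ← neg_one_smul ℂ y]
    exact (hadd' _ _).trans_lt (ENNReal.add_lt_top.2 ⟨hx, fsmul' _ _ hy⟩)
  have d3 : HasDerivWithinAt (fun s => β (a s - a t) (c s - c t)) 0 S t := by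
    rw [hasDerivWithinAt_iff_tendsto_slope, tendsto_iff_edist_tendsto_0]
    have h1 : Tendsto (fun s => C * (N ((((s - t)⁻¹ : ℝ) : ℂ) • (a s - a t) - a') + N a') *
        N' (c s - c t)) (𝓝[S \ {t}] t) (𝓝 0) := by
      have h3 := ENNReal.Tendsto.const_mul (h.tendsto.add (tendsto_const_nhds (x := N a')))
        (Or.inr hC)
      rw [zero_add] at h3
      have := ENNReal.Tendsto.mul h3 (Or.inr (by simp)) (h'.tendsto_sub hadd' hsmul')
        (Or.inr (ENNReal.mul_ne_top hC h.mem_deriv.ne))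
      simpa using this
    refine tendsto_of_tendsto_of_tendsto_of_le_of_le' tendsto_const_nhds h1
      (Eventually.of_forall fun _ => bot_le) ?_
    filter_upwards [self_mem_nhdsWithin] with s hs
    have hs1 := fsub _ _ (h.mem s hs.1) ht1
    have hs2 := fsub' _ _ (h'.mem s hs.1) ht2
    have z0 : β (a t - a t) (c t - c t) = 0 := by
      rw [l_sub _ _ _ ht1 ht1 (fsub' _ _ ht2 ht2), sub_self]
    have e : slope (fun s => β (a s - a t) (c s - c t)) t s - 0 =
        β ((((s - t)⁻¹ : ℝ) : ℂ) • (a s - a t)) (c s - c t) := by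
      rw [slope_def_module, z0, sub_zero, sub_zero, l_smul _ _ _ hs1 hs2, Complex.real_smul]
    rw [edist_eq_enorm_sub, e]
    refine (l_bound _ _ (fsmul _ _ hs1) hs2).trans ?_
    gcongr
    calc _ = N (((((s - t)⁻¹ : ℝ) : ℂ) • (a s - a t) - a') + a') := by rw [sub_add_cancel]
      _ ≤ _ := hadd _ _
  have d4 := ((d1.add d2).add d3).sub_const (β (a t) (c t))
  rw [add_zero] at d4
  refine d4.congr_of_mem (fun s hs => ?_) ht
  have hs1 := h.mem s hs
  have hs2 := h'.mem s hs
  simp only [Pi.add_apply]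
  rw [l_sub _ _ _ hs1 ht1 (fsub' _ _ hs2 ht2), r_sub _ _ _ hs1 hs2 ht2, r_sub _ _ _ ht1 hs2 ht2]
  ring

theorem enorm_J_le : ‖J d‖ₑ ≤ 1 := by
  rw [← ofReal_norm]
  exact ENNReal.ofReal_le_one.2 norm_J_le

theorem traceNorm_weight_le (a : Op d) : traceNorm (J d * a * J d) ≤ traceNorm a := by
  refine (traceNorm_mul_le' _ _).trans ?_
  refine (mul_le_mul' (traceNorm_mul_le _ _) enorm_J_le).trans ?_
  rw [mul_one]
  exact (mul_le_mul' enorm_J_le le_rfl).trans_eq (one_mul _)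

theorem hsNorm_J_mul_le (a : Op d) : hsNorm (J d * a) ≤ hsNorm a :=
  (hsNorm_mul_le _ _).trans ((mul_le_mul' enorm_J_le le_rfl).trans_eq (one_mul _))

/-! ### The energy as a function of `MγM` and `Mσ` -/

/-- `Tr[b[J a J] J a' J]`. -/
def bForm (v : E d → ℝ) (a a' : Op d) : ℂ := trace (b v (J d * a * J d) * (J d * a' * J d))

/-- `Tr[k[J x] (J y)*]`. -/
def kForm (v : E d → ℝ) (x y : Op d) : ℂ := trace (k v (J d * x) * star (J d * y))

/-- The energy in terms of `a = M γ^φ M`, `p = M |φ⟩⟨φ| M` and `x = M σ^φ`. -/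
def energyForm (V v : E d → ℝ) (a p x : Op d) : ℂ :=
  trace (hOp V * a) + 1 / 2 * bForm v a a - 1 / 2 * bForm v p p + 1 / 2 * kForm v x x

section

variable {V v : E d → ℝ} {c : NNReal}

theorem PotBound.hs_k (hv : PotBound v c) {x : Op d} (hx : HS x) : HS (k v (J d * x)) :=
  (hv.hsNorm_sharp_le hx).trans_lt (ENNReal.mul_lt_top (by simp) hx)

theorem PotBound.bForm_bound (hv : PotBound v c) {a a' : Op d} (ha : Nuc a) :
    ‖bForm v a a'‖ₑ ≤ 2 * c * traceNorm a * traceNorm a' :=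
  (enorm_trace_le _).trans <| (traceNorm_mul_le _ _).trans <|
    mul_le_mul' (hv.norm_b_le ha) (traceNorm_weight_le a')

theorem PotBound.kForm_bound (hv : PotBound v c) {x y : Op d} (hx : HS x) :
    ‖kForm v x y‖ₑ ≤ c * hsNorm x * hsNorm y := by
  refine (enorm_trace_le _).trans <| (traceNorm_mul_le_hs _ _).trans <|
    mul_le_mul' (hv.hsNorm_sharp_le hx) ?_
  rw [hsNorm_star]
  exact hsNorm_J_mul_le y

theorem PotBound.bForm_comm (hv : PotBound v c) {a a' : Op d} (ha : Nuc a) (ha' : Nuc a') :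
    bForm v a a' = bForm v a' a := hv.trace_b_comm ha ha'

theorem PotBound.kForm_comm (hv : PotBound v c) {x y : Op d} (hx : HS x) (hy : HS y) :
    kForm v y x = star (kForm v x y) :=
  trace_sharp_mul_star_comm (hv.isSharp hx) (hv.isSharp hy)

theorem bForm_add_right (a : Op d) {x y : Op d} (hx : Nuc x) (hy : Nuc y) :
    bForm v a (x + y) = bForm v a x + bForm v a y := by
  rw [bForm, weight_add, mul_add, trace_add (hx.weight.mul_left _) (hy.weight.mul_left _)]
  rfl

theorem bForm_smul_right (a : Op d) (z : ℂ) (x : Op d) :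
    bForm v a (z • x) = z * bForm v a x := by
  rw [bForm, weight_smul, mul_smul_comm, trace_smul]
  rfl

theorem bForm_sub_right (a : Op d) {x y : Op d} (hx : Nuc x) (hy : Nuc y) :
    bForm v a (x - y) = bForm v a x - bForm v a y := by
  rw [sub_eq_add_neg, ← neg_one_smul ℂ y, bForm_add_right a hx (hy.smul _), bForm_smul_right]
  ring

theorem PotBound.kForm_add_right (hv : PotBound v c) {a x y : Op d} (ha : HS a) (hx : HS x)
    (hy : HS y) : kForm v a (x + y) = kForm v a x + kForm v a y := by
  rw [kForm, mul_add, star_add, mul_add, trace_add ((hv.hs_k ha).mul (hx.mul_left _).star)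
    ((hv.hs_k ha).mul (hy.mul_left _).star)]
  rfl

theorem kForm_smul_right (a : Op d) (z : ℂ) (x : Op d) :
    kForm v a (z • x) = star z * kForm v a x := by
  rw [kForm, mul_smul_comm, star_smul, mul_smul_comm, trace_smul]
  rfl

theorem PotBound.kForm_sub_right (hv : PotBound v c) {a x y : Op d} (ha : HS a) (hx : HS x)
    (hy : HS y) : kForm v a (x - y) = kForm v a x - kForm v a y := by
  rw [sub_eq_add_neg, ← neg_one_smul ℂ y, hv.kForm_add_right ha hx (hy.smul _), kForm_smul_right]
  simp only [star_neg, star_one]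
  ring

/-- The factors ½ cancel because `bForm` is symmetric; `kForm` is Hermitian, so its derivative along
the diagonal is twice a real part. Cyclicity collects the linear term and the `bForm` term into the
trace with `hγOp`. -/
theorem PotBound.hasDerivWithinAt_energyForm (hv : PotBound v c)
    {a p x : ℝ → Op d} {a' p' x' : Op d} {s : Set ℝ} {t : ℝ} (ht : t ∈ s)
    (ha : HasDerivN traceNorm a a' s t) (hp : HasDerivN traceNorm p p' s t)
    (hx : HasDerivN hsNorm x x' s t) :
    HasDerivWithinAt (fun r => energyForm V v (a r) (p r) (x r))
      (trace (hγOp V v (J d * a t * J d) * a') - bForm v (p t) p' + ((kForm v (x t) x').re : ℂ))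
      s t := by
  have d1 := ha.linear ht traceNorm_add_le traceNorm_smul_le (ℓ := fun x => trace (hOp V * x))
    (fun x y hx hy => by rw [mul_sub, trace_sub (Nuc.mul_left _ hx) (Nuc.mul_left _ hy)])
    (fun r x _ => by rw [mul_smul_comm, trace_smul]) (C := ‖hOp V‖ₑ) (by simp)
    (fun x _ => (enorm_trace_le _).trans (traceNorm_mul_le _ _))
  have d2 : ∀ {a : ℝ → Op d} {a' : Op d}, HasDerivN traceNorm a a' s t →
      HasDerivWithinAt (fun r => bForm v (a r) (a r)) (2 * bForm v (a t) a') s t := by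
    intro a a' h
    have := h.bilin h ht traceNorm_add_le traceNorm_smul_le traceNorm_add_le traceNorm_smul_le
      (β := bForm v)
      (fun x y w hx hy hw => by
        rw [hv.bForm_comm (Nuc.sub hx hy) hw, bForm_sub_right _ hx hy, hv.bForm_comm hw hx,
          hv.bForm_comm hw hy])
      (fun r x w hx hw => by
        rw [hv.bForm_comm (Nuc.smul _ hx) hw, bForm_smul_right, hv.bForm_comm hw hx])
      (fun x w y _ hw hy => bForm_sub_right _ hw hy)
      (fun r x w _ _ => bForm_smul_right _ _ _) (C := 2 * c) (ENNReal.mul_ne_top (by simp) (by simp))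
      (fun x w hx _ => hv.bForm_bound hx)
    convert this using 1
    rw [hv.bForm_comm h.mem_deriv (h.mem t ht)]
    ring
  have d3 : HasDerivWithinAt (fun r => kForm v (x r) (x r)) (2 * (kForm v (x t) x').re : ℂ) s t := by
    have := hx.bilin hx ht hsNorm_add_le (fun z y => (hsNorm_smul z y).le) hsNorm_add_le
      (fun z y => (hsNorm_smul z y).le) (β := kForm v)
      (fun x y w hx hy hw => by
        rw [hv.kForm_comm hw (HS.sub hx hy), hv.kForm_sub_right hw hx hy, star_sub,
          ← hv.kForm_comm hw hx, ← hv.kForm_comm hw hy])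
      (fun r x w hx hw => by
        rw [hv.kForm_comm hw (HS.smul _ hx), kForm_smul_right, star_mul', ← hv.kForm_comm hw hx]
        simp)
      (fun x w y hx hw hy => hv.kForm_sub_right hx hw hy)
      (fun r x w _ _ => by rw [kForm_smul_right]; simp)
      (C := c) (by simp) (fun x w hx _ => hv.kForm_bound hx)
    convert this using 1
    rw [hv.kForm_comm (hx.mem t ht) hx.mem_deriv, ← starRingEnd_apply, add_comm, Complex.add_conj]
    push_cast
    rfl
  have d4 := ((d1.add ((d2 ha).const_mul (1 / 2))).sub ((d2 hp).const_mul (1 / 2))).add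
    (d3.const_mul (1 / 2))
  refine d4.congr_deriv ?_
  have e : trace (hγOp V v (J d * a t * J d) * a') = trace (hOp V * a') + bForm v (a t) a' := by
    have hn : Nuc a' := ha.mem_deriv
    rw [hγOp, add_mul, trace_add (hn.mul_left _) (hn.mul_left _), bForm]
    congr 1
    rw [← mul_assoc, ← mul_assoc, mul_assoc (J d), mul_assoc (J d)]
    exact (trace_mul_comm_of_nuc (hn.mul_left _) _).symm
  rw [e]
  ring

/-- The energy contains the interaction of γ with itself and with the condensate, but in this part
no self-interaction of the condensate. Completing the square in a + p produces that
self-interaction, which is why `energyForm` subtracts ½ `bForm v p p`. -/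
theorem PotBound.energyForm_add (hv : PotBound v c) {a p x : Op d} (ha : Nuc a) (hp : Nuc p) :
    energyForm V v (a + p) p x = trace (hOp V * (a + p)) + bForm v p a + 1 / 2 * bForm v a a
      + 1 / 2 * kForm v x x := by
  have h : bForm v (a + p) (a + p) = bForm v a a + 2 * bForm v p a + bForm v p p := by
    rw [bForm_add_right _ ha hp, hv.bForm_comm (ha.add hp) ha, hv.bForm_comm (ha.add hp) hp,
      bForm_add_right _ ha hp, bForm_add_right _ ha hp, hv.bForm_comm ha hp]
    ring
  rw [energyForm, h]
  ring

theorem ketbra_J (f : L2 d) : ketbra (J d f) (J d f) = J d * ketbra f f * J d := by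
  rw [mul_ketbra, ketbra_mul, star_J]

theorem PotBound.energy_eq (hv : PotBound v c) (f : L2 d) {a x : Op d} (ha : Nuc a) (hx : HS x) :
    energy V v (J d f, J d * a * J d, J d * x) =
      energyForm V v (a + ketbra f f) (ketbra f f) (x + ketbra f (star (J d f))) := by
  have hx' : HS (x + ketbra f (star (J d f))) := hx.add (Nuc.ketbra _ _).hs
  rw [hv.energyForm_add ha (Nuc.ketbra f f), energy]
  simp only [γφ]
  rw [ketbra_J, ← weight_add, weight_one_one]
  congr 2
  have e : J d * (x + ketbra f (star (J d f))) = J d * x + ketbra (J d f) (star (J d f)) := by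
    rw [mul_add, mul_ketbra]
  obtain ⟨K, hK⟩ := (hx.mul_left (J d)).exists_hasKernel
  have h1 := hasKernel_kernel (hx.mul_left (J d))
  have h2 := h1.add (hasKernel_ketbra (J d f) (star (J d f)))
  rw [← e] at h2
  rw [kForm, k, trace_sharp_mul_star (hv.isSharp hx') h2 h2, ← integral_complex_ofReal]
  refine integral_congr_ae ?_
  have h3 := ae_prod_snd (Lp.coeFn_star (J d f))
  filter_upwards [h3] with p hp
  simp only [Pi.add_apply]
  rw [hp, Pi.star_apply, star_star, ← starRingEnd_apply, Complex.mul_conj']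
  push_cast
  rfl

/-- Since γ₀ is self-adjoint, the second factor in the pairing term of `ham` is the adjoint of
σ_{u,w} + |φ⟩⟨φ̄|, so that term is the diagonal value of `kForm`. -/
theorem PotBound.ham_eq (hv : PotBound v c) (f : L2 d) {γ₀ u w a x : Op d} (hs : star γ₀ = γ₀)
    (ha : Nuc a) (hg : gamOf γ₀ u w = J d * a * J d) (hσ : sigOf γ₀ u w = J d * x) :
    ham V v γ₀ (J d f) u w =
      energyForm V v (a + ketbra f f) (ketbra f f) (x + ketbra f (star (J d f))) := by
  rw [hv.energyForm_add ha (Nuc.ketbra f f), ham, hg, hσ, Mvec_J, weight_one_one, ketbra_J]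
  have e : J d * (x + ketbra f (star (J d f))) = J d * x + ketbra (J d f) (star (J d f)) := by
    rw [mul_add, mul_ketbra]
  have e2 : star (sigOf γ₀ u w) =
      star w * γ₀ * u + transp u * (1 + conj γ₀) * conj w := by
    simp only [sigOf, star_add, star_mul, star_star, hs, star_conj, star_one, transp]
    simp only [← mul_assoc]
  have e3 : star (J d * (x + ketbra f (star (J d f)))) =
      star w * γ₀ * u + transp u * (1 + conj γ₀) * conj w + ketbra (star (J d f)) (J d f) := by
    rw [e, star_add, ← hσ, e2, star_ketbra]
  rw [← e, ← e3, ← kForm, trace_mul_comm_of_nuc ha.weight, ← ketbra_J, mul_add,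
    trace_add (ha.mul_left _) ((Nuc.ketbra f f).mul_left _), mul_ketbra, trace_ketbra,
    trace_mul_comm_of_nuc ha, trace_mul_comm_of_nuc ha.weight, ketbra_J]
  simp only [bForm]
  ring

end

/-- The difference quotient minus a₁ equals ε a₂. Moving u or w along a line changes γ_{u,w} and
σ_{u,w} by such polynomials. -/
theorem hasDerivN_poly {N : Op d → ℝ≥0∞} (hadd : ∀ x y, N (x + y) ≤ N x + N y)
    (hsmul : ∀ (z : ℂ) x, N (z • x) ≤ ‖z‖ₑ * N x) {a₀ a₁ a₂ : Op d} (h0 : N a₀ < ⊤)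
    (h1 : N a₁ < ⊤) (h2 : N a₂ < ⊤) :
    HasDerivN N (fun ε : ℝ => a₀ + (ε : ℂ) • a₁ + ((ε : ℂ) ^ 2) • a₂) a₁ Set.univ 0 := by
  have fsmul : ∀ (z : ℂ) x, N x < ⊤ → N (z • x) < ⊤ := fun z x hx =>
    (hsmul z x).trans_lt (ENNReal.mul_lt_top (by simp) hx)
  have fadd : ∀ x y, N x < ⊤ → N y < ⊤ → N (x + y) < ⊤ := fun x y hx hy =>
    (hadd _ _).trans_lt (ENNReal.add_lt_top.2 ⟨hx, hy⟩)
  refine ⟨fun s _ => fadd _ _ (fadd _ _ h0 (fsmul _ _ h1)) (fsmul _ _ h2), h1, ?_⟩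
  have h3 : Tendsto (fun s : ℝ => ‖(s : ℂ)‖ₑ * N a₂) (𝓝[Set.univ \ {0}] 0) (𝓝 0) := by
    have h4 : Tendsto (fun s : ℝ => ‖(s : ℂ)‖ₑ) (𝓝[Set.univ \ {0}] 0) (𝓝 0) := by
      have : Continuous fun s : ℝ => ‖(s : ℂ)‖ₑ := by fun_prop
      have h3 := (this.tendsto 0).mono_left (nhdsWithin_le_nhds (s := Set.univ \ {0}))
      simpa using h3
    have := ENNReal.Tendsto.mul_const h4 (Or.inr h2.ne)
    simpa using this
  refine tendsto_of_tendsto_of_tendsto_of_le_of_le' tendsto_const_nhds h3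
    (Eventually.of_forall fun _ => bot_le) ?_
  filter_upwards [self_mem_nhdsWithin] with s hs
  have hne : (s : ℂ) ≠ 0 := by exact_mod_cast hs.2
  refine le_trans (le_of_eq ?_) (hsmul (s : ℂ) a₂)
  congr 1
  simp only [sub_zero, Complex.ofReal_zero, zero_smul, add_zero, ne_eq, OfNat.ofNat_ne_zero,
    not_false_eq_true, zero_pow, Complex.ofReal_inv]
  rw [add_assoc, add_sub_cancel_left, smul_add, smul_smul, smul_smul, inv_mul_cancel₀ hne, one_smul,
    add_sub_cancel_left]
  congr 1
  field_simp

/-! ### Classical solutions in terms of `M φ`, `M γ M` and `M σ` -/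

theorem sobolevNorm_lt_top {j : ℕ} {f : L2 d} (h : sobolevNorm (j + 1) f < ⊤) :
    ∃ g, f = J d g := by
  simp only [sobolevNorm, iInf_lt_iff] at h
  obtain ⟨g, rfl, -⟩ := h
  exact ⟨(J d ^ j) g, by rw [pow_succ']; rfl⟩

theorem calHNorm_lt_top {j : ℕ} {A : Op d} (h : calHNorm (j + 1) A < ⊤) :
    ∃ a, Nuc a ∧ A = J d * a * J d := by
  simp only [calHNorm, iInf_lt_iff] at h
  obtain ⟨B, rfl, hB⟩ := h
  refine ⟨J d ^ j * B * J d ^ j, (Nuc.mul_left _ hB).mul_right _, ?_⟩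
  conv_lhs => rw [pow_succ', ← pow_succ', pow_succ' (J d) j]
  simp only [mul_assoc]
  rw [← pow_succ, ← pow_succ']

theorem sobolevNorm₂_lt_top {j : ℕ} {A : Op d} (h : sobolevNorm₂ (j + 1) A < ⊤) :
    ∃ x, HS x ∧ A = J d * x := by
  rw [sobolevNorm₂, ENNReal.rpow_lt_top_iff_of_pos (by norm_num), ENNReal.sum_lt_top] at h
  have h1 := h (j + 1) (by simp)
  rw [Nat.choose_self, Nat.cast_one, one_mul, ENNReal.pow_lt_top_iff] at h1
  simp only [two_ne_zero, or_false, iInf_lt_iff] at h1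
  obtain ⟨B, hA, hB⟩ := h1
  refine ⟨J d ^ j * B, HS.mul_left _ hB, ?_⟩
  rw [hA, Nat.sub_self, pow_zero, mul_one, pow_succ', mul_assoc]

theorem hsNorm_le_sobolevNorm₂ (x : Op d) : hsNorm x ≤ sobolevNorm₂ 1 (J d * x) := by
  rw [sobolevNorm₂]
  conv_lhs => rw [← sq_rpow_half (hsNorm x)]
  refine ENNReal.rpow_le_rpow ?_ (by norm_num)
  rw [Finset.sum_range_succ]
  refine le_add_left ?_
  rw [Nat.choose_self, Nat.cast_one, one_mul]
  gcongr
  refine le_iInf₂ fun B hB => ?_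
  rw [Nat.sub_self, pow_zero, mul_one, pow_one] at hB
  rw [J_mul_cancel hB]

theorem MemX.exists_lift {j : ℕ} {ρ : State d} (h : MemX (j + 1) ρ) :
    ∃ f a x, Nuc a ∧ star a = a ∧ HS x ∧ transp (J d * x) = J d * x ∧
      ρ = (J d f, J d * a * J d, J d * x) := by
  obtain ⟨φ, γ, σ⟩ := ρ
  obtain ⟨h1, h2, h3⟩ := h
  rw [normX, ENNReal.add_lt_top, ENNReal.add_lt_top] at h1
  obtain ⟨f, hf⟩ := sobolevNorm_lt_top h1.1.1
  obtain ⟨a, ha, hγ⟩ := calHNorm_lt_top h1.1.2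
  obtain ⟨x, hx, hσ⟩ := sobolevNorm₂_lt_top h1.2
  simp only at hf hγ hσ h2 h3
  subst hf hγ hσ
  refine ⟨f, a, x, ha, ?_, hx, h3, rfl⟩
  rw [star_weight] at h2
  exact J_mul_cancel (mul_J_cancel h2)

/-- Classical solutions of the HFB equations in terms of `f = M φ`, `a = M γ M`, `x = M σ`. -/
structure IsLift (V v : E d → ℝ) (T : ℝ) (f : ℝ → L2 d) (a x : ℝ → Op d) (f' : ℝ → L2 d)
    (a' x' : ℝ → Op d) : Prop where
  nuc : ∀ t ∈ Set.Ico 0 T, Nuc (a t)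
  star_a : ∀ t ∈ Set.Ico 0 T, star (a t) = a t
  hs : ∀ t ∈ Set.Ico 0 T, HS (x t)
  transp_x : ∀ t ∈ Set.Ico 0 T, transp (J d * x t) = J d * x t
  nuc' : ∀ t ∈ Set.Ico 0 T, Nuc (a' t)
  star_a' : ∀ t ∈ Set.Ico 0 T, star (a' t) = a' t
  hs' : ∀ t ∈ Set.Ico 0 T, HS (x' t)
  transp_x' : ∀ t ∈ Set.Ico 0 T, transp (J d * x' t) = J d * x' t
  deriv_f : ∀ t ∈ Set.Ico 0 T, HasDerivWithinAt f (f' t) (Set.Ico 0 T) t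
  deriv_a : ∀ t ∈ Set.Ico 0 T, HasDerivN traceNorm a (a' t) (Set.Ico 0 T) t
  deriv_x : ∀ t ∈ Set.Ico 0 T, HasDerivN hsNorm x (x' t) (Set.Ico 0 T) t
  eqn : ∀ t ∈ Set.Ico 0 T, HFBEq V v (J d (f t), J d * a t * J d, J d * x t)
    (J d (f' t), J d * a' t * J d, J d * x' t)

theorem IsClassicalSolution.exists_lift {V v : E d → ℝ} {T : ℝ} {ρ ρ' : ℝ → State d}
    (h : IsClassicalSolution V v T ρ ρ') :
    ∃ f a x f' a' x', IsLift V v T f a x f' a' x' ∧ ∀ t ∈ Set.Ico 0 T,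
      ρ t = (J d (f t), J d * a t * J d, J d * x t) ∧
      ρ' t = (J d (f' t), J d * a' t * J d, J d * x' t) := by
  have h1 : ∀ t, ∃ f a x, t ∈ Set.Ico 0 T → Nuc a ∧ star a = a ∧ HS x ∧
      transp (J d * x) = J d * x ∧ ρ t = (J d f, J d * a * J d, J d * x) := by
    intro t
    by_cases ht : t ∈ Set.Ico 0 T
    · obtain ⟨f, a, x, hh⟩ := (h.cont t ht).1.exists_lift
      exact ⟨f, a, x, fun _ => hh⟩
    · exact ⟨0, 0, 0, fun hh => absurd hh ht⟩
  have h2 : ∀ t, ∃ f a x, t ∈ Set.Ico 0 T → Nuc a ∧ star a = a ∧ HS x ∧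
      transp (J d * x) = J d * x ∧ ρ' t = (J d f, J d * a * J d, J d * x) := by
    intro t
    by_cases ht : t ∈ Set.Ico 0 T
    · obtain ⟨f, a, x, hh⟩ := MemX.exists_lift (j := 0) (h.cont_deriv t ht).1
      exact ⟨f, a, x, fun _ => hh⟩
    · exact ⟨0, 0, 0, fun hh => absurd hh ht⟩
  choose f a x h1 using h1
  choose f' a' x' h2 using h2
  -- By linearity the difference quotients of ρ are the images under `J` of those of f, a, x. The X¹
  -- norm dominates the L², trace and Hilbert-Schmidt norms of the latter, so differentiability in
  -- X¹ passes to the lifts.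
  have key : ∀ t ∈ Set.Ico 0 T, ∀ s ∈ Set.Ico 0 T,
      (s - t)⁻¹ • (ρ s - ρ t) - ρ' t =
        (J d ((((s - t)⁻¹ : ℝ) : ℂ) • (f s - f t) - f' t),
          J d * ((((s - t)⁻¹ : ℝ) : ℂ) • (a s - a t) - a' t) * J d,
          J d * ((((s - t)⁻¹ : ℝ) : ℂ) • (x s - x t) - x' t)) := by
    intro t ht s hs
    rw [(h1 t ht).2.2.2.2, (h1 s hs).2.2.2.2, (h2 t ht).2.2.2.2]
    refine Prod.ext ?_ (Prod.ext ?_ ?_)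
    · simp only [Prod.fst_sub, Prod.smul_fst, map_sub, map_smul]
      rw [Complex.coe_smul]
      rfl
    · simp only [Prod.snd_sub, Prod.smul_snd, Prod.fst_sub, Prod.smul_fst]
      rw [mul_sub, sub_mul, mul_smul_comm, smul_mul_assoc, mul_sub, sub_mul, Complex.coe_smul]
      rfl
    · simp only [Prod.snd_sub, Prod.smul_snd]
      rw [mul_sub, mul_smul_comm, mul_sub, Complex.coe_smul]
      rfl
  have lim : ∀ {N : ℝ → ℝ≥0∞} {t : ℝ}, t ∈ Set.Ico 0 T → (∀ s ∈ Set.Ico 0 T,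
      N s ≤ normX 1 ((s - t)⁻¹ • (ρ s - ρ t) - ρ' t)) →
      Tendsto N (𝓝[Set.Ico 0 T \ {t}] t) (𝓝 0) := by
    intro N t ht hN
    refine tendsto_of_tendsto_of_tendsto_of_le_of_le' tendsto_const_nhds (h.hasDeriv t ht)
      (Eventually.of_forall fun _ => bot_le) ?_
    filter_upwards [self_mem_nhdsWithin] with s hs
    exact hN s hs.1
  refine ⟨f, a, x, f', a', x', ?_, fun t ht => ⟨(h1 t ht).2.2.2.2, (h2 t ht).2.2.2.2⟩⟩
  refine ⟨fun t ht => (h1 t ht).1, fun t ht => (h1 t ht).2.1, fun t ht => (h1 t ht).2.2.1,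
    fun t ht => (h1 t ht).2.2.2.1, fun t ht => (h2 t ht).1, fun t ht => (h2 t ht).2.1,
    fun t ht => (h2 t ht).2.2.1, fun t ht => (h2 t ht).2.2.2.1, fun t ht => ?_,
    fun t ht => ⟨fun s hs => (h1 s hs).1, (h2 t ht).1, lim ht fun s hs => ?_⟩,
    fun t ht => ⟨fun s hs => (h1 s hs).2.2.1, (h2 t ht).2.2.1, lim ht fun s hs => ?_⟩,
    fun t ht => ?_⟩
  · rw [hasDerivWithinAt_iff_tendsto_slope, tendsto_iff_edist_tendsto_0]
    refine lim ht fun s hs => ?_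
    rw [key t ht s hs, normX, sobolevNorm_J, add_assoc, edist_eq_enorm_sub, slope_def_module,
      Complex.coe_smul]
    exact le_self_add
  · rw [key t ht s hs, normX, calHNorm_J, add_right_comm]
    exact le_add_self
  · rw [key t ht s hs, normX]
    exact (hsNorm_le_sobolevNorm₂ _).trans le_add_self
  · rw [← (h1 t ht).2.2.2.2, ← (h2 t ht).2.2.2.2]
    exact h.eqn t ht

theorem HasDerivN.mono {N N' : Op d → ℝ≥0∞} (hN : ∀ x, N' x ≤ N x) {a : ℝ → Op d} {a' : Op d}
    {S : Set ℝ} {t : ℝ} (h : HasDerivN N a a' S t) : HasDerivN N' a a' S t :=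
  ⟨fun s hs => (hN _).trans_lt (h.mem s hs), (hN _).trans_lt h.mem_deriv,
    tendsto_of_tendsto_of_tendsto_of_le_of_le tendsto_const_nhds h.tendsto (fun _ => bot_le)
      fun _ => hN _⟩

protected theorem HasDerivN.add {N : Op d → ℝ≥0∞} (hadd : ∀ x y, N (x + y) ≤ N x + N y)
    {a c : ℝ → Op d} {a' c' : Op d} {S : Set ℝ} {t : ℝ} (h : HasDerivN N a a' S t)
    (h' : HasDerivN N c c' S t) : HasDerivN N (fun s => a s + c s) (a' + c') S t := by
  refine ⟨fun s hs => (hadd _ _).trans_lt (ENNReal.add_lt_top.2 ⟨h.mem s hs, h'.mem s hs⟩),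
    (hadd _ _).trans_lt (ENNReal.add_lt_top.2 ⟨h.mem_deriv, h'.mem_deriv⟩), ?_⟩
  have h1 := h.tendsto.add h'.tendsto
  rw [zero_add] at h1
  refine tendsto_of_tendsto_of_tendsto_of_le_of_le tendsto_const_nhds h1 (fun _ => bot_le)
    fun s => ?_
  have e : (((s - t)⁻¹ : ℝ) : ℂ) • (a s + c s - (a t + c t)) - (a' + c') =
      ((((s - t)⁻¹ : ℝ) : ℂ) • (a s - a t) - a') + ((((s - t)⁻¹ : ℝ) : ℂ) • (c s - c t) - c') := by
    rw [add_sub_add_comm, smul_add]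
    abel
  simp only [e]
  exact hadd _ _

/-- Leibniz rule, with the remainder written as three rank-one operators whose trace norms are
bounded by products of vector norms. -/
theorem hasDerivN_ketbra {f g : ℝ → L2 d} {f' g' : L2 d} {S : Set ℝ} {t : ℝ}
    (hf : HasDerivWithinAt f f' S t) (hg : HasDerivWithinAt g g' S t) :
    HasDerivN traceNorm (fun s => ketbra (f s) (g s)) (ketbra f' (g t) + ketbra (f t) g') S t := by
  refine ⟨fun s _ => Nuc.ketbra _ _, (Nuc.ketbra _ _).add (Nuc.ketbra _ _), ?_⟩
  have lim : ∀ {f : ℝ → L2 d} {f' : L2 d}, HasDerivWithinAt f f' S t →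
      Tendsto (fun s => ‖(((s - t)⁻¹ : ℝ) : ℂ) • (f s - f t) - f'‖ₑ) (𝓝[S \ {t}] t) (𝓝 0) := by
    intro f f' hf
    rw [hasDerivWithinAt_iff_tendsto_slope, tendsto_iff_edist_tendsto_0] at hf
    refine hf.congr fun s => ?_
    rw [edist_eq_enorm_sub, slope_def_module, Complex.coe_smul]
    rfl
  have hc : Tendsto (fun s => ‖g s‖ₑ) (𝓝[S \ {t}] t) (𝓝 ‖g t‖ₑ) :=
    (continuous_enorm.tendsto _).comp
      (hg.continuousWithinAt.mono_left (nhdsWithin_mono _ Set.sdiff_subset))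
  have hc' : Tendsto (fun s => ‖g s - g t‖ₑ) (𝓝[S \ {t}] t) (𝓝 0) := by
    have h0 := (hg.continuousWithinAt.mono_left (nhdsWithin_mono _ Set.sdiff_subset
      (s := S \ {t}))).sub_const (g t)
    have := (continuous_enorm.tendsto _).comp h0
    simpa [Function.comp_def] using this
  have h1 := ((ENNReal.Tendsto.mul (lim hf) (Or.inr (by simp)) hc (Or.inr (by simp))).add
    (ENNReal.Tendsto.const_mul hc' (a := ‖f'‖ₑ) (Or.inr (by simp)))).add
    (ENNReal.Tendsto.const_mul (lim hg) (a := ‖f t‖ₑ) (Or.inr (by simp)))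
  simp only [zero_mul, mul_zero, add_zero] at h1
  refine tendsto_of_tendsto_of_tendsto_of_le_of_le tendsto_const_nhds h1 (fun _ => bot_le)
    fun s => ?_
  have ksub : ∀ f g h : L2 d, ketbra (f - g) h = ketbra f h - ketbra g h := fun f g h => by
    rw [sub_eq_add_neg, ← neg_one_smul ℂ g, ketbra_add_left, ketbra_smul_left]
    simp [sub_eq_add_neg]
  have ksub' : ∀ f g h : L2 d, ketbra h (f - g) = ketbra h f - ketbra h g := fun f g h => by
    rw [← star_ketbra, ksub, star_sub, star_ketbra, star_ketbra]
  have e : (((s - t)⁻¹ : ℝ) : ℂ) • (ketbra (f s) (g s) - ketbra (f t) (g t))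
      - (ketbra f' (g t) + ketbra (f t) g') =
      ketbra ((((s - t)⁻¹ : ℝ) : ℂ) • (f s - f t) - f') (g s) + ketbra f' (g s - g t)
        + ketbra (f t) ((((s - t)⁻¹ : ℝ) : ℂ) • (g s - g t) - g') := by
    simp only [ksub, ksub', ketbra_smul_left, ketbra_smul_right, Complex.star_def,
      Complex.conj_ofReal, smul_sub]
    abel
  simp only [e]
  refine (traceNorm_add_le _ _).trans (add_le_add ((traceNorm_add_le _ _).trans
    (add_le_add ?_ ?_)) ?_) <;> exact traceNorm_ketbra_le _ _

/-! ### The HFB equations in the lifted variables -/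

section

variable {V v : E d → ℝ} {c : NNReal} {T : ℝ} {f f' : ℝ → L2 d} {a x a' x' : ℝ → Op d}

/-- `M⁻¹ h(γ^φ) M⁻¹` for `φ = J f`, `γ = J a J`. -/
def hLift (V v : E d → ℝ) (f : L2 d) (a : Op d) : Op d :=
  hγOp V v (γφ (J d f) (J d * a * J d))

/-- `k[σ^φ]` for `φ = J f`, `σ = J x`. -/
def kLift (v : E d → ℝ) (f : L2 d) (x : Op d) : Op d := k v (σφ (J d f) (J d * x))

theorem hLift_eq (f : L2 d) (a : Op d) :
    hLift V v f a = hγOp V v (J d * (a + ketbra f f) * J d) := by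
  rw [hLift, γφ, ketbra_J, ← weight_add]

theorem kLift_eq (f : L2 d) (x : Op d) :
    kLift v f x = k v (J d * (x + ketbra f (star (J d f)))) := by
  rw [kLift, σφ, mul_add, mul_ketbra]

theorem star_hLift (hV : Measurable V) (hVb : InfFormBounded V) (hv : PotBound v c) (f : L2 d)
    {a : Op d} (ha : Nuc a) (hs : star a = a) : star (hLift V v f a) = hLift V v f a := by
  rw [hLift_eq]
  exact star_hγOp hV hVb hv (ha.add (Nuc.ketbra _ _)) (by rw [star_add, hs, star_ketbra])

theorem PotBound.hs_kLift (hv : PotBound v c) (f : L2 d) {x : Op d} (hx : HS x) :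
    HS (kLift v f x) := by
  rw [kLift_eq]
  exact hv.hs_k (hx.add (Nuc.ketbra _ _).hs)

theorem PotBound.transp_kLift (hv : PotBound v c) (f : L2 d) {x : Op d} (hx : HS x)
    (hs : transp (J d * x) = J d * x) : transp (kLift v f x) = kLift v f x := by
  rw [kLift_eq, k, ← sharp_transp hv.even (hv.isSharp (hx.add (Nuc.ketbra _ _).hs)), mul_add,
    transp_add, hs, mul_ketbra, transp_ketbra, star_star]

theorem PotBound.star_kLift (hv : PotBound v c) (f : L2 d) {x : Op d} (hx : HS x)
    (hs : transp (J d * x) = J d * x) : star (kLift v f x) = conj (kLift v f x) := by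
  conv_lhs => rw [← hv.transp_kLift f hx hs, star_transp]

theorem transp_J_mul {x : Op d} (hs : transp (J d * x) = J d * x) :
    transp x * J d = J d * x := by
  rw [← hs, transp_mul, transp_J]

/-- The symmetry of σ and k lets adjoints be written as conjugates, and lets the weight on σ stand
on either side: Jx = xᵀJ. All terms then become words in a, x, h, k and their conjugates, ready for
comparison with block matrices. -/
theorem IsLift.eqn_γ (h : IsLift V v T f a x f' a' x') (hv : PotBound v c) {t : ℝ} (ht : t ∈ Set.Ico 0 T) :
    Complex.I • (J d * (J d * a' t * J d) * J d) =
      hLift V v (f t) (a t) * a t * J d * J d - J d * J d * a t * hLift V v (f t) (a t)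
        + J d * kLift v (f t) (x t) * J d * conj (x t) * J d
        - J d * transp (x t) * J d * conj (kLift v (f t) (x t)) * J d := by
  have e : _ = hLift V v (f t) (a t) * (weight 1 0 (J d * a t * J d) * J d)
      - (J d * weight 0 1 (J d * a t * J d)) * hLift V v (f t) (a t)
      + J d * (kLift v (f t) (x t) * star (J d * x t) - J d * x t * star (kLift v (f t) (x t)))
        * J d := (h.eqn t ht).2.1
  have w1 : weight 1 0 (J d * a t * J d) = a t * J d := by rw [mul_assoc, weight_one_zero]
  simp only [w1, weight_zero_one] at e
  have s1 : star (J d * x t) = J d * conj (x t) := by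
    rw [← h.transp_x t ht, star_transp, conj_mul, conj_J]
  rw [e, s1, hv.star_kLift _ (h.hs t ht) (h.transp_x t ht), ← transp_J_mul (h.transp_x t ht)]
  simp only [mul_sub, sub_mul, ← mul_assoc]
  abel

theorem IsLift.eqn_σ (h : IsLift V v T f a x f' a' x') (hV : Measurable V)
    (hVb : InfFormBounded V) (hv : PotBound v c) {t : ℝ} (ht : t ∈ Set.Ico 0 T) :
    Complex.I • (J d * (J d * x' t) * J d) =
      hLift V v (f t) (a t) * x t * J d + J d * transp (x t) * conj (hLift V v (f t) (a t))
        + J d * kLift v (f t) (x t) * J d * conj (a t) * J d * J d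
        + J d * J d * a t * J d * kLift v (f t) (x t) * J d
        + J d * kLift v (f t) (x t) * J d := by
  have e : _ = hLift V v (f t) (a t) * (weight 1 0 (transp (J d * x t)) * J d)
      + (J d * weight 0 1 (J d * x t)) * transp (hLift V v (f t) (a t))
      + J d * (kLift v (f t) (x t) * transp (J d * a t * J d)
        + J d * a t * J d * transp (kLift v (f t) (x t)) + kLift v (f t) (x t)) * J d :=
    (h.eqn t ht).2.2
  have w1 : weight 0 1 (J d * x t) = transp (x t) := by
    rw [← transp_J_mul (h.transp_x t ht), weight_zero_one]
  have s1 : transp (J d * a t * J d) = J d * conj (a t) * J d := by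
    simp only [transp_mul, transp_J, mul_assoc]
    rw [transp, h.star_a t ht]
  have s2 : transp (hLift V v (f t) (a t)) = conj (hLift V v (f t) (a t)) := by
    rw [transp, star_hLift hV hVb hv _ (h.nuc t ht) (h.star_a t ht)]
  simp only [w1, h.transp_x t ht, weight_one_zero, s1, s2] at e
  rw [e, hv.transp_kLift _ (h.hs t ht) (h.transp_x t ht)]
  simp only [mul_add, add_mul, ← mul_assoc]
  abel

theorem IsLift.eqn_φ (h : IsLift V v T f a x f' a' x') {t : ℝ} (ht : t ∈ Set.Ico 0 T) :
    Complex.I • J d (J d (f' t)) = hγOp V v (J d * a t * J d) (f t)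
      + J d (kLift v (f t) (x t) (star (J d (f t)))) := by
  have e : _ = hγOp V v (J d * a t * J d) (Mvec (J d (f t)))
    + J d (kLift v (f t) (x t) (star (J d (f t)))) := (h.eqn t ht).1
  rwa [Mvec_J] at e

/-! ### Derivatives of products tested on `H¹` -/

theorem tendsto_op_apply {l : Filter ℝ} {A : ℝ → Op d} {A₀ : Op d} {g : ℝ → L2 d} {g₀ : L2 d}
    (hA : Tendsto A l (𝓝 A₀)) (hg : Tendsto g l (𝓝 g₀)) :
    Tendsto (fun s => A s (g s)) l (𝓝 (A₀ g₀)) :=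
  ((isBoundedBilinearMap_apply (𝕜 := ℂ) (E := L2 d) (F := L2 d)).continuous.tendsto (A₀, g₀)).comp
    (hA.prodMk_nhds hg)

/-- Along sequences, weak convergence implies boundedness by Banach–Steinhaus, and a bounded weakly
convergent factor may be paired with a strongly convergent one. The countability of the filter is
what permits the passage to sequences. -/
theorem tendsto_inner_of_weak {l : Filter ℝ} [l.IsCountablyGenerated] {η h : ℝ → L2 d}
    {η₀ h₀ : L2 d} (hη : ∀ g, Tendsto (fun s => ⟪η s, g⟫) l (𝓝 ⟪η₀, g⟫))
    (hh : Tendsto h l (𝓝 h₀)) : Tendsto (fun s => ⟪η s, h s⟫) l (𝓝 ⟪η₀, h₀⟫) := by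
  refine tendsto_of_seq_tendsto fun s hs => ?_
  obtain ⟨C, hC⟩ : ∃ C, ∀ n, ‖innerSL ℂ (η (s n))‖ ≤ C := by
    refine banach_steinhaus fun g => ?_
    obtain ⟨C, hC⟩ := ((hη g).comp hs).norm.bddAbove_range
    exact ⟨C, fun n => hC ⟨n, rfl⟩⟩
  have h1 : Tendsto (fun n => ⟪η (s n), h (s n) - h₀⟫) atTop (𝓝 0) := by
    have h2 : Tendsto (fun n => C * ‖h (s n) - h₀‖) atTop (𝓝 0) := by
      have := ((hh.comp hs).sub_const h₀).norm.const_mul C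
      simpa using this
    refine squeeze_zero_norm (fun n => ?_) h2
    calc _ ≤ ‖innerSL ℂ (η (s n))‖ * ‖h (s n) - h₀‖ := (innerSL ℂ (η (s n))).le_opNorm _
      _ ≤ _ := by gcongr; exact hC n
  have h3 := h1.add ((hη h₀).comp hs)
  rw [zero_add] at h3
  refine h3.congr fun n => ?_
  simp only [Function.comp_apply, inner_sub_right, sub_add_cancel]

theorem inner_real_smul_left (r : ℝ) (f g : L2 d) : ⟪r • f, g⟫ = r * ⟪f, g⟫ := by
  rw [show r • f = (r : ℂ) • f from (Complex.coe_smul r f).symm, inner_smul_left,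
    Complex.conj_ofReal]

theorem inner_real_smul_right (r : ℝ) (f g : L2 d) : ⟪f, r • g⟫ = r * ⟪f, g⟫ := by
  rw [show r • g = (r : ℂ) • g from (Complex.coe_smul r g).symm, inner_smul_right]

/-- A product rule when Jp and Jq are differentiable only as functionals tested on H¹. The increment
is split so that the weak difference quotient of p meets G(Jq) = J(Nq), with Nq converging strongly,
while for q the operator G is moved onto the fixed test vector, which stays in H¹ by the hypothesis
on N'. -/
theorem hasDerivWithinAt_sandwich {p q : ℝ → L2 d} {η ζ : L2 d} {G N : ℝ → Op d} {G' N' : Op d}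
    {s : Set ℝ} {t : ℝ} (ht : t ∈ s)
    (hp : ∀ g, HasDerivWithinAt (fun r => ⟪J d g, J d (p r)⟫) ⟪g, η⟫ s t)
    (hq : ∀ g, HasDerivWithinAt (fun r => ⟪J d g, J d (q r)⟫) ⟪g, ζ⟫ s t)
    (cq : ContinuousWithinAt q s t) (cN : ContinuousWithinAt N s t)
    (hG : HasDerivWithinAt G G' s t) (hN : ∀ r ∈ s, G r * J d = J d * N r)
    (hN' : star (G t) * J d = J d * N') :
    HasDerivWithinAt (fun r => ⟪J d (p r), G r (J d (q r))⟫)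
      (⟪η, N t (q t)⟫ + ⟪J d (p t), G' (J d (q t))⟫ + ⟪N' (p t), ζ⟫) s t := by
  have cq' := cq.mono (Set.sdiff_subset (t := {t}))
  have cN' := cN.mono (Set.sdiff_subset (t := {t}))
  have dA : HasDerivWithinAt (fun r => ⟪J d (p r) - J d (p t), G r (J d (q r))⟫)
      ⟪η, N t (q t)⟫ s t := by
    rw [hasDerivWithinAt_iff_tendsto_slope]
    have h1 : Tendsto (fun r => ⟪(r - t)⁻¹ • J d (J d (p r) - J d (p t)), N r (q r)⟫)
        (𝓝[s \ {t}] t) (𝓝 ⟪η, N t (q t)⟫) := by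
      refine tendsto_inner_of_weak (fun g => ?_) (tendsto_op_apply cN' cq')
      have h2 := hasDerivWithinAt_iff_tendsto_slope.1 (hp g)
      have h3 := (Complex.continuous_conj.tendsto _).comp h2
      rw [inner_conj_symm] at h3
      refine h3.congr fun r => ?_
      rw [Function.comp_apply, slope_def_module, ← inner_sub_right, Complex.real_smul, map_mul,
        inner_conj_symm, Complex.conj_ofReal, inner_real_smul_left, J_inner]
    refine h1.congr' ?_
    filter_upwards [self_mem_nhdsWithin] with r hr
    have e : G r (J d (q r)) = J d (N r (q r)) := DFunLike.congr_fun (hN r hr.1) (q r)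
    rw [slope_def_module, sub_self, inner_zero_left, sub_zero, e, inner_real_smul_left,
      J_inner, Complex.real_smul]
  have dB : HasDerivWithinAt (fun r => ⟪J d (p t), (G r - G t) (J d (q r))⟫)
      ⟪J d (p t), G' (J d (q t))⟫ s t := by
    rw [hasDerivWithinAt_iff_tendsto_slope]
    have h2 := hasDerivWithinAt_iff_tendsto_slope.1 hG
    have h3 := Filter.Tendsto.inner (𝕜 := ℂ) (tendsto_const_nhds (x := J d (p t)))
      (tendsto_op_apply h2 (((J d).continuous.tendsto _).comp cq'))
    refine h3.congr fun r => ?_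
    rw [slope_def_module, slope_def_module, sub_self, zero_apply,
      inner_zero_right, sub_zero, Function.comp_apply, smul_apply, inner_real_smul_right,
      Complex.real_smul]
  have dC : HasDerivWithinAt (fun r => ⟪J d (p t), G t (J d (q r))⟫) ⟪N' (p t), ζ⟫ s t := by
    refine (hq (N' (p t))).congr_of_mem (fun r _ => ?_) ht
    have e : star (G t) (J d (p t)) = J d (N' (p t)) := DFunLike.congr_fun hN' (p t)
    rw [← e, inner_adj]
  refine ((dA.add dB).add dC).congr_of_mem (fun r _ => ?_) ht
  simp only [Pi.add_apply, inner_sub_left, sub_apply, inner_sub_right]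
  ring

end

theorem HasDerivN.map {N N' : Op d → ℝ≥0∞} {C : ℝ≥0∞} (hC : C ≠ ⊤) {a : ℝ → Op d} {a' : Op d}
    {S : Set ℝ} {t : ℝ} (h : HasDerivN N a a' S t) (L : Op d → Op d)
    (l_sub : ∀ x y, L (x - y) = L x - L y) (l_smul : ∀ (r : ℝ) x, L ((r : ℂ) • x) = (r : ℂ) • L x)
    (hL : ∀ x, N' (L x) ≤ C * N x) : HasDerivN N' (fun s => L (a s)) (L a') S t := by
  refine ⟨fun s hs => (hL _).trans_lt (ENNReal.mul_lt_top hC.lt_top (h.mem s hs)),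
    (hL _).trans_lt (ENNReal.mul_lt_top hC.lt_top h.mem_deriv), ?_⟩
  have h1 := ENNReal.Tendsto.const_mul h.tendsto (Or.inr hC)
  rw [mul_zero] at h1
  refine tendsto_of_tendsto_of_tendsto_of_le_of_le tendsto_const_nhds h1 (fun _ => bot_le)
    fun s => ?_
  have e : (((s - t)⁻¹ : ℝ) : ℂ) • (L (a s) - L (a t)) - L a' =
      L ((((s - t)⁻¹ : ℝ) : ℂ) • (a s - a t) - a') := by
    rw [l_sub, l_smul, l_sub]
  simp only [e]
  exact hL _

theorem HasDerivN.hasDerivWithinAt {a : ℝ → Op d} {a' : Op d} {S : Set ℝ} {t : ℝ}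
    (h : HasDerivN (fun x => ‖x‖ₑ) a a' S t) : HasDerivWithinAt a a' S t := by
  rw [hasDerivWithinAt_iff_tendsto_slope, tendsto_iff_edist_tendsto_0]
  refine h.tendsto.congr fun s => ?_
  rw [edist_eq_enorm_sub, slope_def_module, Complex.coe_smul]
  rfl

/-! ### Block operators -/

theorem S_mul_S : S d * S d = 1 := by
  ext i j
  fin_cases i <;> fin_cases j <;> simp [S, Matrix.mul_apply]

theorem conjTranspose_S : (S d)ᴴ = S d := by
  ext i j
  fin_cases i <;> fin_cases j <;> simp [S, Matrix.conjTranspose_apply]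

/-- The diagonal entries of `𝒮`. -/
def sgn : Fin 2 → ℂ := ![1, -1]

theorem inner_sandwich (A B C : Matrix (Fin 2) (Fin 2) (Op d)) (i j : Fin 2) (f g : L2 d) :
    ⟪f, (Aᴴ * S d * B * S d * C) i j g⟫ =
      ∑ k, ∑ l, sgn k * sgn l * ⟪A k i f, B k l (C l j g)⟫ := by
  have h : (Aᴴ * S d * B * S d * C) i j =
      ∑ k, ∑ l, (sgn k * sgn l) • (star (A k i) * B k l * C l j) := by
    simp only [Matrix.mul_apply, Fin.sum_univ_two, S, Matrix.conjTranspose_apply, sgn,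
      Matrix.of_apply, Matrix.cons_val_zero, Matrix.cons_val_one, Matrix.cons_val', mul_one,
      mul_zero, add_zero, zero_add, zero_mul, mul_neg, neg_mul, neg_neg, one_smul,
      neg_smul, Matrix.cons_val_fin_one, add_mul]
    abel
  rw [h]
  simp only [Fin.sum_univ_two, add_apply, smul_apply, inner_add_right, inner_smul_right]
  have e : ∀ k l, ⟪f, (star (A k i) * B k l * C l j) g⟫ = ⟪A k i f, B k l (C l j g)⟫ :=
    fun k l => inner_adj' (A k i) f (B k l (C l j g))
  simp only [e]

theorem blockU_conjTranspose_mul_J {u w : Op d} (h : MemHinf2 (star u) (transp w)) (i j : Fin 2) :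
    (blockU u w)ᴴ i j * J d = J d * conjWeight (blockU u w) i j := by
  obtain ⟨⟨A, hA⟩, B, -, hB⟩ := h
  have h1 : ∃ C, (blockU u w)ᴴ i j * J d = J d * C := by
    have hA' : transp u * J d = J d * conj A := by
      have := congrArg conj hA
      rwa [conj_mul, conj_mul, conj_J] at this
    have hB' : star w * J d = J d * conj B := by
      have := congrArg conj hB
      rwa [conj_mul, conj_mul, conj_J, conj_transp] at this
    fin_cases i <;> fin_cases j
    · exact ⟨A, hA⟩
    · refine ⟨B, ?_⟩
      rw [← hB, transp_eq]
      rfl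
    · exact ⟨conj B, hB'⟩
    · refine ⟨conj A, ?_⟩
      rw [← hA', transp_eq]
      rfl
  obtain ⟨C, hC⟩ := h1
  rw [conjWeight, hC, weight_one_zero]

/-- `M Γ M⁻¹` for `γ = J a J`, `σ = J x`. -/
def gamWeight (a x : Op d) : Matrix (Fin 2) (Fin 2) (Op d) :=
  !![a * J d * J d, x * J d; conj x * J d, 1 + conj a * J d * J d]

/-- The time derivative of `Γ`. -/
def gamDeriv (a x : Op d) : Matrix (Fin 2) (Fin 2) (Op d) :=
  !![J d * a * J d, J d * x; conj (J d * x), conj (J d * a * J d)]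

theorem Gam_mul_J (a x : Op d) (i j : Fin 2) :
    Gam (J d * a * J d) (J d * x) i j * J d = J d * gamWeight a x i j := by
  fin_cases i <;> fin_cases j <;>
    simp [Gam, gamWeight, conj_mul, conj_J, mul_assoc, add_mul, mul_add]

theorem Gam_conjTranspose {γ σ : Op d} (hγ : star γ = γ) (hσ : transp σ = σ) :
    (Gam γ σ)ᴴ = Gam γ σ := by
  have h1 : star σ = conj σ := by conv_lhs => rw [← hσ, star_transp]
  have h2 : star (conj σ) = σ := by rw [star_conj, h1, conj_conj]
  ext i j : 1
  fin_cases i <;> fin_cases j <;> simp [Gam, Matrix.conjTranspose_apply, hγ, h1, h2, star_conj]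

section

variable {V v : E d → ℝ} {c : NNReal} {T : ℝ} {f f' : ℝ → L2 d} {a x a' x' : ℝ → Op d}

theorem lamOp_eq (f : L2 d) (a x : Op d) : lamOp V v (J d f, J d * a * J d, J d * x) =
    !![hLift V v f a, J d * kLift v f x * J d; J d * conj (kLift v f x) * J d,
      conj (hLift V v f a)] := rfl

theorem lamOp_conjTranspose {f : L2 d} {a x : Op d} (hH : star (hLift V v f a) = hLift V v f a)
    (hK : star (kLift v f x) = conj (kLift v f x)) :
    (lamOp V v (J d f, J d * a * J d, J d * x))ᴴ = lamOp V v (J d f, J d * a * J d, J d * x) := by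
  rw [lamOp_eq]
  have h2 : star (conj (kLift v f x)) = kLift v f x := by rw [star_conj, hK, conj_conj]
  ext i j : 1
  fin_cases i <;> fin_cases j <;>
    simp [Matrix.conjTranspose_apply, hH, hK, h2, star_conj, mul_assoc]

/-- The γ- and σ-equations and their complex conjugates are the four entries. The inhomogeneous term
k of the σ-equation comes from the summand 1 in the lower right corner of Γ. -/
theorem IsLift.gam_eqn (h : IsLift V v T f a x f' a' x') (hV : Measurable V)
    (hVb : InfFormBounded V) (hv : PotBound v c) {t : ℝ} (ht : t ∈ Set.Ico 0 T) :
    Complex.I • (Matrix.of fun i j => J d * gamDeriv (a' t) (x' t) i j * J d) =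
      S d * lamOp V v (J d (f t), J d * a t * J d, J d * x t) * gamWeight (a t) (x t)
      - (gamWeight (a t) (x t))ᴴ * lamOp V v (J d (f t), J d * a t * J d, J d * x t) * S d := by
  have e1 := h.eqn_γ hv ht
  have e2 := h.eqn_σ hV hVb hv ht
  have c1 := congrArg conj e1
  have c2 := congrArg conj e2
  rw [lamOp_eq]
  generalize hLift V v (f t) (a t) = H at *
  generalize kLift v (f t) (x t) = K at *
  simp only [conj_add, conj_sub, conj_mul, conj_smul, conj_J, conj_conj, Complex.star_def,
    Complex.conj_I, neg_smul, conj_transp] at c1 c2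
  rw [neg_eq_iff_eq_neg] at c1 c2
  have ha : star (conj (a t)) = conj (a t) := by rw [star_conj, h.star_a t ht]
  have hx : star (conj (x t)) = transp (x t) := star_conj _
  ext i j : 1
  fin_cases i <;> fin_cases j
  all_goals
    simp only [Matrix.smul_apply, Matrix.sub_apply, Matrix.mul_apply, Fin.sum_univ_two, S,
      Matrix.conjTranspose_apply, gamDeriv, gamWeight, Fin.zero_eta, Fin.mk_one, Fin.isValue,
      Matrix.of_apply, Matrix.cons_val_zero, Matrix.cons_val_one, Matrix.cons_val', mul_one,
      mul_zero, add_zero, zero_add, mul_neg, neg_mul, one_mul, zero_mul,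
      Matrix.cons_val_fin_one, star_add, star_mul, star_one, star_J, h.star_a t ht, ha, hx,
      conj_mul, conj_J]
  · rw [e1]
    simp only [mul_assoc]
    abel
  · rw [e2]
    simp only [mul_assoc, mul_add, mul_one]
    abel
  · rw [c2]
    simp only [mul_assoc, add_mul, one_mul]
    abel
  · rw [c1]
    simp only [mul_assoc, mul_add, add_mul, mul_one, one_mul]
    abel

/-- The algebraic content of ∂ₜ(𝒰𝒮Γ𝒮𝒰*) = 0: with 𝒮² = 1 and Λ* = Λ, the terms from 𝒰 and from 𝒰*
are ±i times the two halves of the commutator-like derivative of Γ. -/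
theorem sandwich_deriv_eq_zero {P L N G : Matrix (Fin 2) (Fin 2) (Op d)} (hL : Lᴴ = L)
    (hG : Complex.I • G = S d * L * N - Nᴴ * L * S d) :
    ((-Complex.I) • (S d * L * P))ᴴ * S d * N * S d * P + Pᴴ * S d * G * S d * P
      + Pᴴ * S d * Nᴴ * S d * ((-Complex.I) • (S d * L * P)) = 0 := by
  have hSS : ∀ X : Matrix (Fin 2) (Fin 2) (Op d), S d * (S d * X) = X := fun X => by
    rw [← mul_assoc, S_mul_S, one_mul]
  have h1 : ((-Complex.I) • (S d * L * P))ᴴ * S d * N * S d * P =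
      Complex.I • (Pᴴ * L * N * S d * P) := by
    rw [Matrix.conjTranspose_smul, Matrix.conjTranspose_mul, Matrix.conjTranspose_mul, hL,
      conjTranspose_S]
    simp only [smul_mul_assoc, mul_assoc, hSS, star_neg, Complex.star_def, Complex.conj_I, neg_neg]
  have h2 : Pᴴ * S d * Nᴴ * S d * ((-Complex.I) • (S d * L * P)) =
      (-Complex.I) • (Pᴴ * S d * Nᴴ * L * P) := by
    simp only [mul_smul_comm, mul_assoc, hSS]
  have h3 : G = (-Complex.I) • (S d * L * N - Nᴴ * L * S d) := by
    rw [← hG, smul_smul]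
    simp
  have h4 : Pᴴ * S d * G * S d * P =
      (-Complex.I) • (Pᴴ * L * N * S d * P - Pᴴ * S d * Nᴴ * L * P) := by
    rw [h3]
    simp only [mul_smul_comm, smul_mul_assoc, mul_sub, sub_mul, mul_assoc, hSS]
  rw [h1, h2, h4, neg_smul, neg_smul, smul_sub]
  abel

end

/-! ### Propagation of the diagonalization in time -/

section

variable {V v : E d → ℝ} {c : NNReal} {T : ℝ} {f f' : ℝ → L2 d} {a x a' x' : ℝ → Op d}

theorem IsLift.hasDeriv_map_a (h : IsLift V v T f a x f' a' x') {t : ℝ} (ht : t ∈ Set.Ico 0 T)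
    (L : Op d → Op d) (l_sub : ∀ x y, L (x - y) = L x - L y)
    (l_smul : ∀ (r : ℝ) x, L ((r : ℂ) • x) = (r : ℂ) • L x) (hL : ∀ x, ‖L x‖ₑ ≤ ‖x‖ₑ) :
    HasDerivWithinAt (fun s => L (a s)) (L (a' t)) (Set.Ico 0 T) t :=
  HasDerivN.hasDerivWithinAt <| (h.deriv_a t ht).map ENNReal.one_ne_top L l_sub l_smul fun x => by
    rw [one_mul]
    exact (hL x).trans (opNorm_le_traceNorm x)

theorem IsLift.hasDeriv_map_x (h : IsLift V v T f a x f' a' x') {t : ℝ} (ht : t ∈ Set.Ico 0 T)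
    (L : Op d → Op d) (l_sub : ∀ x y, L (x - y) = L x - L y)
    (l_smul : ∀ (r : ℝ) x, L ((r : ℂ) • x) = (r : ℂ) • L x) (hL : ∀ x, ‖L x‖ₑ ≤ ‖x‖ₑ) :
    HasDerivWithinAt (fun s => L (x s)) (L (x' t)) (Set.Ico 0 T) t :=
  HasDerivN.hasDerivWithinAt <| (h.deriv_x t ht).map ENNReal.one_ne_top L l_sub l_smul fun x => by
    rw [one_mul]
    exact (hL x).trans (opNorm_le_hsNorm x)

theorem enorm_op_mul_le (A B : Op d) : ‖A * B‖ₑ ≤ ‖A‖ₑ * ‖B‖ₑ := by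
  rw [← ofReal_norm, ← ofReal_norm, ← ofReal_norm, ← ENNReal.ofReal_mul (norm_nonneg _)]
  exact ENNReal.ofReal_le_ofReal (norm_mul_le A B)

theorem enorm_J_mul_le (A : Op d) : ‖J d * A‖ₑ ≤ ‖A‖ₑ :=
  (enorm_op_mul_le _ _).trans ((mul_le_mul' enorm_J_le le_rfl).trans_eq (one_mul _))

theorem enorm_mul_J_le (A : Op d) : ‖A * J d‖ₑ ≤ ‖A‖ₑ :=
  (enorm_op_mul_le _ _).trans ((mul_le_mul' le_rfl enorm_J_le).trans_eq (mul_one _))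

theorem IsLift.hasDeriv_Gam (h : IsLift V v T f a x f' a' x') {t : ℝ} (ht : t ∈ Set.Ico 0 T)
    (i j : Fin 2) :
    HasDerivWithinAt (fun s => Gam (J d * a s * J d) (J d * x s) i j) (gamDeriv (a' t) (x' t) i j)
      (Set.Ico 0 T) t := by
  fin_cases i <;> fin_cases j
  · exact h.hasDeriv_map_a ht (fun y => J d * y * J d) (fun x y => by rw [mul_sub, sub_mul])
      (fun r x => weight_smul _ _) fun x => (enorm_mul_J_le _).trans (enorm_J_mul_le _)
  · exact h.hasDeriv_map_x ht (fun y => J d * y) (fun x y => by rw [mul_sub])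
      (fun r x => mul_smul_comm _ _ _) fun x => enorm_J_mul_le _
  · refine h.hasDeriv_map_x ht (fun y => conj (J d * y)) (fun x y => by rw [mul_sub, conj_sub])
      (fun r x => by rw [mul_smul_comm, conj_smul]; simp) fun x => ?_
    rw [enorm_conj]
    exact enorm_J_mul_le _
  · refine (h.hasDeriv_map_a ht (fun y => conj (J d * y * J d))
      (fun x y => by rw [mul_sub, sub_mul, conj_sub])
      (fun r x => by rw [weight_smul, conj_smul]; simp) fun x => ?_).const_add 1
    rw [enorm_conj]
    exact (enorm_mul_J_le _).trans (enorm_J_mul_le _)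

theorem IsLift.continuousWithinAt_gamWeight (h : IsLift V v T f a x f' a' x') {t : ℝ}
    (ht : t ∈ Set.Ico 0 T) (i j : Fin 2) :
    ContinuousWithinAt (fun s => gamWeight (a s) (x s) i j) (Set.Ico 0 T) t := by
  fin_cases i <;> fin_cases j
  · exact (h.hasDeriv_map_a ht (fun y => y * J d * J d) (fun x y => by rw [sub_mul, sub_mul])
      (fun r x => by rw [smul_mul_assoc, smul_mul_assoc])
      fun x => (enorm_mul_J_le _).trans (enorm_mul_J_le _)).continuousWithinAt
  · exact (h.hasDeriv_map_x ht (fun y => y * J d) (fun x y => by rw [sub_mul])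
      (fun r x => by rw [smul_mul_assoc]) fun x => enorm_mul_J_le _).continuousWithinAt
  · refine (h.hasDeriv_map_x ht (fun y => conj y * J d) (fun x y => by rw [conj_sub, sub_mul])
      (fun r x => by rw [conj_smul, smul_mul_assoc]; simp) fun x => ?_).continuousWithinAt
    rw [← enorm_conj x]
    exact enorm_mul_J_le _
  · refine ((h.hasDeriv_map_a ht (fun y => conj y * J d * J d)
      (fun x y => by rw [conj_sub, sub_mul, sub_mul])
      (fun r x => by rw [conj_smul, smul_mul_assoc, smul_mul_assoc]; simp)
      fun x => ?_).const_add 1).continuousWithinAt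
    rw [← enorm_conj x]
    exact (enorm_mul_J_le _).trans (enorm_mul_J_le _)

variable {ρ : ℝ → State d} {γ₀ : Op d} {u w : ℝ → Op d}

theorem op_eq_of_inner_J {A B : Op d} (h : ∀ f g, ⟪J d f, A (J d g)⟫ = ⟪J d f, B (J d g)⟫) :
    A = B := by
  refine mul_J_cancel (J_mul_cancel (A := A * J d) (B := B * J d) ?_)
  ext1 g
  refine ext_inner_left ℂ fun f => ?_
  change ⟪f, J d (A (J d g))⟫ = ⟪f, J d (B (J d g))⟫
  rw [← J_inner, ← J_inner, h]

theorem blockU_conjTranspose_apply_J {u w : Op d} (h : MemHinf2 (star u) (transp w)) (i j : Fin 2)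
    (g : L2 d) : (blockU u w)ᴴ i j (J d g) = J d (conjWeight (blockU u w) i j g) :=
  DFunLike.congr_fun (blockU_conjTranspose_mul_J h i j) g

/-- Each matrix element is a signed sum of pairings covered by `hasDerivWithinAt_sandwich`, and the
sum of their derivatives is a matrix element of the expression in `sandwich_deriv_eq_zero`. -/
theorem IsLift.hasDeriv_sandwich (h : IsLift V v T f a x f' a' x') (hV : Measurable V)
    (hVb : InfFormBounded V) (hv : PotBound v c)
    (hρ : ∀ t ∈ Set.Ico 0 T, ρ t = (J d (f t), J d * a t * J d, J d * x t))
    (hU : IsDiagonalizingFamily V v T ρ γ₀ u w) {t : ℝ} (ht : t ∈ Set.Ico 0 T) (i j : Fin 2)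
    (g g' : L2 d) :
    HasDerivWithinAt (fun s => ⟪J d g, (blockU (u s) (w s) * S d *
      Gam (J d * a s * J d) (J d * x s) * S d * (blockU (u s) (w s))ᴴ) i j (J d g')⟫) 0
      (Set.Ico 0 T) t := by
  set P := fun s => conjWeight (blockU (u s) (w s)) with hP
  have hL := lamOp_conjTranspose (V := V) (v := v) (f := f t)
    (star_hLift hV hVb hv _ (h.nuc t ht) (h.star_a t ht))
    (hv.star_kLift (f t) (h.hs t ht) (h.transp_x t ht))
  set D : Matrix (Fin 2) (Fin 2) (Op d) :=
    (-Complex.I) • (S d * lamOp V v (J d (f t), J d * a t * J d, J d * x t) * P t) with hD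
  have weak : ∀ (k i : Fin 2) (g h : L2 d),
      HasDerivWithinAt (fun r => ⟪J d h, J d (P r k i g)⟫) ⟪h, D k i g⟫ (Set.Ico 0 T) t := by
    intro k i g h
    have := hU.evol t ht k i g h
    rw [hρ t ht] at this
    refine this.congr_of_mem (fun s hs => ?_) ht
    rw [← blockU_conjTranspose_apply_J (hU.mem_adjoint s hs)]
  have hGs := Gam_conjTranspose (γ := J d * a t * J d) (σ := J d * x t)
    (by rw [star_weight, h.star_a t ht]) (h.transp_x t ht)
  have hd : ∀ k l : Fin 2, HasDerivWithinAt (fun s => sgn k * sgn l *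
      ⟪J d (P s k i g), Gam (J d * a s * J d) (J d * x s) k l (J d (P s l j g'))⟫)
      (sgn k * sgn l * (⟪D k i g, gamWeight (a t) (x t) k l (P t l j g')⟫ +
        ⟪J d (P t k i g), gamDeriv (a' t) (x' t) k l (J d (P t l j g'))⟫ +
        ⟪gamWeight (a t) (x t) l k (P t k i g), D l j g'⟫)) (Set.Ico 0 T) t := by
    intro k l
    have e : star (Gam (J d * a t * J d) (J d * x t) k l) * J d =
        J d * gamWeight (a t) (x t) l k := by
      rw [← Matrix.conjTranspose_apply, hGs, Gam_mul_J]
    exact (hasDerivWithinAt_sandwich (p := fun s => P s k i g) (q := fun s => P s l j g')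
      (G := fun s => Gam (J d * a s * J d) (J d * x s) k l)
      (N := fun s => gamWeight (a s) (x s) k l) ht (weak k i g) (weak l j g')
      (hU.cont l j g' t ht) (h.continuousWithinAt_gamWeight ht k l) (h.hasDeriv_Gam ht k l)
      (fun r _ => Gam_mul_J _ _ k l) e).const_mul _
  have hd' := HasDerivWithinAt.fun_sum (u := Finset.univ) fun k _ =>
    HasDerivWithinAt.fun_sum (u := Finset.univ) fun l _ => hd k l
  have z : ∑ k, ∑ l, sgn k * sgn l * (⟪D k i g, gamWeight (a t) (x t) k l (P t l j g')⟫ +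
        ⟪J d (P t k i g), gamDeriv (a' t) (x' t) k l (J d (P t l j g'))⟫ +
        ⟪gamWeight (a t) (x t) l k (P t k i g), D l j g'⟫) = 0 := by
    have e1 := inner_sandwich D (gamWeight (a t) (x t)) (P t) i j g g'
    have e2 := inner_sandwich (P t)
      (Matrix.of fun i j => J d * gamDeriv (a' t) (x' t) i j * J d) (P t) i j g g'
    have e3 := inner_sandwich (P t) (gamWeight (a t) (x t))ᴴ D i j g g'
    have e4 := congrArg (fun M : Matrix (Fin 2) (Fin 2) (Op d) => ⟪g, M i j g'⟫)
      (sandwich_deriv_eq_zero (P := P t) hL (h.gam_eqn hV hVb hv ht))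
    simp only [Matrix.add_apply, add_apply, inner_add_right] at e4
    rw [← hD, e1, e2, e3] at e4
    simp only [mul_add, Finset.sum_add_distrib]
    simp only [Matrix.zero_apply, zero_apply, inner_zero_right, Matrix.conjTranspose_apply,
      inner_adj', Matrix.of_apply] at e4
    rw [← e4]
    congr 2
    refine Finset.sum_congr rfl fun k _ => Finset.sum_congr rfl fun l _ => ?_
    rw [J_inner]
    rfl
  rw [z] at hd'
  refine hd'.congr_of_mem (fun s hs => ?_) ht
  have e := inner_sandwich (blockU (u s) (w s))ᴴ (Gam (J d * a s * J d) (J d * x s))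
    (blockU (u s) (w s))ᴴ i j (J d g) (J d g')
  rw [Matrix.conjTranspose_conjTranspose] at e
  rw [e]
  simp only [blockU_conjTranspose_apply_J (hU.mem_adjoint s hs), hP]

theorem eq_of_hasDerivWithinAt_zero {F : ℝ → ℂ}
    (h : ∀ t ∈ Set.Ico 0 T, HasDerivWithinAt F 0 (Set.Ico 0 T) t) {t : ℝ}
    (ht : t ∈ Set.Ico 0 T) : F t = F 0 := by
  have h0 : (0 : ℝ) ∈ Set.Ico 0 T := ⟨le_rfl, ht.1.trans_lt ht.2⟩
  have := (convex_Ico (𝕜 := ℝ) 0 T).norm_image_sub_le_of_norm_hasDerivWithin_le (f := F) (C := 0)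
    h (fun x _ => by simp) h0 ht
  rw [zero_mul] at this
  exact sub_eq_zero.1 (norm_le_zero_iff.1 this)

/-- `Γ_t = 𝒰_t* diag(γ₀, 1 + γ̄₀) 𝒰_t`. -/
theorem IsLift.gam_eq (h : IsLift V v T f a x f' a' x') (hV : Measurable V)
    (hVb : InfFormBounded V) (hv : PotBound v c)
    (hρ : ∀ t ∈ Set.Ico 0 T, ρ t = (J d (f t), J d * a t * J d, J d * x t))
    (hU : IsDiagonalizingFamily V v T ρ γ₀ u w) {t : ℝ} (ht : t ∈ Set.Ico 0 T) :
    Gam (J d * a t * J d) (J d * x t) =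
      (blockU (u t) (w t))ᴴ * Gam γ₀ 0 * blockU (u t) (w t) := by
  have h0 : (0 : ℝ) ∈ Set.Ico 0 T := ⟨le_rfl, ht.1.trans_lt ht.2⟩
  have hc : blockU (u t) (w t) * S d * Gam (J d * a t * J d) (J d * x t) * S d *
      (blockU (u t) (w t))ᴴ = blockU (u 0) (w 0) * S d * Gam (J d * a 0 * J d) (J d * x 0) * S d *
      (blockU (u 0) (w 0))ᴴ := by
    ext i j : 1
    refine op_eq_of_inner_J fun g g' => ?_
    exact eq_of_hasDerivWithinAt_zero
      (fun s hs => h.hasDeriv_sandwich hV hVb hv hρ hU hs i j g g') ht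
  have hi := hU.initial
  rw [hρ 0 h0] at hi
  simp only at hi
  obtain ⟨p0, q0⟩ := hU.symplecto 0 h0
  obtain ⟨pt, qt⟩ := hU.symplecto t ht
  generalize Gam (J d * a t * J d) (J d * x t) = G at *
  generalize Gam γ₀ 0 = G₀ at *
  generalize blockU (u t) (w t) = U at *
  rw [hi] at hc
  generalize blockU (u 0) (w 0) = U₀ at *
  have hSS : ∀ X : Matrix (Fin 2) (Fin 2) (Op d), S d * (S d * X) = X := fun X => by
    rw [← mul_assoc, S_mul_S, one_mul]
  -- At time 0 the initial condition and 𝒰₀𝒮𝒰₀* = 𝒮 evaluate the conserved quantity. The other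
  -- relation 𝒰*𝒮𝒰 = 𝒮 then inverts the sandwich at time t.
  have e1 : U * S d * G * S d * Uᴴ = S d * G₀ * S d := by
    rw [hc]
    calc _ = (U₀ * S d * U₀ᴴ) * G₀ * (U₀ * S d * U₀ᴴ) := by simp only [mul_assoc]
      _ = _ := by rw [q0]
  have e2 : Uᴴ * S d * (U * S d * G * S d * Uᴴ) * S d * U = G := by
    calc _ = (Uᴴ * S d * U) * S d * G * S d * (Uᴴ * S d * U) := by simp only [mul_assoc]
      _ = G := by rw [pt, S_mul_S, one_mul, mul_assoc, S_mul_S, mul_one]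
  rw [← e2, e1]
  simp only [mul_assoc, hSS]

theorem IsLift.gamOf_sigOf (h : IsLift V v T f a x f' a' x') (hV : Measurable V)
    (hVb : InfFormBounded V) (hv : PotBound v c)
    (hρ : ∀ t ∈ Set.Ico 0 T, ρ t = (J d (f t), J d * a t * J d, J d * x t))
    (hU : IsDiagonalizingFamily V v T ρ γ₀ u w) {t : ℝ} (ht : t ∈ Set.Ico 0 T) :
    gamOf γ₀ (u t) (w t) = J d * a t * J d ∧ sigOf γ₀ (u t) (w t) = J d * x t := by
  have e := h.gam_eq hV hVb hv hρ hU ht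
  have e1 := congrFun (congrFun e 0) 0
  have e2 := congrFun (congrFun e 0) 1
  simp only [Matrix.mul_apply, Fin.sum_univ_two, Matrix.conjTranspose_apply, Gam, blockU,
    Matrix.of_apply, Matrix.cons_val_zero, Matrix.cons_val_one, Matrix.cons_val',
    Matrix.cons_val_fin_one, mul_zero, add_zero, zero_add, conj_zero, ← transp_eq] at e1 e2
  exact ⟨e1.symm, e2.symm⟩

end

/-! ### Admissibility of the diagonalizing family -/

theorem re_inner_conj_nonneg {γ : Op d} (h : γ.IsPositive) (f : L2 d) :
    0 ≤ (⟪f, conj γ f⟫).re := by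
  have h1 : ⟪f, conj γ f⟫ = ⟪γ (star f), star f⟫ := by
    have := inner_star_star (star f) (γ (star f))
    rwa [star_star] at this
  rw [h1]
  exact h.re_inner_nonneg_left _

/-- In ⟨f, γ_{u,w} f⟩ the contributions of γ₀' and of its conjugate are nonnegative; the summand 1
in 1 + γ̄₀' leaves ‖w̄f‖². -/
theorem normSq_conj_le {γ₀ u w a : Op d} (h : γ₀.IsPositive)
    (hg : gamOf γ₀ u w = J d * a * J d) (f : L2 d) :
    ‖conj w f‖ ^ 2 ≤ (⟪J d f, a (J d f)⟫).re := by
  have h1 : ⟪J d f, a (J d f)⟫ = ⟪u f, γ₀ (u f)⟫ +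
      (⟪conj w f, conj w f⟫ + ⟪conj w f, conj γ₀ (conj w f)⟫) := by
    have e : ⟪f, gamOf γ₀ u w f⟫ = ⟪J d f, a (J d f)⟫ := by
      rw [hg, J_inner]
      rfl
    rw [← e, gamOf, add_apply, inner_add_right, transp_eq]
    have e1 : ⟪f, (star u * γ₀ * u) f⟫ = ⟪u f, γ₀ (u f)⟫ := inner_adj' u f _
    have e2 : ⟪f, (star (conj w) * (1 + conj γ₀) * conj w) f⟫ =
        ⟪conj w f, (1 + conj γ₀) (conj w f)⟫ := inner_adj' (conj w) f _
    rw [e1, e2, add_apply, inner_add_right]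
    rfl
  rw [h1, Complex.add_re, Complex.add_re, inner_self_eq_norm_sq_to_K]
  have h2 : 0 ≤ (⟪u f, γ₀ (u f)⟫).re := h.re_inner_nonneg_right _
  have h3 := re_inner_conj_nonneg h (conj w f)
  have h4 : (((‖conj w f‖ : ℂ)) ^ 2).re = ‖conj w f‖ ^ 2 := by norm_cast
  have h5 : ((RCLike.ofReal ‖conj w f‖ : ℂ) ^ 2).re = ‖conj w f‖ ^ 2 := h4
  rw [h5]
  linarith

theorem hs_of_normSq_le {B a : Op d} (ha : Nuc a) (h : ∀ f, ‖B f‖ ^ 2 ≤ (⟪f, a f⟫).re) : HS B := by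
  rw [HS, hsNorm_lt_top_iff]
  have h1 : ∑' i, ‖⟪onb d i, a (onb d i)⟫‖ₑ < ⊤ := by
    have := ha.summable.norm.tsum_ofReal_lt_top
    simpa only [ofReal_norm] using this
  refine lt_of_le_of_lt (ENNReal.tsum_le_tsum fun i => ?_) h1
  rw [← ofReal_norm, ← ofReal_norm, ← ENNReal.ofReal_pow (norm_nonneg _)]
  exact ENNReal.ofReal_le_ofReal ((h _).trans ((le_abs_self _).trans (Complex.abs_re_le_norm _)))

/-- The inequality ‖w̄f‖² ≤ ⟨Jf, aJf⟩ lets w̄ factor as BJ. By density it becomes ‖Bf‖² ≤ ⟨f, af⟩,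
and B is Hilbert-Schmidt because a is trace class. -/
theorem exists_hs_mul_J {γ₀ u w a : Op d} (h : γ₀.IsPositive) (ha : Nuc a)
    (hg : gamOf γ₀ u w = J d * a * J d) : ∃ B, HS B ∧ w = B * J d := by
  have h1 := normSq_conj_le h hg
  obtain ⟨B, hB⟩ : ∃ B, conj w = B * J d := by
    refine exists_eq_mul_J (C := Real.sqrt ‖a‖) fun f => ?_
    refine abs_le_of_sq_le_sq' ?_ (by positivity) |>.2
    rw [mul_pow, Real.sq_sqrt (norm_nonneg _)]
    refine (h1 f).trans ((Complex.re_le_norm _).trans ((norm_inner_le_norm _ _).trans ?_))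
    calc _ ≤ ‖J d f‖ * (‖a‖ * ‖J d f‖) := by gcongr; exact a.le_opNorm _
      _ = _ := by ring
  refine ⟨conj B, HS.conj (hs_of_normSq_le ha fun f => ?_), ?_⟩
  · refine J_denseRange.induction_on f ?_ fun g => ?_
    · refine isClosed_le (by fun_prop) (Complex.continuous_re.comp ?_)
      exact continuous_id.inner (𝕜 := ℂ) a.continuous
    · have := h1 g
      rwa [hB] at this
  · have := congrArg conj hB
    rwa [conj_conj, conj_mul, conj_J] at this

/-- The symplectic relations wuᵀ = uwᵀ and uᵀū = 1 + w*w give w = u wᵀ ū − w w* w. In both terms the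
weight of w = BJ has moved to the left of a transpose or adjoint, and u and w preserve H¹, so Mw is
Hilbert-Schmidt as well as wM. -/
theorem exists_hs_J_mul {u w B : Op d} (hU : IsSymplecto (blockU u w)) (h : MemHinf2 u w)
    (hB : HS B) (hw : w = B * J d) : ∃ Y, HS Y ∧ w = J d * Y := by
  obtain ⟨⟨A, hA⟩, Q, hQ, hwQ⟩ := h
  have e1 := congrFun (congrFun hU.1 0) 0
  have e2 := congrFun (congrFun hU.2 0) 1
  simp only [Matrix.mul_apply, Fin.sum_univ_two, Matrix.conjTranspose_apply, S, blockU,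
    Matrix.of_apply, Matrix.cons_val_zero, Matrix.cons_val_one, Matrix.cons_val',
    Matrix.cons_val_fin_one, mul_zero, add_zero, zero_add, mul_one, mul_neg, neg_mul,
    ← transp_eq] at e1 e2
  have e3 := congrArg conj e1
  simp only [conj_add, conj_neg, conj_mul, conj_one, conj_conj, conj_transp] at e3
  have e4 : conj (star u) = transp u := rfl
  have e5 : w * (1 + star w * w) = u * transp w * conj u := by
    rw [sub_eq_zero.1 ((sub_eq_add_neg _ _).trans e2), ← e3, e4]
    noncomm_ring
  refine ⟨A * transp B * conj u - Q * star B * w,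
    ((hB.transp.mul_left A).mul_right _).sub ((HS.mul_right hQ _).mul_right _), ?_⟩
  have tw : transp w = J d * transp B := by rw [hw, transp_mul, transp_J]
  have sw : star w = J d * star B := by rw [hw, star_mul, star_J]
  rw [mul_sub]
  simp only [← mul_assoc]
  rw [← hA, ← hwQ, mul_assoc u, ← tw, mul_assoc w, ← sw, ← e5]
  noncomm_ring

/-! ### The resolvent -/

theorem tendsto_op_seq_apply {W : ℕ → Op d} {L : Op d} {C : ℝ} (hW : ∀ n, ‖W n‖ ≤ C)
    (hl : ∀ f, Tendsto (fun n => W n f) atTop (𝓝 (L f))) {g : ℕ → L2 d} {g₀ : L2 d}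
    (hg : Tendsto g atTop (𝓝 g₀)) : Tendsto (fun n => W n (g n)) atTop (𝓝 (L g₀)) := by
  have h1 : Tendsto (fun n => W n (g n - g₀)) atTop (𝓝 0) := by
    have h2 : Tendsto (fun n => C * ‖g n - g₀‖) atTop (𝓝 0) := by
      have := (hg.sub_const g₀).norm.const_mul C
      simpa using this
    exact squeeze_zero_norm (fun n => (W n).le_of_opNorm_le (hW n) _) h2
  have h3 := h1.add (hl g₀)
  rw [zero_add] at h3
  exact h3.congr fun n => by rw [map_sub, sub_add_cancel]

theorem tendsto_op_of_dense {W : ℕ → Op d} {L : Op d} {C : ℝ} (hW : ∀ n, ‖W n‖ ≤ C)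
    {D : Op d} (hD : DenseRange D)
    (hl : ∀ f, Tendsto (fun n => W n (D f)) atTop (𝓝 (L (D f)))) (f : L2 d) :
    Tendsto (fun n => W n f) atTop (𝓝 (L f)) := by
  have hC : 0 ≤ C := (norm_nonneg _).trans (hW 0)
  rw [Metric.tendsto_atTop]
  intro ε hε
  have hK : 0 < 2 * (C + ‖L‖ + 1) := by positivity
  obtain ⟨g, hg⟩ := hD.exists_dist_lt f (div_pos hε hK)
  obtain ⟨N, hN⟩ := Metric.tendsto_atTop.1 (hl g) (ε / 2) (half_pos hε)
  refine ⟨N, fun n hn => ?_⟩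
  have h1 := hN n hn
  rw [dist_eq_norm] at hg h1 ⊢
  rw [lt_div_iff₀ hK] at hg
  have e : W n f - L f = W n (f - D g) - L (f - D g) + (W n (D g) - L (D g)) := by
    simp only [map_sub]
    abel
  rw [e]
  have h2 := norm_add_le (W n (f - D g) - L (f - D g)) (W n (D g) - L (D g))
  have h3 := norm_sub_le (W n (f - D g)) (L (f - D g))
  have h4 := (W n).le_of_opNorm_le (hW n) (f - D g)
  have h5 := L.le_opNorm (f - D g)
  nlinarith [norm_nonneg (f - D g)]

section

variable {H : Op d} {c : ℝ}

/-- `H + c J²`, the operator `M⁻¹ (h + c) M⁻¹`. -/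
def shiftOp (H : Op d) (c : ℝ) : Op d := H + (c : ℂ) • J d ^ 2

theorem star_shiftOp (hs : star H = H) : star (shiftOp H c) = shiftOp H c := by
  rw [shiftOp, star_add, hs, star_smul, star_pow, star_J]
  simp

theorem inner_J_sq (g : L2 d) : ⟪g, (J d ^ 2) g⟫ = (‖J d g‖ ^ 2 : ℝ) := by
  have : ⟪g, (J d ^ 2) g⟫ = ⟪J d g, J d g⟫ := by rw [J_inner, pow_two]; rfl
  rw [this, inner_self_eq_norm_sq_to_K]
  norm_cast

/-- `R n = ((n + 1) J² + H + c J²)⁻¹`. -/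
structure IsResolvent (H : Op d) (c : ℝ) (R : ℕ → Op d) : Prop where
  star_eq : ∀ n, star (R n) = R n
  mul_right : ∀ n, ((n + 1 : ℕ) : ℂ) • (J d ^ 2 * R n) = 1 - shiftOp H c * R n
  mul_left : ∀ n, ((n + 1 : ℕ) : ℂ) • (R n * J d ^ 2) = 1 - R n * shiftOp H c
  norm_le : ∀ n, ‖R n‖ ≤ 2
  norm_le' : ∀ n, ‖((n + 1 : ℕ) : ℂ) • (J d * R n * J d)‖ ≤ 1

/-- Coercivity of (n+1)J² + H + cJ² makes it invertible. -/
theorem exists_isResolvent (hs : star H = H)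
    (hc : ∀ g, (1 / 2) * ‖g‖ ^ 2 ≤ (⟪g, H g⟫).re + c * ‖J d g‖ ^ 2) :
    ∃ R, IsResolvent H c R := by
  let A : ℕ → Op d := fun n => ((n + 1 : ℕ) : ℂ) • J d ^ 2 + shiftOp H c
  have hA : ∀ n g, ((n + 1 : ℕ) : ℝ) * ‖J d g‖ ^ 2 + (1 / 2) * ‖g‖ ^ 2 ≤ (⟪g, A n g⟫).re := by
    intro n g
    have e : ⟪g, A n g⟫ = ((n + 1 : ℕ) : ℂ) * ⟪g, (J d ^ 2) g⟫ + (⟪g, H g⟫ + c * ⟪g, (J d ^ 2) g⟫) := by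
      simp only [A, shiftOp, add_apply, smul_apply, inner_add_right, inner_smul_right]
    rw [e, inner_J_sq]
    have e2 : (((n + 1 : ℕ) : ℂ) * ((‖J d g‖ ^ 2 : ℝ) : ℂ) +
        (⟪g, H g⟫ + (c : ℂ) * ((‖J d g‖ ^ 2 : ℝ) : ℂ))).re =
        ((n + 1 : ℕ) : ℝ) * ‖J d g‖ ^ 2 + ((⟪g, H g⟫).re + c * ‖J d g‖ ^ 2) := by
      rw [Complex.add_re, Complex.add_re, Complex.re_ofReal_mul, Complex.ofReal_re,
        show ((n + 1 : ℕ) : ℂ) = (((n + 1 : ℕ) : ℝ) : ℂ) by simp, Complex.re_ofReal_mul, Complex.ofReal_re]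
    rw [e2]
    linarith [hc g]
  have hu : ∀ n, IsUnit (A n) := by
    intro n
    refine ContinuousLinearMap.isUnit_of_forall_le_norm_inner_map (A n) (c := 1 / 2)
      (by norm_num) fun g => ?_
    have h1 := hA n g
    have h2 : (⟪g, A n g⟫).re ≤ ‖⟪A n g, g⟫‖ := by
      rw [norm_inner_symm]
      exact Complex.re_le_norm _
    have h3 : 0 ≤ ((n + 1 : ℕ) : ℝ) * ‖J d g‖ ^ 2 := by positivity
    have h4 : ((1 / 2 : NNReal) : ℝ) = 1 / 2 := by simp
    rw [h4]
    linarith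
  choose U hU using hu
  have hl : ∀ n, ((U n)⁻¹ : (Op d)ˣ).val * A n = 1 := fun n => by rw [← hU, Units.inv_mul]
  have hr : ∀ n, A n * ((U n)⁻¹ : (Op d)ˣ).val = 1 := fun n => by rw [← hU, Units.mul_inv]
  have hsA : ∀ n, star (A n) = A n := fun n => by
    simp only [A]
    rw [star_add, star_shiftOp hs, star_smul, star_pow, star_J]
    simp
  -- Coercivity evaluated at the resolvent vector. Keeping ½‖·‖² bounds R by 2; keeping (n+1)‖J·‖²,
  -- with Jg in place of g, bounds (n+1)JRJ by 1.
  have key : ∀ n (g : L2 d), ((n + 1 : ℕ) : ℝ) * ‖J d (((U n)⁻¹ : (Op d)ˣ).val g)‖ ^ 2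
      + (1 / 2) * ‖((U n)⁻¹ : (Op d)ˣ).val g‖ ^ 2 ≤ (⟪((U n)⁻¹ : (Op d)ˣ).val g, g⟫).re := by
    intro n g
    have := hA n (((U n)⁻¹ : (Op d)ˣ).val g)
    rwa [show A n (((U n)⁻¹ : (Op d)ˣ).val g) = g from DFunLike.congr_fun (hr n) g] at this
  refine ⟨fun n => ((U n)⁻¹ : (Op d)ˣ).val, fun n => ?_, fun n => ?_, fun n => ?_, fun n => ?_,
    fun n => ?_⟩
  · have h1 := congrArg star (hr n)
    rw [star_mul, hsA, star_one] at h1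
    calc _ = star ((U n)⁻¹ : (Op d)ˣ).val * (A n * ((U n)⁻¹ : (Op d)ˣ).val) := by
            rw [hr, mul_one]
      _ = _ := by rw [← mul_assoc, h1, one_mul]
  · have h1 := hr n
    simp only [A, add_mul, smul_mul_assoc] at h1
    rw [← h1, add_sub_cancel_right]
  · have h1 := hl n
    simp only [A, mul_add, mul_smul_comm] at h1
    rw [← h1, add_sub_cancel_right]
  · refine ContinuousLinearMap.opNorm_le_bound _ zero_le_two fun g => ?_
    have h1 := key n g
    set y := ((U n)⁻¹ : (Op d)ˣ).val g
    have h2 : (⟪y, g⟫).re ≤ ‖y‖ * ‖g‖ := (Complex.re_le_norm _).trans (norm_inner_le_norm _ _)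
    have h3 : 0 ≤ ((n + 1 : ℕ) : ℝ) * ‖J d y‖ ^ 2 := by positivity
    by_contra! h4
    nlinarith [norm_nonneg y, norm_nonneg g]
  · refine ContinuousLinearMap.opNorm_le_bound _ zero_le_one fun g => ?_
    have h1 := key n (J d g)
    have e : (((n + 1 : ℕ) : ℂ) • (J d * ((U n)⁻¹ : (Op d)ˣ).val * J d)) g =
      ((n + 1 : ℕ) : ℂ) • J d (((U n)⁻¹ : (Op d)ˣ).val (J d g)) := rfl
    rw [e, norm_smul, Complex.norm_natCast]
    set y := ((U n)⁻¹ : (Op d)ˣ).val (J d g)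
    rw [← J_inner] at h1
    have h2 : (⟪J d y, g⟫).re ≤ ‖J d y‖ * ‖g‖ :=
      (Complex.re_le_norm _).trans (norm_inner_le_norm _ _)
    have h3 : 0 ≤ ‖y‖ ^ 2 := by positivity
    by_contra! h4
    rw [one_mul] at h4
    have h5 : 0 < ‖J d y‖ := by
      by_contra! h6
      have : ‖J d y‖ = 0 := le_antisymm h6 (norm_nonneg _)
      rw [this, mul_zero] at h4
      exact (norm_nonneg g).not_gt h4
    nlinarith

namespace IsResolvent

variable {R : ℕ → Op d}

/-- An operator commutes with its resolvent, expressed through M⁻¹(h + c)M⁻¹: both sides, times n +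
1, equal G − GRG with G = `shiftOp H c`. -/
theorem comm (hR : IsResolvent H c R) (n : ℕ) :
    J d ^ 2 * R n * shiftOp H c = shiftOp H c * R n * J d ^ 2 := by
  have h1 := congrArg (· * shiftOp H c) (hR.mul_right n)
  have h2 := congrArg (shiftOp H c * ·) (hR.mul_left n)
  simp only [smul_mul_assoc, mul_smul_comm, sub_mul, mul_sub, one_mul, mul_one,
    ← mul_assoc] at h1 h2
  have h3 := h1.trans h2.symm
  exact smul_right_injective _ (Nat.cast_ne_zero.2 n.succ_ne_zero : ((n + 1 : ℕ) : ℂ) ≠ 0) h3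

theorem comm' (hR : IsResolvent H c R) (n : ℕ) :
    J d ^ 2 * R n * H = H * R n * J d ^ 2 := by
  have h := hR.comm n
  simp only [shiftOp, mul_add, add_mul, mul_smul_comm, smul_mul_assoc] at h
  exact add_right_cancel h

theorem norm_mul_left_le (hR : IsResolvent H c R) (n : ℕ) :
    ‖((n + 1 : ℕ) : ℂ) • (R n * J d ^ 2)‖ ≤ 1 + 2 * ‖shiftOp H c‖ := by
  rw [hR.mul_left]
  refine (norm_sub_le _ _).trans (add_le_add ?_ ((norm_mul_le _ _).trans ?_))
  · exact ContinuousLinearMap.norm_id_le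
  · gcongr
    exact hR.norm_le n

theorem norm_mul_right_le (hR : IsResolvent H c R) (n : ℕ) :
    ‖((n + 1 : ℕ) : ℂ) • (J d ^ 2 * R n)‖ ≤ 1 + 2 * ‖shiftOp H c‖ := by
  rw [hR.mul_right]
  refine (norm_sub_le _ _).trans (add_le_add ?_ ((norm_mul_le _ _).trans ?_))
  · exact ContinuousLinearMap.norm_id_le
  · rw [mul_comm]
    gcongr
    exact hR.norm_le n

/-- On the dense range of J² one has ‖RₙJ²f‖ ≤ const · ‖f‖/(n+1); the uniform bound on Rₙ does the
rest. Inserted into the resolvent identities this gives (n+1)RₙJ² → 1 and (n+1)J²Rₙ → 1 strongly. -/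
theorem tendsto_zero (hR : IsResolvent H c R) (g : L2 d) :
    Tendsto (fun n => R n g) atTop (𝓝 0) := by
  have hD : DenseRange (J d ^ 2 : Op d) := by
    rw [pow_two]
    exact J_denseRange.comp J_denseRange (J d).continuous
  refine tendsto_op_of_dense (L := 0) hR.norm_le hD (fun f => ?_) g
  have h1 : Tendsto (fun n : ℕ => (1 / ((n : ℝ) + 1)) * ((1 + 2 * ‖shiftOp H c‖) * ‖f‖))
      atTop (𝓝 0) := by
    have := (tendsto_one_div_add_atTop_nhds_zero_nat (𝕜 := ℝ)).mul_const
      ((1 + 2 * ‖shiftOp H c‖) * ‖f‖)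
    rwa [zero_mul] at this
  refine squeeze_zero_norm (fun n => ?_) h1
  have h2 := (((n + 1 : ℕ) : ℂ) • (R n * J d ^ 2)).le_of_opNorm_le (hR.norm_mul_left_le n) f
  have e : (((n + 1 : ℕ) : ℂ) • (R n * J d ^ 2)) f = ((n + 1 : ℕ) : ℂ) • R n ((J d ^ 2) f) := rfl
  rw [e, norm_smul, Complex.norm_natCast] at h2
  rw [one_div, ← div_eq_inv_mul, le_div_iff₀ (by positivity), mul_comm]
  exact_mod_cast h2

theorem tendsto_mul_left (hR : IsResolvent H c R) (g : L2 d) :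
    Tendsto (fun n => (((n + 1 : ℕ) : ℂ) • (R n * J d ^ 2)) g) atTop (𝓝 g) := by
  have h := (hR.tendsto_zero (shiftOp H c g)).const_sub g
  rw [sub_zero] at h
  refine h.congr fun n => ?_
  rw [hR.mul_left]
  rfl

theorem tendsto_mul_right (hR : IsResolvent H c R) (g : L2 d) :
    Tendsto (fun n => (((n + 1 : ℕ) : ℂ) • (J d ^ 2 * R n)) g) atTop (𝓝 g) := by
  have h := (((shiftOp H c).continuous.tendsto _).comp (hR.tendsto_zero g)).const_sub g
  rw [map_zero, sub_zero] at h
  refine h.congr fun n => ?_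
  rw [hR.mul_right]
  rfl

/-- The resolvent `(n + 1) (n + 1 + h + c)⁻¹` of the unbounded operator. -/
def Q (R : ℕ → Op d) (n : ℕ) : Op d := ((n + 1 : ℕ) : ℂ) • (J d * R n * J d)

theorem tendsto_Q (hR : IsResolvent H c R) (g : L2 d) :
    Tendsto (fun n => Q R n g) atTop (𝓝 g) := by
  refine tendsto_op_of_dense (L := 1) hR.norm_le' J_denseRange (fun f => ?_) g
  refine (((J d).continuous.tendsto _).comp (hR.tendsto_mul_left f)).congr fun n => ?_
  simp only [Function.comp_apply, smul_apply, map_smul, pow_two]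
  rfl

theorem norm_Q_le (hR : IsResolvent H c R) (n : ℕ) : ‖Q R n‖ ≤ 1 := hR.norm_le' n

theorem tendsto_conj_Q (hR : IsResolvent H c R) (g : L2 d) :
    Tendsto (fun n => conj (Q R n) g) atTop (𝓝 g) := by
  have := (continuous_star_L2.tendsto _).comp (hR.tendsto_Q (star g))
  rwa [star_star] at this

end IsResolvent

end

/-! ### Regularity of `h σ` -/

theorem hasSum_trace_star_mul_self {A : Op d} (hA : HS A) :
    HasSum (fun i => ‖A (onb d i)‖ ^ 2) (trace (star A * A)).re := by
  have hs : ∀ i, ⟪onb d i, (star A * A) (onb d i)⟫ = ((‖A (onb d i)‖ ^ 2 : ℝ) : ℂ) := by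
    intro i
    have : ⟪onb d i, (star A * A) (onb d i)⟫ = ⟪A (onb d i), A (onb d i)⟫ :=
      inner_adj' A (onb d i) (A (onb d i))
    rw [this, inner_self_eq_norm_sq_to_K]
    norm_cast
  have h : HasSum (fun i => (⟪onb d i, (star A * A) (onb d i)⟫).re) (trace (star A * A)).re :=
    Complex.hasSum_re (HS.mul hA.star hA).summable.hasSum
  refine (funext fun i => ?_ : (fun i => ‖A (onb d i)‖ ^ 2) = _) ▸ h
  rw [hs, Complex.ofReal_re]

theorem exists_eq_star_mul_self {A : Type*} [CStarAlgebra A] [PartialOrder A] [StarOrderedRing A]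
    {a : A} (h : 0 ≤ a) : ∃ b, a = star b * b := CStarAlgebra.nonneg_iff_eq_star_mul_self.1 h

theorem hsSq_eq_ofReal {A : Op d} (hA : HS A) :
    hsSq A = ENNReal.ofReal (trace (star A * A)).re := by
  have h := hasSum_trace_star_mul_self hA
  rw [← h.tsum_eq, ENNReal.ofReal_tsum_of_nonneg (fun i => by positivity) h.summable, hsSq]
  refine tsum_congr fun i => ?_
  rw [ENNReal.ofReal_pow (norm_nonneg _), ofReal_norm]

theorem trace_star_mul_self_nonneg {A : Op d} (hA : HS A) : 0 ≤ (trace (star A * A)).re :=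
  (hasSum_trace_star_mul_self hA).nonneg fun _ => by positivity

/-- Expand ‖a + aᵀ‖² in the Hilbert-Schmidt inner product: the cross term is nonnegative by
hypothesis and ‖aᵀ‖² may be dropped. -/
theorem hsNorm_le_add_transp {a : Op d} (ha : HS a) (h : 0 ≤ (trace (star a * transp a)).re) :
    hsNorm a ≤ hsNorm (a + transp a) := by
  rw [hsNorm_eq, hsNorm_eq]
  refine ENNReal.rpow_le_rpow ?_ (by norm_num)
  rw [hsSq_eq_ofReal ha, hsSq_eq_ofReal (ha.add ha.transp)]
  refine ENNReal.ofReal_le_ofReal ?_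
  have e : trace (star (a + transp a) * (a + transp a)) = trace (star a * a)
      + trace (star a * transp a) + (star (trace (star a * transp a))
      + trace (star (transp a) * transp a)) := by
    have h1 := ha.star
    have h2 := ha.transp
    rw [star_add, add_mul, mul_add, mul_add,
      trace_add ((h1.mul ha).add (h1.mul h2)) ((h2.star.mul ha).add (h2.star.mul h2)),
      trace_add (h1.mul ha) (h1.mul h2), trace_add (h2.star.mul ha) (h2.star.mul h2),
      ← trace_star, star_mul, star_star]
  have h3 := trace_star_mul_self_nonneg ha.transp
  rw [e, Complex.add_re, Complex.add_re, Complex.add_re, Complex.star_def, Complex.conj_re]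
  linarith

/-- Lower semicontinuity of the Hilbert-Schmidt norm under strong convergence, seen on finite parts
of the basis. -/
theorem hs_of_tendsto {A : ℕ → Op d} {B : Op d} {C : ℝ≥0∞} (hC : C < ⊤)
    (hA : ∀ n, hsNorm (A n) ≤ C) (h : ∀ f, Tendsto (fun n => A n f) atTop (𝓝 (B f))) : HS B := by
  rw [HS, hsNorm_lt_top_iff]
  refine lt_of_le_of_lt ?_ (ENNReal.pow_lt_top hC (n := 2))
  rw [hsSq, ENNReal.tsum_eq_iSup_sum]
  refine iSup_le fun s => ?_
  have h1 : Tendsto (fun n => ∑ i ∈ s, ‖A n (onb d i)‖ₑ ^ 2) atTop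
      (𝓝 (∑ i ∈ s, ‖B (onb d i)‖ₑ ^ 2)) :=
    tendsto_finsetSum _ fun i _ => ENNReal.Tendsto.pow ((continuous_enorm.tendsto _).comp (h _))
  refine le_of_tendsto' h1 fun n => ?_
  calc _ ≤ hsSq (A n) := ENNReal.sum_le_tsum s
    _ = hsNorm (A n) ^ 2 := (hsNorm_sq _).symm
    _ ≤ C ^ 2 := by gcongr; exact hA n

/-- The Hilbert-Schmidt pairing of `h σ` and `σ h̄`, regularized by resolvents, is nonnegative. -/
theorem re_trace_sandwich_nonneg {r G ρ x : Op d} (hr : star r = r) (hG : G = star ρ * ρ)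
    (hcomm : J d ^ 2 * r * G = G * r * J d ^ 2) (hx : HS x) (hxs : transp x * J d = J d * x)
    {a : Op d} (ha : a = J d * r * G * x * J d * conj r * J d) :
    0 ≤ (trace (star a * transp a)).re := by
  have hGs : star G = G := by rw [hG, star_mul, star_star]
  have c1 : ∀ X, G * (r * (J d * (J d * X))) = J d * (J d * (r * (G * X))) := fun X => by
    have := congrArg (· * X) hcomm
    simp only [pow_two, mul_assoc] at this
    exact this.symm
  have c2 : ∀ X, conj G * (conj r * (J d * (J d * X))) = J d * (J d * (conj r * (conj G * X))) :=
      fun X => by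
    have := congrArg (fun A => conj A * X) hcomm
    simp only [pow_two, conj_mul, conj_J, mul_assoc] at this
    exact this.symm
  have hr' : star (conj r) = conj r := by rw [star_conj, hr]
  have c3 : ∀ X, transp x * (J d * X) = J d * (x * X) := fun X => by
    rw [← mul_assoc, hxs, mul_assoc]
  have sa : star a = (J d * conj r * J d) * (star x * G * r * J d) := by
    rw [ha]
    simp only [star_mul, star_J, hr, hr', hGs, mul_assoc]
  have ta : transp a = J d * r * J d * transp x * conj G * conj r * J d := by
    rw [ha]
    simp only [transp_mul, transp_J, transp_conj, hr, mul_assoc]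
    simp only [transp, hr, hGs]
  -- Since m*m = J r G r J, the commutation rules and the symmetry of σ rearrange the pairing into
  -- the squared Hilbert-Schmidt norm of D = m σ mᵀ.
  set m := ρ * r * J d with hm
  set D := m * (J d * x) * star (conj m) with hD
  have hDs : HS D := ((hx.mul_left _).mul_left _).mul_right _
  have hJx : HS (J d * x) := hx.mul_left _
  have e : trace (star a * transp a) = trace (star D * D) := by
    have hn : Nuc (star x * G * r * J d * transp a) := by
      rw [ta]
      refine HS.mul (((hx.star.mul_right _).mul_right _).mul_right _) ?_
      exact (((hx.transp.mul_left _).mul_right _).mul_right _).mul_right _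
    rw [sa, mul_assoc, ← trace_mul_comm_of_nuc hn]
    have hn2 : Nuc (star (J d * x) * (star m * m) * (J d * x) * star (conj m)) :=
      (HS.mul (hJx.star.mul_right _) hJx).mul_right _
    have e2 : star D * D =
        conj m * (star (J d * x) * (star m * m) * (J d * x) * star (conj m)) := by
      rw [hD]
      simp only [star_mul, star_star, mul_assoc]
    rw [e2, ← trace_mul_comm_of_nuc hn2, ta]
    congr 1
    have e3 : star m * m = J d * (r * (G * (r * J d))) := by
      rw [hm, hG]
      simp only [star_mul, star_J, hr, mul_assoc]
    have e4 : star (conj m) * conj m = J d * (conj r * (conj G * (conj r * J d))) := by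
      have := congrArg conj e3
      rw [conj_mul, ← star_conj] at this
      rw [this]
      simp only [conj_mul, conj_J]
    rw [mul_assoc _ (star (conj m)), e4, e3]
    simp only [star_mul, star_J, mul_assoc, c1, c2, c3]
  rw [e]
  exact trace_star_mul_self_nonneg hDs

section

variable {H : Op d} {c : ℝ} {R : ℕ → Op d}

theorem transp_shiftOp (hs : star H = H) : transp (shiftOp H c) = conj (shiftOp H c) := by
  rw [transp, star_shiftOp hs]

theorem isPositive_shiftOp (hs : star H = H)
    (hc : ∀ g, (1 / 2) * ‖g‖ ^ 2 ≤ (⟪g, H g⟫).re + c * ‖J d g‖ ^ 2) :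
    (shiftOp H c).IsPositive := by
  rw [ContinuousLinearMap.isPositive_def']
  refine ⟨star_shiftOp hs, fun g => ?_⟩
  have e : ⟪g, shiftOp H c g⟫ = ⟪g, H g⟫ + c * ⟪g, (J d ^ 2) g⟫ := by
    simp only [shiftOp, add_apply, smul_apply, inner_add_right, inner_smul_right]
  have e2 : (⟪g, shiftOp H c g⟫).re = (⟪g, H g⟫).re + c * ‖J d g‖ ^ 2 := by
    rw [e, inner_J_sq, Complex.add_re, Complex.re_ofReal_mul, Complex.ofReal_re]
  rw [ContinuousLinearMap.reApplyInnerSelf_apply, inner_re_symm]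
  change 0 ≤ (⟪g, shiftOp H c g⟫).re
  rw [e2]
  exact le_trans (by positivity) (hc g)

/-- The regularity statement behind conservation: if hσ + σh̄ is Hilbert-Schmidt for symmetric σ,
then so is hσ. Sandwiched between resolvents, the two summands have a nonnegative pairing once h is
shifted to be positive, so the norm of one is controlled by the norm of the sum, uniformly in n. -/
theorem IsResolvent.exists_J_mul (hR : IsResolvent H c R) (hs : star H = H)
    (hc : ∀ g, (1 / 2) * ‖g‖ ^ 2 ≤ (⟪g, H g⟫).re + c * ‖J d g‖ ^ 2) {x Z : Op d} (hx : HS x)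
    (hxs : transp x * J d = J d * x) (hZ : HS Z)
    (e : H * x * J d + J d * transp x * conj H = J d * Z * J d) :
    ∃ Y, HS Y ∧ H * x = J d * Y ∧ Y + transp Y = Z := by
  obtain ⟨ρ, hρ⟩ := exists_eq_star_mul_self (A := Op d)
    ((ContinuousLinearMap.nonneg_iff_isPositive _).2 (isPositive_shiftOp hs hc))
  set G := shiftOp H c with hG
  -- Replacing h by h + c adds cσ to each of the two summands.
  set Z' := Z + (2 * c : ℂ) • (J d * x) with hZ'
  have hZs : HS Z' := hZ.add ((hx.mul_left _).smul _)
  have e' : G * x * J d + J d * transp x * conj G = J d * Z' * J d := by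
    have e1 : J d * transp x * (J d * J d) = J d * J d * x * J d := by
      rw [← mul_assoc, mul_assoc (J d) (transp x), hxs, ← mul_assoc]
    have e2 : J d * Z' * J d = J d * Z * J d + (2 * c : ℂ) • (J d * J d * x * J d) := by
      rw [hZ']
      simp only [mul_add, add_mul, mul_smul_comm, smul_mul_assoc, mul_assoc]
    rw [e2, ← e, hG, shiftOp, conj_add, conj_smul, pow_two, conj_mul, conj_J, mul_add,
      mul_smul_comm, e1, add_mul, add_mul, smul_mul_assoc, smul_mul_assoc, two_mul, add_smul,
      Complex.star_def, Complex.conj_ofReal]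
    abel
  let a : ℕ → Op d := fun n => J d * R n * G * x * J d * conj (R n) * J d
  have ha : ∀ n, HS (a n) := fun n =>
    (((hx.mul_left _).mul_right _).mul_right _).mul_right _
  have hat : ∀ n, transp (a n) = J d * R n * J d * transp x * conj G * conj (R n) * J d := by
    intro n
    simp only [a, transp_mul, transp_J, transp_conj, hR.star_eq, mul_assoc, hG, transp_shiftOp hs]
    rw [show transp (R n) = conj (R n) by rw [transp, hR.star_eq]]
  have hsum : ∀ n, (((n + 1 : ℕ) : ℂ) ^ 2) • (a n + transp (a n)) =
      IsResolvent.Q R n * Z' * conj (IsResolvent.Q R n) := by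
    intro n
    have e1 : a n + transp (a n) = J d * R n * (J d * Z' * J d) * (conj (R n) * J d) := by
      rw [← e', hat]
      simp only [a, mul_add, add_mul, mul_assoc]
    rw [e1, IsResolvent.Q, conj_smul]
    simp only [conj_mul, conj_J, smul_mul_assoc, mul_smul_comm, smul_smul, mul_assoc,
      star_natCast, pow_two]
  have hQn : ∀ n, ‖IsResolvent.Q R n‖ₑ ≤ 1 := fun n => by
    rw [← ofReal_norm]
    exact ENNReal.ofReal_le_one.2 (hR.norm_Q_le n)
  -- The factor (n+1)² turns the resolvents around Z' into the contractions Q, so the bound does not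
  -- depend on n.
  have hbd : ∀ n, hsNorm ((((n + 1 : ℕ) : ℂ) ^ 2) • a n) ≤ hsNorm Z' := by
    intro n
    have h1 := hsNorm_le_add_transp (ha n)
      (re_trace_sandwich_nonneg (hR.star_eq n) hρ (hR.comm n) hx hxs rfl)
    calc _ = ‖((n + 1 : ℕ) : ℂ) ^ 2‖ₑ * hsNorm (a n) := hsNorm_smul _ _
      _ ≤ ‖((n + 1 : ℕ) : ℂ) ^ 2‖ₑ * hsNorm (a n + transp (a n)) := by gcongr
      _ = hsNorm (IsResolvent.Q R n * Z' * conj (IsResolvent.Q R n)) := by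
        rw [← hsNorm_smul, hsum]
      _ ≤ hsNorm Z' := by
        refine (hsNorm_mul_le' _ _).trans ?_
        rw [enorm_conj]
        calc _ ≤ (1 * hsNorm Z') * 1 :=
              mul_le_mul' ((hsNorm_mul_le _ _).trans (mul_le_mul' (hQn n) le_rfl)) (hQn n)
          _ = _ := by rw [one_mul, mul_one]
  have hlim : ∀ h, Tendsto (fun n => J d (((((n + 1 : ℕ) : ℂ) ^ 2) • a n) h)) atTop
      (𝓝 ((G * x) h)) := by
    intro h
    have h1 := tendsto_op_seq_apply (L := 1) hR.norm_mul_right_le hR.tendsto_mul_right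
      (((G * x).continuous.tendsto _).comp (hR.tendsto_conj_Q h))
    refine h1.congr fun n => ?_
    have e1 : (((n + 1 : ℕ) : ℂ) • (J d ^ 2 * R n)) * (G * x) * conj (IsResolvent.Q R n) =
        J d * ((((n + 1 : ℕ) : ℂ) ^ 2) • a n) := by
      rw [IsResolvent.Q, conj_smul]
      simp only [a, conj_mul, conj_J, smul_mul_assoc, mul_smul_comm, smul_smul, mul_assoc,
        star_natCast, pow_two]
    exact DFunLike.congr_fun e1 h
  -- Pairing the limit with g moves one `J` onto g. The resulting estimate lets the adjoint of Gx
  -- factor through `J`, so that Gx = JY with Y bounded.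
  have hC : ∀ g, ‖star (G * x) g‖ ≤ (hsNorm Z').toReal * ‖J d g‖ := by
    intro g
    have h1 : ∀ h, ‖⟪g, (G * x) h⟫‖ ≤ (hsNorm Z').toReal * ‖J d g‖ * ‖h‖ := by
      intro h
      refine le_of_tendsto' (((tendsto_const_nhds (x := g)).inner (𝕜 := ℂ) (hlim h)).norm)
        fun n => ?_
      rw [← J_inner]
      have h2 : ‖(((n + 1 : ℕ) : ℂ) ^ 2) • a n‖ ≤ (hsNorm Z').toReal := by
        rw [← ENNReal.ofReal_le_iff_le_toReal hZs.ne, ofReal_norm]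
        exact (opNorm_le_hsNorm _).trans (hbd n)
      calc _ ≤ ‖J d g‖ * ‖((((n + 1 : ℕ) : ℂ) ^ 2) • a n) h‖ := norm_inner_le_norm _ _
        _ ≤ ‖J d g‖ * ((hsNorm Z').toReal * ‖h‖) := by
          gcongr
          exact ContinuousLinearMap.le_of_opNorm_le _ h2 _
        _ = _ := by ring
    have h2 := h1 (star (G * x) g)
    rw [← inner_adj, inner_self_eq_norm_sq_to_K, norm_pow] at h2
    have h3 : ‖(RCLike.ofReal ‖star (G * x) g‖ : ℂ)‖ = ‖star (G * x) g‖ := by simp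
    rw [h3] at h2
    by_contra! h4
    have h5 : 0 ≤ (hsNorm Z').toReal * ‖J d g‖ := by positivity
    nlinarith
  obtain ⟨B, hB⟩ := exists_eq_mul_J hC
  have hY : G * x = J d * star B := by
    have := congrArg star hB
    rwa [star_star, star_mul, star_J] at this
  -- Now (n+1)² aₙ = Q Y Q̄ converges strongly to Y, and the uniform bound makes Y Hilbert-Schmidt.
  have hYs : HS (star B) := by
    refine hs_of_tendsto hZs hbd fun f => ?_
    have h1 := tendsto_op_seq_apply (L := 1) hR.norm_Q_le hR.tendsto_Q
      (((star B).continuous.tendsto _).comp (hR.tendsto_conj_Q f))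
    refine h1.congr fun n => ?_
    have e1 : IsResolvent.Q R n * star B * conj (IsResolvent.Q R n) =
        (((n + 1 : ℕ) : ℂ) ^ 2) • a n := by
      have e2 : a n = J d * R n * (J d * star B) * J d * conj (R n) * J d := by
        rw [← hY]
        simp only [a, mul_assoc]
      rw [e2, IsResolvent.Q, conj_smul]
      simp only [conj_mul, conj_J, smul_mul_assoc, mul_smul_comm, smul_smul, mul_assoc,
        star_natCast, pow_two]
    exact DFunLike.congr_fun e1 f
  have hHx : H * x = J d * (star B - (c : ℂ) • (J d * x)) := by
    have : G * x = H * x + (c : ℂ) • (J d * (J d * x)) := by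
      rw [hG, shiftOp, add_mul, smul_mul_assoc, pow_two, mul_assoc]
    rw [mul_sub, ← hY, this, mul_smul_comm, add_sub_cancel_right]
  refine ⟨star B - (c : ℂ) • (J d * x), hYs.sub ((hx.mul_left _).smul _), hHx, ?_⟩
  generalize star B - (c : ℂ) • (J d * x) = Y at hHx
  refine mul_J_cancel (J_mul_cancel (A := (Y + transp Y) * J d) (B := Z * J d) ?_)
  have ht := congrArg transp hHx
  rw [transp_mul, transp_mul, transp_J, show transp H = conj H by rw [transp, hs]] at ht
  rw [← mul_assoc (J d) Z, ← e, hHx, mul_assoc (J d) (transp x), ht]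
  simp only [add_mul, mul_add, mul_assoc]

end

/-! ### Conservation of the energy -/

namespace IsResolvent

variable {H : Op d} {c : ℝ} {R : ℕ → Op d}

/-- The regularized one-particle operator `Q h Q`. -/
def W (H : Op d) (R : ℕ → Op d) (n : ℕ) : Op d :=
  (((n + 1 : ℕ) : ℂ) ^ 2) • (J d * R n * H * R n * J d)

theorem star_W (hR : IsResolvent H c R) (hs : star H = H) (n : ℕ) : star (W H R n) = W H R n := by
  rw [W, star_smul, star_pow, star_natCast]
  simp only [star_mul, star_J, hR.star_eq, hs, mul_assoc]

theorem comm_assoc (hR : IsResolvent H c R) (n : ℕ) (X : Op d) :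
    H * (R n * (J d * (J d * X))) = J d * (J d * (R n * (H * X))) := by
  have := congrArg (· * X) (hR.comm' n)
  simp only [pow_two, mul_assoc] at this
  exact this.symm

/-- The rigorous form of Tr[QhQ [h, γ]] = 0. All factors other than a are bounded and a is trace
class, so cyclicity is legitimate, and `comm_assoc` expresses that QhQ commutes with h. -/
theorem trace_W_mul_eq_zero (hR : IsResolvent H c R) {a C : Op d} (ha : Nuc a) (hC : Nuc C)
    (e : J d * C * J d = H * a * J d * J d - J d * J d * a * H) (n : ℕ) :
    trace (W H R n * C) = 0 := by
  have h1 : trace (J d * R n * H * R n * J d * C) = trace (R n * H * R n * (J d * C * J d)) := by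
    have e1 : J d * R n * H * R n * J d * C = J d * (R n * H * R n * J d * C) := by
      simp only [mul_assoc]
    rw [e1, ← trace_mul_comm_of_nuc (hC.mul_left _)]
    simp only [mul_assoc]
  have h2 : trace (R n * H * R n * (H * a * J d * J d)) =
      trace (R n * H * R n * (J d * J d * a * H)) := by
    have e1 : R n * H * R n * (H * a * J d * J d) = (R n * H * R n * H * a) * (J d * J d) := by
      simp only [mul_assoc]
    have e2 : R n * H * R n * (J d * J d * a * H) = (R n * H * R n * J d * J d * a) * H := by
      simp only [mul_assoc]
    rw [e1, e2, trace_mul_comm_of_nuc (ha.mul_left _), trace_mul_comm_of_nuc (ha.mul_left _)]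
    congr 1
    simp only [mul_assoc, hR.comm_assoc]
  rw [W, smul_mul_assoc, trace_smul, h1, e, mul_sub,
    trace_sub ((((ha.mul_left H).mul_right _).mul_right _).mul_left _)
      (((ha.mul_left _).mul_right _).mul_left _), h2, sub_self, mul_zero]

theorem tendsto_trace_W (hR : IsResolvent H c R) {D : Op d} (hD : Nuc D) :
    Tendsto (fun n => trace (W H R n * (J d * D * J d))) atTop (𝓝 (trace (H * D))) := by
  have e : ∀ n, trace (W H R n * (J d * D * J d)) =
      trace ((((n + 1 : ℕ) : ℂ) • (J d ^ 2 * R n)) * H * (((n + 1 : ℕ) : ℂ) • (R n * J d ^ 2)) * D)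
      := by
    intro n
    have e1 : W H R n * (J d * D * J d) = (W H R n * J d * D) * J d := by simp only [mul_assoc]
    rw [e1, trace_mul_comm_of_nuc (hD.mul_left _)]
    congr 1
    simp only [W, smul_mul_assoc, mul_smul_comm, smul_smul, pow_two, mul_assoc]
  simp only [e]
  refine tendsto_trace_mul hD (C := (1 + 2 * ‖shiftOp H c‖) * ‖H‖ * (1 + 2 * ‖shiftOp H c‖))
    (fun n => ?_) fun f => ?_
  · refine (norm_mul_le _ _).trans (mul_le_mul ((norm_mul_le _ _).trans ?_)
      (hR.norm_mul_left_le n) (norm_nonneg _) (by positivity))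
    exact mul_le_mul_of_nonneg_right (hR.norm_mul_right_le n) (norm_nonneg _)
  · have h1 := tendsto_op_seq_apply (L := 1) hR.norm_mul_right_le hR.tendsto_mul_right
      ((H.continuous.tendsto _).comp (hR.tendsto_mul_left f))
    exact h1

theorem W_mul (hR : IsResolvent H c R) {x Y : Op d} (e : H * x = J d * Y) (n : ℕ) :
    W H R n * (J d * x) = Q R n * Q R n * Y := by
  have e1 : J d * R n * H * R n * J d * (J d * x) = J d * R n * J d * (J d * R n * (H * x)) := by
    simp only [mul_assoc, hR.comm_assoc]
  rw [W, Q, smul_mul_assoc, e1, e]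
  simp only [smul_mul_assoc, mul_smul_comm, smul_smul, pow_two, mul_assoc]

theorem tendsto_trace_Q (hR : IsResolvent H c R) {D : Op d} (hD : Nuc D) :
    Tendsto (fun n => trace (Q R n * Q R n * D)) atTop (𝓝 (trace D)) := by
  have h := tendsto_trace_mul (W := fun n => Q R n * Q R n) (L := 1) hD (C := 1)
    (fun n => (norm_mul_le _ _).trans (mul_le_one₀ (hR.norm_Q_le n) (norm_nonneg _)
      (hR.norm_Q_le n)))
    (fun f => tendsto_op_seq_apply (L := 1) hR.norm_Q_le hR.tendsto_Q (hR.tendsto_Q f))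
  rwa [one_mul] at h

/-- Pair the γ-equation with QhQ: the commutator disappears, and QhQσ = Q²(hσ) because hσ = Y is
Hilbert-Schmidt. As n → ∞ there remains i Tr[h γ̇] = conj(Tr[Y K*]) − Tr[Y K*]. -/
theorem trace_H_mul (hR : IsResolvent H c R) (hs : star H = H) {a a' x Y K : Op d} (ha : Nuc a)
    (ha' : Nuc a') (hx : HS x) (hY : HS Y) (hK : HS K) (hxY : H * x = J d * Y)
    (e : Complex.I • (J d * (J d * a' * J d) * J d) = H * a * J d * J d - J d * J d * a * H
      + J d * (K * star (J d * x) - J d * x * star K) * J d) :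
    trace (H * a') = ((-2 * (trace (Y * star K)).im : ℝ) : ℂ) := by
  have hσ : HS (J d * x) := hx.mul_left _
  set B := K * star (J d * x) - J d * x * star K with hB
  have n1 : Nuc (K * star (J d * x)) := hK.mul hσ.star
  have n2 : Nuc (J d * x * star K) := hσ.mul hK.star
  have hBn : Nuc B := n1.sub n2
  have hC : Nuc (Complex.I • (J d * a' * J d) - B) := (ha'.weight.smul _).sub hBn
  have h1 : ∀ n, Complex.I * trace (W H R n * (J d * a' * J d)) = trace (W H R n * B) := by
    intro n
    have h2 := hR.trace_W_mul_eq_zero ha hC (by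
      rw [mul_sub, sub_mul, mul_smul_comm, smul_mul_assoc, e, add_sub_cancel_right]) n
    rw [mul_sub, trace_sub ((ha'.weight.smul _).mul_left _) (hBn.mul_left _), mul_smul_comm,
      trace_smul] at h2
    exact sub_eq_zero.1 h2
  have h2 : ∀ n, trace (W H R n * B) =
      star (trace (Q R n * Q R n * (Y * star K))) - trace (Q R n * Q R n * (Y * star K)) := by
    intro n
    have e1 : W H R n * (J d * x * star K) = Q R n * Q R n * (Y * star K) := by
      rw [← mul_assoc, hR.W_mul hxY, mul_assoc]
    have e2 : trace (W H R n * (K * star (J d * x))) =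
        star (trace (Q R n * Q R n * (Y * star K))) := by
      have e3 : star (W H R n * (J d * x * star K)) = K * star (J d * x) * W H R n := by
        rw [star_mul (W H R n), hR.star_W hs, star_mul (J d * x), star_star]
      rw [← e1, ← trace_star, e3, trace_mul_comm_of_nuc n1]
    rw [hB, mul_sub, trace_sub (n1.mul_left _) (n2.mul_left _), e1, e2]
  have h3 := (hR.tendsto_trace_W ha').const_mul Complex.I
  have h4 := hR.tendsto_trace_Q (hY.mul hK.star)
  have h5 := ((Complex.continuous_conj.tendsto _).comp h4).sub h4
  have h6 : Complex.I * trace (H * a') = star (trace (Y * star K)) - trace (Y * star K) :=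
    tendsto_nhds_unique (h3.congr fun n => (h1 n).trans (h2 n)) h5
  have h7 : trace (H * a') = -Complex.I * (Complex.I * trace (H * a')) := by
    rw [← mul_assoc]
    simp
  rw [h7, h6]
  apply Complex.ext <;> simp
  ring

end IsResolvent

/-- Multiply the σ-equation by K* and take the trace. The terms containing a, and KK*, have real
trace; hσ and its transpose contribute equally because K is symmetric. Multiplication by i turns the
real part of Tr[σ̇K*] into the imaginary part of the right side. -/
theorem re_trace_mul_star {K a x' Y : Op d} (hK : HS K) (hKs : transp K = K) (ha : Nuc a)
    (has : star a = a) (hx' : HS x') (hY : HS Y)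
    (e : Complex.I • (J d * x') = Y + transp Y + (K * J d * conj a * J d + J d * a * J d * K + K)) :
    (trace (K * star (J d * x'))).re = 2 * (trace (Y * star K)).im := by
  have hσ : HS (J d * x') := hx'.mul_left _
  have hKc : star K = conj K := by conv_lhs => rw [← hKs, star_transp]
  have im_zero : ∀ {A : Op d}, star A = A → (trace A).im = 0 := by
    intro A hA
    have := trace_star A
    rw [hA] at this
    exact Complex.conj_eq_iff_im.1 this.symm
  have hac : star (conj a) = conj a := by rw [star_conj, has]
  have z1 : (trace (K * J d * conj a * J d * star K)).im = 0 := im_zero (by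
    simp only [star_mul, star_star, star_J, hac, mul_assoc])
  have z2 : (trace (J d * a * J d * K * star K)).im = 0 := by
    have : trace (J d * a * J d * K * star K) = star (trace (J d * a * J d * K * star K)) := by
      have e1 : star (J d * a * J d * (K * star K)) = K * star K * (J d * a * J d) := by
        rw [star_mul, star_weight, has, star_mul, star_star]
      rw [mul_assoc, ← trace_star, e1, trace_mul_comm_of_nuc ha.weight]
    exact Complex.conj_eq_iff_im.1 this.symm
  have z3 : (trace (K * star K)).im = 0 := im_zero (by simp only [star_mul, star_star])
  have hT : trace (transp Y * star K) = trace (Y * star K) := by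
    have h1 : transp (transp Y * star K) = star K * Y := by
      rw [transp_mul, transp_transp, hKc, transp_conj, hKc]
    rw [← trace_transp (hY.transp.mul hK.star), h1, trace_mul_comm_of_hs hK.star hY]
  have m1 : Nuc (K * J d * conj a * J d * star K) :=
    (((ha.conj.mul_left _).mul_right _).mul_right _)
  have m2 : Nuc (J d * a * J d * K * star K) := (ha.weight.mul_right _).mul_right _
  have m3 : Nuc (K * star K) := hK.mul hK.star
  have h1 : Complex.I * trace (J d * x' * star K) = trace (Y * star K) + trace (Y * star K)
      + (trace (K * J d * conj a * J d * star K) + trace (J d * a * J d * K * star K)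
        + trace (K * star K)) := by
    rw [← trace_smul, ← smul_mul_assoc, e]
    simp only [add_mul]
    rw [trace_add ((hY.mul hK.star).add (hY.transp.mul hK.star)) ((m1.add m2).add m3),
      trace_add (hY.mul hK.star) (hY.transp.mul hK.star), trace_add (m1.add m2) m3,
      trace_add m1 m2, hT]
  have h2 : (trace (K * star (J d * x'))).re = (trace (J d * x' * star K)).re := by
    have : trace (K * star (J d * x')) = star (trace (J d * x' * star K)) := by
      rw [← trace_star, star_mul (J d * x'), star_star]
    rw [this, Complex.star_def, Complex.conj_re]
  have h3 := congrArg Complex.im h1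
  simp only [Complex.add_im, z1, z2, z3, Complex.mul_im, Complex.I_re, Complex.I_im] at h3
  rw [h2]
  linarith

theorem HasDerivWithinAt.star_L2 {f : ℝ → L2 d} {f' : L2 d} {s : Set ℝ} {t : ℝ}
    (h : HasDerivWithinAt f f' s t) : HasDerivWithinAt (fun r => star (f r)) (star f') s t := by
  rw [hasDerivWithinAt_iff_tendsto_slope] at h ⊢
  refine ((continuous_star_L2.tendsto _).comp h).congr fun r => ?_
  rw [Function.comp_apply, slope_def_module, slope_def_module, ← star_sub_L2,
    show (r - t)⁻¹ • (f r - f t) = (((r - t)⁻¹ : ℝ) : ℂ) • (f r - f t) from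
      (Complex.coe_smul _ _).symm, star_smul_L2, Complex.star_def, Complex.conj_ofReal]
  exact Complex.coe_smul _ _

theorem HasDerivWithinAt.J_L2 {f : ℝ → L2 d} {f' : L2 d} {s : Set ℝ} {t : ℝ}
    (h : HasDerivWithinAt f f' s t) : HasDerivWithinAt (fun r => J d (f r)) (J d f') s t := by
  rw [hasDerivWithinAt_iff_tendsto_slope] at h ⊢
  refine (((J d).continuous.tendsto _).comp h).congr fun r => ?_
  rw [Function.comp_apply, slope_def_module, slope_def_module, ← map_sub,
    show (r - t)⁻¹ • (f r - f t) = (((r - t)⁻¹ : ℝ) : ℂ) • (f r - f t) from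
      (Complex.coe_smul _ _).symm, map_smul]
  exact Complex.coe_smul _ _

section

variable {V v : E d → ℝ} {c : NNReal}

theorem hLift_eq_add (hv : PotBound v c) (f : L2 d) {a : Op d} (ha : Nuc a) :
    hLift V v f a = hγOp V v (J d * a * J d) + J d * b v (J d * ketbra f f * J d) * J d := by
  rw [hLift_eq, hγOp, hγOp, hv.b_add ha (Nuc.ketbra f f), mul_add, add_mul, add_assoc]

/-- A variation of φ acts through h(γ^φ), but the subtracted self-interaction of the condensate
cancels b[|φ⟩⟨φ|]. Hence h(γ), not h(γ^φ), appears, as in the equation for φ. The symmetry of K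
makes the two rank-one variations of σ^φ contribute equally. -/
theorem re_deriv_φ (hV : Measurable V) (hVb : InfFormBounded V) (hv : PotBound v c)
    (f h : L2 d) {a x : Op d} (ha : Nuc a) (has : star a = a) (hx : HS x)
    (hxs : transp (J d * x) = J d * x) :
    trace (hLift V v f a * (ketbra h f + ketbra f h))
      - bForm v (ketbra f f) (ketbra h f + ketbra f h)
      + ((trace (kLift v f x *
          star (J d * (ketbra h (star (J d f)) + ketbra f (star (J d h)))))).re : ℂ) =
    ((2 * (⟪h, hγOp V v (J d * a * J d) f + J d (kLift v f x (star (J d f)))⟫).re : ℝ) : ℂ) := by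
  set G := hγOp V v (J d * a * J d) with hG
  have hGs : star G = G := star_hγOp hV hVb hv ha has
  set K := kLift v f x with hK
  have hKs : star (conj K) = K := by
    rw [← transp_eq]
    exact hv.transp_kLift f hx hxs
  have np : Nuc (ketbra h f + ketbra f h) := (Nuc.ketbra _ _).add (Nuc.ketbra _ _)
  have e1 : trace (hLift V v f a * (ketbra h f + ketbra f h)) =
      trace (G * (ketbra h f + ketbra f h)) + bForm v (ketbra f f) (ketbra h f + ketbra f h) := by
    rw [hLift_eq_add hv f ha, add_mul, trace_add (np.mul_left _) (np.mul_left _), bForm]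
    congr 1
    rw [mul_assoc, mul_assoc, ← trace_mul_comm_of_nuc ((np.mul_left _).mul_left _)]
    simp only [mul_assoc]
  have e2 : trace (G * (ketbra h f + ketbra f h)) = ((2 * (⟪h, G f⟫).re : ℝ) : ℂ) := by
    rw [mul_add, mul_ketbra, mul_ketbra, trace_add (Nuc.ketbra _ _) (Nuc.ketbra _ _),
      trace_ketbra, trace_ketbra]
    have : ⟪f, G h⟫ = starRingEnd ℂ ⟪h, G f⟫ := by rw [inner_conj_symm, ← inner_adj, hGs]
    rw [this, add_comm, Complex.add_conj]
  have e3 : trace (K * star (J d * (ketbra h (star (J d f)) + ketbra f (star (J d h))))) =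
      2 * ⟪h, J d (K (star (J d f)))⟫ := by
    rw [mul_add, mul_ketbra, mul_ketbra, star_add, star_ketbra, star_ketbra, mul_add, mul_ketbra,
      mul_ketbra, trace_add (Nuc.ketbra _ _) (Nuc.ketbra _ _), trace_ketbra, trace_ketbra]
    have : ⟪J d f, K (star (J d h))⟫ = ⟪J d h, K (star (J d f))⟫ := by
      conv_rhs => rw [← hKs, inner_adj']
      rw [conj_apply, inner_star_star]
    rw [this, ← J_inner, two_mul]
  have e4 : (2 * ⟪h, J d (K (star (J d f)))⟫).re = 2 * (⟪h, J d (K (star (J d f)))⟫).re := by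
    simp
  rw [e1, e2, e3, e4, inner_add_right, Complex.add_re]
  push_cast
  ring

/-- The derivative of the energy along a path. -/
theorem hasDerivWithinAt_energy (hV : Measurable V) (hVb : InfFormBounded V) (hv : PotBound v c)
    {f : ℝ → L2 d} {f' : L2 d} {a x : ℝ → Op d} {a' x' : Op d} {s : Set ℝ} {t : ℝ} (ht : t ∈ s)
    (hf : HasDerivWithinAt f f' s t) (ha : HasDerivN traceNorm a a' s t)
    (hx : HasDerivN hsNorm x x' s t) (has : star (a t) = a t)
    (hxs : transp (J d * x t) = J d * x t) :
    HasDerivWithinAt (fun r => energyForm V v (a r + ketbra (f r) (f r)) (ketbra (f r) (f r))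
        (x r + ketbra (f r) (star (J d (f r)))))
      (trace (hLift V v (f t) (a t) * a')
        + ((trace (kLift v (f t) (x t) * star (J d * x'))).re : ℂ)
        + ((2 * (⟪f', hγOp V v (J d * a t * J d) (f t)
          + J d (kLift v (f t) (x t) (star (J d (f t))))⟫).re : ℝ) : ℂ)) s t := by
  have hp := hasDerivN_ketbra hf hf
  have hy := (hasDerivN_ketbra hf (HasDerivWithinAt.star_L2 (HasDerivWithinAt.J_L2 hf))).mono
    hsNorm_le_traceNorm
  have hat : Nuc (a t) := ha.mem t ht
  have hxt : HS (x t) := hx.mem t ht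
  have ha' : Nuc a' := ha.mem_deriv
  have hx' : HS x' := hx.mem_deriv
  have h := hv.hasDerivWithinAt_energyForm (V := V) ht (ha.add traceNorm_add_le hp) hp
    (hx.add hsNorm_add_le hy)
  refine h.congr_deriv ?_
  rw [← re_deriv_φ hV hVb hv (f t) f' hat has hxt hxs, ← hLift_eq]
  have np : Nuc (ketbra f' (f t) + ketbra (f t) f') := (Nuc.ketbra _ _).add (Nuc.ketbra _ _)
  have nq : HS (ketbra f' (star (J d (f t))) + ketbra (f t) (star (J d f'))) :=
    ((Nuc.ketbra _ _).add (Nuc.ketbra _ _)).hs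
  have hyt : HS (x t + ketbra (f t) (star (J d (f t)))) := hxt.add (Nuc.ketbra _ _).hs
  rw [mul_add, trace_add (ha'.mul_left _) (np.mul_left _), hv.kForm_add_right hyt hx' nq, kForm,
    kForm, ← kLift_eq, Complex.add_re]
  push_cast
  ring

/-- The interaction part b is bounded on L², so it only increases the constant in front of ‖Jg‖². -/
theorem exists_hLift_lower (hV : Measurable V) (hVb : InfFormBounded V) (f : L2 d) (a : Op d) :
    ∃ c : ℝ, ∀ g : L2 d,
      (1 / 2) * ‖g‖ ^ 2 ≤ (⟪g, hLift V v f a g⟫).re + c * ‖J d g‖ ^ 2 := by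
  obtain ⟨c, hc⟩ := exists_hOp_lower hV hVb
  set B := b v (γφ (J d f) (J d * a * J d)) with hB
  refine ⟨c + ‖B‖, fun g => ?_⟩
  have e : ⟪g, hLift V v f a g⟫ = ⟪g, hOp V g⟫ + ⟪J d g, B (J d g)⟫ := by
    rw [hLift, hγOp, add_apply, inner_add_right, J_inner]
    rfl
  have h1 : -(‖B‖ * ‖J d g‖ ^ 2) ≤ (⟪J d g, B (J d g)⟫).re := by
    have h2 : ‖⟪J d g, B (J d g)⟫‖ ≤ ‖B‖ * ‖J d g‖ ^ 2 := by
      refine (norm_inner_le_norm _ _).trans ?_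
      calc _ ≤ ‖J d g‖ * (‖B‖ * ‖J d g‖) := by gcongr; exact B.le_opNorm _
        _ = _ := by ring
    exact (abs_le.1 ((Complex.abs_re_le_norm _).trans h2)).1
  rw [e, Complex.add_re]
  linarith [hc g]

/-- The three contributions are −2 Im Tr[(hσ)k*] from γ, +2 Im Tr[(hσ)k*] from σ, and 0 from φ. -/
theorem IsLift.hasDeriv_energy {T : ℝ} {f f' : ℝ → L2 d} {a x a' x' : ℝ → Op d}
    (h : IsLift V v T f a x f' a' x') (hV : Measurable V)
    (hVb : InfFormBounded V) (hv : PotBound v c) {t : ℝ} (ht : t ∈ Set.Ico 0 T) :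
    HasDerivWithinAt (fun s => energy V v (J d (f s), J d * a s * J d, J d * x s)) 0
      (Set.Ico 0 T) t := by
  have hd := hasDerivWithinAt_energy hV hVb hv ht (h.deriv_f t ht) (h.deriv_a t ht)
    (h.deriv_x t ht) (h.star_a t ht) (h.transp_x t ht)
  refine (hd.congr_of_mem (fun s hs => hv.energy_eq (f s) (h.nuc s hs) (h.hs s hs)) ht).congr_deriv
    ?_
  -- By the φ-equation this is the real part of i‖φ̇‖².
  have z : (⟪f' t, hγOp V v (J d * a t * J d) (f t)
      + J d (kLift v (f t) (x t) (star (J d (f t))))⟫).re = 0 := by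
    rw [← h.eqn_φ ht, inner_smul_right, ← J_inner, inner_self_eq_norm_sq_to_K]
    have : (RCLike.ofReal ‖J d (f' t)‖ : ℂ) ^ 2 = ((‖J d (f' t)‖ ^ 2 : ℝ) : ℂ) := by
      push_cast
      rfl
    rw [this, Complex.mul_re, Complex.ofReal_im]
    simp
  obtain ⟨c', hc⟩ := exists_hLift_lower (v := v) hV hVb (f t) (a t)
  have hHs := star_hLift hV hVb hv (f t) (h.nuc t ht) (h.star_a t ht)
  obtain ⟨R, hR⟩ := exists_isResolvent hHs hc
  have hK := hv.hs_kLift (f t) (h.hs t ht)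
  have hKs := hv.transp_kLift (f t) (h.hs t ht) (h.transp_x t ht)
  have e1 := h.eqn_γ hv ht
  have e2 := h.eqn_σ hV hVb hv ht
  have hKc := hv.star_kLift (f t) (h.hs t ht) (h.transp_x t ht)
  generalize hLift V v (f t) (a t) = H at *
  generalize kLift v (f t) (x t) = K at *
  have n1 : HS (K * J d * conj (a t) * J d) := ((hK.mul_right _).mul_right _).mul_right _
  have n2 : HS (J d * a t * J d * K) := hK.mul_left _
  have n3 : HS (Complex.I • (J d * x' t)) := ((h.hs' t ht).mul_left _).smul _
  have hxJ := transp_J_mul (h.transp_x t ht)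
  -- The σ-equation solved for hσ + σh̄: the remaining terms are Hilbert-Schmidt because σ̇ and k
  -- are.
  obtain ⟨Y, hY, hHx, hYZ⟩ := hR.exists_J_mul hHs hc (h.hs t ht) hxJ
    (n3.sub ((n1.add n2).add hK)) (by
      have : J d * (Complex.I • (J d * x' t)) * J d = Complex.I • (J d * (J d * x' t) * J d) := by
        rw [mul_smul_comm, smul_mul_assoc]
      rw [mul_sub, sub_mul, this, e2]
      simp only [mul_add, add_mul, mul_assoc]
      abel)
  have s1 : star (J d * x t) = J d * conj (x t) := by
    rw [← h.transp_x t ht, star_transp, conj_mul, conj_J]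
  have t1 := hR.trace_H_mul hHs (h.nuc t ht) (h.nuc' t ht) (h.hs t ht) hY hK hHx (by
    rw [e1, s1, hKc, ← hxJ]
    simp only [mul_sub, sub_mul, mul_assoc]
    abel)
  have t2 := re_trace_mul_star hK hKs (h.nuc t ht) (h.star_a t ht) (h.hs' t ht) hY (by
    rw [hYZ, sub_add_cancel])
  rw [t1, t2, z]
  push_cast
  ring

end

/-! ### Partial derivatives of the quasi-Hamiltonian -/

theorem HasFormDeriv.star_op {T : ℝ} {A : ℝ → Op d} {D : Op d} {t : ℝ}
    (h : HasFormDeriv T A D t) : HasFormDeriv T (fun s => star (A s)) (star D) t := by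
  intro f g
  have e := (h g f).star
  simp only [← starRingEnd_apply, inner_conj_symm] at e
  simpa only [inner_adj'] using e

section

variable {V v : E d → ℝ} {c : NNReal}

theorem hasGradKet_ham (hV : Measurable V) (hVb : InfFormBounded V) (hv : PotBound v c)
    {γ₀ u w a x : Op d} {f f' : L2 d} (hs : star γ₀ = γ₀) (ha : Nuc a) (has : star a = a)
    (hx : HS x) (hxs : transp (J d * x) = J d * x) (hg : gamOf γ₀ u w = J d * a * J d)
    (hσ : sigOf γ₀ u w = J d * x)
    (heq : J d f' = hγOp V v (J d * a * J d) f + J d (kLift v f x (star (J d f)))) :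
    HasGradKet (fun φ => ham V v γ₀ φ u w) (J d f) f' := by
  intro η hη
  obtain ⟨h, rfl⟩ := sobolevNorm_lt_top (j := 0) hη
  have e : (fun ε : ℝ => ham V v γ₀ (J d f + (ε : ℂ) • J d h) u w) = fun ε : ℝ =>
      energyForm V v (a + ketbra (f + (ε : ℂ) • h) (f + (ε : ℂ) • h))
        (ketbra (f + (ε : ℂ) • h) (f + (ε : ℂ) • h))
        (x + ketbra (f + (ε : ℂ) • h) (star (J d (f + (ε : ℂ) • h)))) := by
    funext ε
    rw [← hv.ham_eq (f + (ε : ℂ) • h) hs ha hg hσ, map_add, map_smul]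
  have hf : HasDerivWithinAt (fun ε : ℝ => f + (ε : ℂ) • h) h Set.univ 0 := by
    have := (Complex.ofRealCLM.hasDerivAt (x := (0 : ℝ))).smul_const h
    simpa using this
  have n0 : Nuc (0 : Op d) := by rw [Nuc, traceNorm_zero]; simp
  have da := hasDerivN_poly traceNorm_add_le traceNorm_smul_le ha n0 n0
  have dx := hasDerivN_poly hsNorm_add_le (fun z y => (hsNorm_smul z y).le) hx n0.hs n0.hs
  simp only [smul_zero, add_zero] at da dx
  have hd := hasDerivWithinAt_energy hV hVb hv (Set.mem_univ 0) hf da dx has hxs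
  rw [hasDerivWithinAt_univ, ← e] at hd
  refine hd.congr_deriv ?_
  simp only [Complex.ofReal_zero, zero_smul, add_zero, mul_zero, star_zero]
  rw [← heq, J_inner]
  simp [trace]

/-- Only the first-order coefficients enter the derivative; the quadratic ones need nothing but
finite norm. -/
theorem hasDerivAt_ham (hV : Measurable V) (hVb : InfFormBounded V) (hv : PotBound v c)
    {γ₀ a₀ a₁ a₂ x₀ x₁ x₂ : Op d} {f : L2 d} {u w : ℝ → Op d} (hs : star γ₀ = γ₀) (h0 : Nuc a₀)
    (h1 : Nuc a₁) (h2 : Nuc a₂) (k0 : HS x₀) (k1 : HS x₁) (k2 : HS x₂) (has : star a₀ = a₀)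
    (hxs : transp (J d * x₀) = J d * x₀)
    (hg : ∀ ε : ℝ, gamOf γ₀ (u ε) (w ε) =
      J d * (a₀ + (ε : ℂ) • a₁ + ((ε : ℂ) ^ 2) • a₂) * J d)
    (hσ : ∀ ε : ℝ, sigOf γ₀ (u ε) (w ε) = J d * (x₀ + (ε : ℂ) • x₁ + ((ε : ℂ) ^ 2) • x₂)) :
    HasDerivAt (fun ε => ham V v γ₀ (J d f) (u ε) (w ε))
      (trace (hLift V v f a₀ * a₁) + ((trace (kLift v f x₀ * star (J d * x₁))).re : ℂ)) 0 := by
  have da := hasDerivN_poly traceNorm_add_le traceNorm_smul_le h0 h1 h2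
  have dx := hasDerivN_poly hsNorm_add_le (fun z y => (hsNorm_smul z y).le) k0 k1 k2
  have hd := hasDerivWithinAt_energy (V := V) hV hVb hv (Set.mem_univ 0)
    (hasDerivWithinAt_const 0 Set.univ f) da dx (by simpa using has) (by simpa using hxs)
  rw [hasDerivWithinAt_univ] at hd
  refine (hd.congr_of_eventuallyEq (Eventually.of_forall fun ε =>
    hv.ham_eq f hs (da.mem ε (Set.mem_univ ε)) (hg ε) (hσ ε))).congr_deriv ?_
  simp

end

theorem add_trace_eq_two_re {A B : Op d} (h : star A = B) :
    trace A + trace B = ((2 * (trace A).re : ℝ) : ℂ) := by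
  rw [← h, trace_star, ← starRingEnd_apply, Complex.add_conj]

theorem re_trace_star (A : Op d) : (trace A).re = (trace (star A)).re := by
  rw [trace_star]
  rfl

/-- Transposition turns the term with 1 + γ̄ into a copy of the first one plus a remainder from the
1. That copy doubles the γ-term and the remainder does not, which is the origin of the ½ in the
terms ½v k̄ and ½u k of the gradients. -/
theorem trace_mul_star_pairing {K X Y γ : Op d} (hK : HS K) (hKs : transp K = K)
    (hγs : star γ = γ) (hY : HS Y) :
    trace (K * star (star X * γ * Y + transp Y * (1 + conj γ) * conj X)) =
      2 * trace (star Y * γ * X * K) + trace (star Y * X * K) := by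
  have n1 : HS (star Y * γ * X) := (hY.star.mul_right _).mul_right _
  have n2 : HS (transp X * (1 + conj γ) * conj Y) := hY.conj.mul_left _
  have n3 : HS (star Y * X) := hY.star.mul_right _
  have s1 : star (star X * γ * Y + transp Y * (1 + conj γ) * conj X) =
      star Y * γ * X + transp X * (1 + conj γ) * conj Y := by
    simp only [star_add, star_mul, star_star, hγs, star_one, star_conj, transp, mul_assoc]
  have s2 : transp (K * (transp X * (1 + conj γ) * conj Y)) = star Y * γ * X * K + star Y * X * K := by
    have e1 : transp (1 + conj γ) = 1 + γ := by
      rw [transp_eq, conj_add, conj_conj, conj_one, star_add, star_one, hγs]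
    have e2 : transp (transp X) = X := by rw [transp_eq, conj_transp, star_star]
    rw [transp_mul, transp_mul, transp_mul, transp_conj, hKs, e1, e2]
    simp only [mul_add, add_mul, one_mul, mul_assoc]
    abel
  rw [s1, mul_add, trace_add (hK.mul n1) (hK.mul n2), trace_mul_comm_of_hs hK n1,
    ← trace_transp (hK.mul n2), s2, trace_add (n1.mul hK) (n3.mul hK)]
  ring

/-- The trace identity behind the derivative in `u`. -/
theorem trace_direction_u {H K A g w W D Dl : Op d} (hH : star H = H) (hK : HS K)
    (hKs : transp K = K) (hg : Nuc g) (hgs : star g = g) (hw : HS w) (hW : HS W)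
    (hwW : w = J d * W) (hD : star Dl * J d = J d * D) :
    trace (H * (D * g * star A + A * g * star D)) + ((trace (K * star (star Dl * (J d * g * J d) * w
      + transp w * (1 + conj (J d * g * J d)) * conj Dl))).re : ℂ) =
    ((2 * (trace (D * g * (star A * H + J d * w * conj K * J d)
      + (1 / 2 : ℂ) • (D * W * conj K * J d))).re : ℝ) : ℂ) := by
  have hKb : star (conj K) = K := by rw [← transp_eq, hKs]
  have hKc : star K = conj K := by rw [← star_transp, hKs]
  have hγs : star (J d * g * J d) = J d * g * J d := by rw [star_weight, hgs]
  have n1 : Nuc (D * g * star A) := (hg.mul_left _).mul_right _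
  have n2 : Nuc (A * g * star D) := (hg.mul_left _).mul_right _
  have e1 : trace (H * (D * g * star A + A * g * star D)) =
      ((2 * (trace (D * g * star A * H)).re : ℝ) : ℂ) := by
    rw [mul_add, trace_add (n1.mul_left _) (n2.mul_left _), ← trace_mul_comm_of_nuc n1,
      add_trace_eq_two_re]
    simp only [star_mul, star_star, hgs, hH, mul_assoc]
  have m1 : Nuc (D * g * (J d * w * conj K * J d)) := (hg.mul_left _).mul_right _
  have m2 : Nuc (D * W * conj K * J d) := ((hW.mul_left _).mul hK.conj).mul_right _
  have e2 : (trace (star w * (J d * g * J d) * Dl * K)).re =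
      (trace (D * g * (J d * w * conj K * J d))).re := by
    have n3 : Nuc (D * g * J d * w) := ((hg.mul_left _).mul_right _).mul_right _
    have e : star (star w * (J d * g * J d) * Dl * K) = conj K * J d * (D * g * J d * w) := by
      rw [star_mul, star_mul, star_mul, hKc, hγs, star_star]
      rw [mul_assoc (J d) g, mul_assoc (J d), ← mul_assoc (star Dl) (J d), hD]
      simp only [mul_assoc]
    rw [re_trace_star, e, ← trace_mul_comm_of_nuc n3]
    simp only [mul_assoc]
  have e3 : (trace (star w * Dl * K)).re = (trace (D * W * conj K * J d)).re := by
    have e : star (star w * Dl * K) = conj K * J d * (D * W) := by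
      rw [star_mul, star_mul, hKc, star_star, hwW, ← mul_assoc (star Dl), hD]
      simp only [mul_assoc]
    rw [re_trace_star, e, trace_mul_comm_of_hs (hK.conj.mul_right _) (hW.mul_left _)]
    simp only [mul_assoc]
  rw [e1, trace_mul_star_pairing hK hKs hγs hw, mul_add, ← mul_assoc (D * g),
    trace_add ((n1.mul_right H).add m1) (m2.smul _), trace_add (n1.mul_right H) m1, trace_smul]
  simp only [Complex.add_re]
  rw [show (2 * trace (star w * (J d * g * J d) * Dl * K)).re =
    2 * (trace (star w * (J d * g * J d) * Dl * K)).re by simp, e2, e3,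
    show ((1 / 2 : ℂ) * trace (D * W * conj K * J d)).re =
    1 / 2 * (trace (D * W * conj K * J d)).re by simp]
  push_cast
  ring

/-- The trace identity behind the derivative in `w`. -/
theorem trace_direction_w {H K A g B D u : Op d} (hH : star H = H) (hK : HS K)
    (hKs : transp K = K) (hg : Nuc g) (hgs : star g = g) (hB : HS B) (hD : HS D)
    (hA : star u * J d = J d * A) :
    trace (H * (transp D * (1 + conj (J d * g * J d)) * conj B
        + transp B * (1 + conj (J d * g * J d)) * conj D))
      + ((trace (K * star (star u * (J d * g * J d) * (D * J d)
        + transp (D * J d) * (1 + conj (J d * g * J d)) * conj u))).re : ℂ) =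
    ((2 * (trace (star D * (J d * g * (star A * J d * K * J d + J d * B * conj H) + B * conj H
      + (1 / 2 : ℂ) • (u * K * J d)))).re : ℝ) : ℂ) := by
  have hγs : star (J d * g * J d) = J d * g * J d := by rw [star_weight, hgs]
  have hJu : J d * u = star A * J d := by
    rw [← star_inj, star_mul, star_J, hA, star_mul, star_J, star_star]
  set γ := J d * g * J d with hγ
  have n1 : Nuc (transp D * (1 + conj γ) * conj B) := (hD.transp.mul_right _).mul hB.conj
  have n2 : Nuc (transp B * (1 + conj γ) * conj D) := (hB.transp.mul_right _).mul hD.conj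
  have m1 : Nuc (star D * (1 + γ) * B * conj H) := ((hD.star.mul_right _).mul hB).mul_right _
  have hHt : transp H = conj H := by rw [transp, hH]
  have e1 : trace (H * (transp D * (1 + conj γ) * conj B + transp B * (1 + conj γ) * conj D)) =
      ((2 * (trace (star D * (1 + γ) * B * conj H)).re : ℝ) : ℂ) := by
    have s1 : transp (H * (transp B * (1 + conj γ) * conj D)) =
        star D * (1 + γ) * B * conj H := by
      rw [transp_mul, transp_mul, transp_mul, transp_conj, hHt]
      rw [show transp (1 + conj γ) = 1 + γ by
        rw [transp_eq, conj_add, conj_conj, conj_one, star_add, star_one, hγs],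
        show transp (transp B) = B by rw [transp_eq, conj_transp, star_star]]
      simp only [mul_assoc]
    have s2 : star (H * (transp B * (1 + conj γ) * conj D)) =
        transp D * (1 + conj γ) * conj B * H := by
      rw [star_mul, star_mul, star_mul, star_transp, star_add, star_one, star_conj, star_conj, hγs,
        hH, transp]
      simp only [mul_assoc]
    rw [mul_add, trace_add (n1.mul_left _) (n2.mul_left _), ← trace_mul_comm_of_nuc n1, ← s2,
      add_comm, add_trace_eq_two_re rfl, ← s1, trace_transp (n2.mul_left _)]
  have hDJ : star (D * J d) = J d * star D := by rw [star_mul, star_J]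
  have m2 : Nuc (star D * (J d * g * (star A * J d * K * J d))) :=
    ((hg.mul_left _).mul_right _).mul_left _
  have m3 : Nuc (star D * u * K * J d) := ((hD.star.mul_right _).mul hK).mul_right _
  have e2 : trace (star (D * J d) * γ * u * K) =
      trace (star D * (J d * g * (star A * J d * K * J d))) := by
    have n3 : Nuc (star D * (J d * g * (star A * J d * K))) :=
      ((hg.mul_left _).mul_right _).mul_left _
    have e : star (D * J d) * γ * u * K = J d * (star D * (J d * g * (star A * J d * K))) := by
      rw [← hJu, hDJ]
      simp only [hγ, mul_assoc]
    rw [e, ← trace_mul_comm_of_nuc n3]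
    simp only [mul_assoc]
  have e3 : trace (star (D * J d) * u * K) = trace (star D * u * K * J d) := by
    rw [hDJ, mul_assoc, mul_assoc,
      ← trace_mul_comm_of_nuc (hD.star.mul (hK.mul_left u))]
    simp only [mul_assoc]
  have e4 : star D * (J d * g * (star A * J d * K * J d + J d * B * conj H) + B * conj H
      + (1 / 2 : ℂ) • (u * K * J d)) = star D * (1 + γ) * B * conj H
      + star D * (J d * g * (star A * J d * K * J d)) + (1 / 2 : ℂ) • (star D * u * K * J d) := by
    simp only [hγ, mul_add, add_mul, mul_one, mul_smul_comm, mul_assoc]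
    abel
  rw [e1, trace_mul_star_pairing hK hKs hγs (hD.mul_right _), e2, e3, e4,
    trace_add (m1.add m2) (m3.smul _), trace_add m1 m2, trace_smul]
  simp only [Complex.add_re]
  rw [show ∀ z : ℂ, (2 * z).re = 2 * z.re by simp, show ∀ z : ℂ, (1 / 2 * z).re = 1 / 2 * z.re by simp]
  push_cast
  ring

section

variable {V v : E d → ℝ} {c : NNReal}

/-- Because (u + εδ)* preserves H¹ and wᵀ = JBᵀ, the weights can be pulled out of γ_{u+εδ,w}
(quadratic in ε) and σ_{u+εδ,w} (affine). The factorization w = JW is needed for δ*w = J(DW), which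
exhibits the last gradient term as trace class on H¹. -/
theorem hasGradAdj_u (hV : Measurable V) (hVb : InfFormBounded V) (hv : PotBound v c)
    {g u w a x A B W : Op d} {f : L2 d} (hg : Nuc g) (hgs : star g = g) (ha : Nuc a)
    (has : star a = a) (hx : HS x) (hxs : transp (J d * x) = J d * x)
    (hγ : gamOf (J d * g * J d) u w = J d * a * J d) (hσ : sigOf (J d * g * J d) u w = J d * x)
    (hA : star u * J d = J d * A) (hB : HS B) (hwB : w = B * J d) (hW : HS W)
    (hwW : w = J d * W) :
    HasGradAdj AdmU (fun u' => ham V v (J d * g * J d) (J d f) u' w) u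
      (J d * g * (star A * hLift V v f a + J d * w * conj (kLift v f x) * J d)
        + (1 / 2 : ℂ) • (w * conj (kLift v f x) * J d)) := by
  rintro δ ⟨D, hD⟩
  have hH := star_hLift hV hVb hv f ha has
  have hK := hv.hs_kLift f hx
  have hKs := hv.transp_kLift f hx hxs
  have hγs : star (J d * g * J d) = J d * g * J d := by rw [star_weight, hgs]
  have hw : HS w := hwB ▸ hB.mul_right _
  have hJu : J d * u = star A * J d := by
    rw [← star_inj, star_mul, star_J, hA, star_mul, star_J, star_star]
  have hJδ : J d * δ = star D * J d := by
    rw [← star_inj, star_mul, star_J, hD, star_mul, star_J, star_star]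
  have hwt : transp w = J d * transp B := by rw [hwB, transp_mul, transp_J]
  have hwc : conj w = conj B * J d := by rw [hwB, conj_mul, conj_J]
  have n0 : Nuc (A * g * star A + transp B * (1 + conj (J d * g * J d)) * conj B) :=
    ((hg.mul_left _).mul_right _).add ((hB.transp.mul_right _).mul hB.conj)
  have n1 : Nuc (D * g * star A + A * g * star D) :=
    ((hg.mul_left _).mul_right _).add ((hg.mul_left _).mul_right _)
  have n2 : Nuc (D * g * star D) := (hg.mul_left _).mul_right _
  have k0 : HS (A * g * (J d * w) + transp B * (1 + conj (J d * g * J d)) * conj u) :=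
    ((hg.mul_left _).mul_right _).hs.add ((hB.transp.mul_right _).mul_right _)
  have k1 : HS (D * g * (J d * w) + transp B * (1 + conj (J d * g * J d)) * conj δ) :=
    ((hg.mul_left _).mul_right _).hs.add ((hB.transp.mul_right _).mul_right _)
  have eγ : ∀ ε : ℝ, gamOf (J d * g * J d) (u + (ε : ℂ) • δ) w =
      J d * (A * g * star A + transp B * (1 + conj (J d * g * J d)) * conj B
        + (ε : ℂ) • (D * g * star A + A * g * star D) + ((ε : ℂ) ^ 2) • (D * g * star D)) * J d := by
    intro ε
    have e1 : star (u + (ε : ℂ) • δ) * J d = J d * (A + (ε : ℂ) • D) := by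
      rw [star_add, star_smul, Complex.star_def, Complex.conj_ofReal, add_mul, smul_mul_assoc, hA,
        hD, mul_add, mul_smul_comm]
    have e2 : J d * (u + (ε : ℂ) • δ) = (star A + (ε : ℂ) • star D) * J d := by
      rw [mul_add, mul_smul_comm, hJu, hJδ, add_mul, smul_mul_assoc]
    have e3 : star (u + (ε : ℂ) • δ) * (J d * g * J d) * (u + (ε : ℂ) • δ) =
        J d * ((A + (ε : ℂ) • D) * g * (star A + (ε : ℂ) • star D)) * J d := by
      calc _ = (star (u + (ε : ℂ) • δ) * J d) * g * (J d * (u + (ε : ℂ) • δ)) := by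
            simp only [mul_assoc]
        _ = _ := by rw [e1, e2]; simp only [mul_assoc]
    rw [gamOf, e3, hwt, hwc]
    simp only [mul_add, add_mul, mul_smul_comm, smul_mul_assoc, smul_add, smul_smul, pow_two,
      mul_assoc]
    abel
  have eσ : ∀ ε : ℝ, sigOf (J d * g * J d) (u + (ε : ℂ) • δ) w =
      J d * (A * g * (J d * w) + transp B * (1 + conj (J d * g * J d)) * conj u
        + (ε : ℂ) • (D * g * (J d * w) + transp B * (1 + conj (J d * g * J d)) * conj δ)
        + ((ε : ℂ) ^ 2) • (0 : Op d)) := by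
    intro ε
    have e1 : star (u + (ε : ℂ) • δ) * J d = J d * (A + (ε : ℂ) • D) := by
      rw [star_add, star_smul, Complex.star_def, Complex.conj_ofReal, add_mul, smul_mul_assoc, hA,
        hD, mul_add, mul_smul_comm]
    have e3 : star (u + (ε : ℂ) • δ) * (J d * g * J d) * w =
        J d * ((A + (ε : ℂ) • D) * g * (J d * w)) := by
      rw [← mul_assoc, ← mul_assoc, e1]
      simp only [mul_assoc]
    rw [sigOf, e3, hwt, conj_add, conj_smul, Complex.star_def, Complex.conj_ofReal]
    simp only [mul_add, add_mul, mul_smul_comm, smul_mul_assoc, smul_add, mul_assoc, smul_zero,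
      add_zero]
    abel
  -- At ε = 0 the polynomial must reproduce γ, and the weights cancel.
  have ea : A * g * star A + transp B * (1 + conj (J d * g * J d)) * conj B = a := by
    refine J_mul_cancel (mul_J_cancel ?_)
    have := eγ 0
    simpa [hγ] using this.symm
  have ex : A * g * (J d * w) + transp B * (1 + conj (J d * g * J d)) * conj u = x := by
    refine J_mul_cancel ?_
    have := eσ 0
    simpa [hσ] using this.symm
  have hd := hasDerivAt_ham (V := V) (f := f) hV hVb hv hγs n0 n1 n2 k0 k1 HS.zero (by rw [ea, has])
    (by rw [ex, hxs]) eγ eσ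
  rw [ea, ex] at hd
  have e1 : J d * (D * g * (J d * w) + transp B * (1 + conj (J d * g * J d)) * conj δ) =
      star δ * (J d * g * J d) * w + transp w * (1 + conj (J d * g * J d)) * conj δ := by
    rw [mul_add, hwt, ← mul_assoc (star δ), ← mul_assoc (star δ), hD]
    simp only [mul_assoc]
  rw [e1, trace_direction_u hH hK hKs hg hgs hw hW hwW hD] at hd
  refine ⟨_, ?_, ?_, hd⟩
  · exact Nuc.add ((hg.mul_left _).mul_right _)
      (Nuc.smul _ (((hW.mul_left _).mul hK.conj).mul_right _))
  · rw [mul_add (star δ), mul_smul_comm, mul_add (J d) (D * g * _), mul_smul_comm]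
    congr 1
    · rw [mul_assoc (J d), ← mul_assoc, hD]
      simp only [mul_assoc]
    · rw [hwW, mul_assoc (J d), mul_assoc (J d), ← mul_assoc, hD]
      simp only [mul_assoc]

/-- Here the direction carries its own weight, δ = DJ with D Hilbert-Schmidt, so δ* = JD* and the
trace class property follows from a Hilbert-Schmidt bound on the gradient alone. -/
theorem hasGradAdj_w (hV : Measurable V) (hVb : InfFormBounded V) (hv : PotBound v c)
    {g u w a x A B : Op d} {f : L2 d} (hg : Nuc g) (hgs : star g = g) (ha : Nuc a)
    (has : star a = a) (hx : HS x) (hxs : transp (J d * x) = J d * x)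
    (hγ : gamOf (J d * g * J d) u w = J d * a * J d) (hσ : sigOf (J d * g * J d) u w = J d * x)
    (hA : star u * J d = J d * A) (hB : HS B) (hwB : w = B * J d) :
    HasGradAdj AdmW (fun w' => ham V v (J d * g * J d) (J d f) u w') w
      (J d * g * (star A * J d * kLift v f x * J d + J d * B * conj (hLift V v f a))
        + B * conj (hLift V v f a) + (1 / 2 : ℂ) • (u * kLift v f x * J d)) := by
  rintro δ ⟨D, hD, rfl⟩
  change HS D at hD
  have hH := star_hLift hV hVb hv f ha has
  have hK := hv.hs_kLift f hx
  have hKs := hv.transp_kLift f hx hxs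
  have hγs : star (J d * g * J d) = J d * g * J d := by rw [star_weight, hgs]
  have hJu : J d * u = star A * J d := by
    rw [← star_inj, star_mul, star_J, hA, star_mul, star_J, star_star]
  have hu : star u * (J d * g * J d) = J d * (A * g * J d) := by
    rw [← mul_assoc, ← mul_assoc, hA]
    simp only [mul_assoc]
  have n0 : Nuc (A * g * star A + transp B * (1 + conj (J d * g * J d)) * conj B) :=
    ((hg.mul_left _).mul_right _).add ((hB.transp.mul_right _).mul hB.conj)
  have n1 : Nuc (transp D * (1 + conj (J d * g * J d)) * conj B
      + transp B * (1 + conj (J d * g * J d)) * conj D) :=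
    ((hD.transp.mul_right _).mul hB.conj).add ((hB.transp.mul_right _).mul hD.conj)
  have n2 : Nuc (transp D * (1 + conj (J d * g * J d)) * conj D) :=
    (hD.transp.mul_right _).mul hD.conj
  have k0 : HS (A * g * J d * w + transp B * (1 + conj (J d * g * J d)) * conj u) :=
    (((hg.mul_left _).mul_right _).mul_right _).hs.add ((hB.transp.mul_right _).mul_right _)
  have k1 : HS (A * g * J d * (D * J d) + transp D * (1 + conj (J d * g * J d)) * conj u) :=
    (((hg.mul_left _).mul_right _).mul_right _).hs.add ((hD.transp.mul_right _).mul_right _)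
  have et : ∀ ε : ℝ, transp (w + (ε : ℂ) • (D * J d)) =
      J d * (transp B + (ε : ℂ) • transp D) := by
    intro ε
    rw [hwB, transp_add, transp_smul, transp_mul, transp_mul, transp_J, mul_add, mul_smul_comm]
  have ec : ∀ ε : ℝ, conj (w + (ε : ℂ) • (D * J d)) = (conj B + (ε : ℂ) • conj D) * J d := by
    intro ε
    rw [hwB, conj_add, conj_smul, conj_mul, conj_mul, conj_J, Complex.star_def,
      Complex.conj_ofReal, add_mul, smul_mul_assoc]
  have eγ : ∀ ε : ℝ, gamOf (J d * g * J d) u (w + (ε : ℂ) • (D * J d)) =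
      J d * (A * g * star A + transp B * (1 + conj (J d * g * J d)) * conj B
        + (ε : ℂ) • (transp D * (1 + conj (J d * g * J d)) * conj B
          + transp B * (1 + conj (J d * g * J d)) * conj D)
        + ((ε : ℂ) ^ 2) • (transp D * (1 + conj (J d * g * J d)) * conj D)) * J d := by
    intro ε
    have e3 : star u * (J d * g * J d) * u = J d * (A * g * star A) * J d := by
      rw [hu, mul_assoc, mul_assoc, hJu]
      simp only [mul_assoc]
    rw [gamOf, e3, et, ec]
    generalize 1 + conj (J d * g * J d) = Z
    simp only [mul_add, add_mul, mul_smul_comm, smul_mul_assoc, smul_add, smul_smul, pow_two,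
      mul_assoc]
    abel
  have eσ : ∀ ε : ℝ, sigOf (J d * g * J d) u (w + (ε : ℂ) • (D * J d)) =
      J d * (A * g * J d * w + transp B * (1 + conj (J d * g * J d)) * conj u
        + (ε : ℂ) • (A * g * J d * (D * J d) + transp D * (1 + conj (J d * g * J d)) * conj u)
        + ((ε : ℂ) ^ 2) • (0 : Op d)) := by
    intro ε
    rw [sigOf, hu, et]
    generalize 1 + conj (J d * g * J d) = Z
    simp only [mul_add, add_mul, mul_smul_comm, smul_mul_assoc, smul_add, mul_assoc, smul_zero,
      add_zero]
    abel
  have ea : A * g * star A + transp B * (1 + conj (J d * g * J d)) * conj B = a := by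
    refine J_mul_cancel (mul_J_cancel ?_)
    have := eγ 0
    simpa [hγ] using this.symm
  have ex : A * g * J d * w + transp B * (1 + conj (J d * g * J d)) * conj u = x := by
    refine J_mul_cancel ?_
    have := eσ 0
    simpa [hσ] using this.symm
  have hd := hasDerivAt_ham (V := V) (f := f) hV hVb hv hγs n0 n1 n2 k0 k1 HS.zero (by rw [ea, has])
    (by rw [ex, hxs]) eγ eσ
  rw [ea, ex] at hd
  have e1 : J d * (A * g * J d * (D * J d) + transp D * (1 + conj (J d * g * J d)) * conj u) =
      star u * (J d * g * J d) * (D * J d)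
        + transp (D * J d) * (1 + conj (J d * g * J d)) * conj u := by
    rw [mul_add, hu, transp_mul, transp_J]
    simp only [mul_assoc]
  rw [e1, trace_direction_w hH hK hKs hg hgs hB hD hA] at hd
  refine ⟨_, ?_, ?_, hd⟩
  · have m : HS (J d * g * (star A * J d * kLift v f x * J d + J d * B * conj (hLift V v f a))
        + B * conj (hLift V v f a) + (1 / 2 : ℂ) • (u * kLift v f x * J d)) :=
      (((hg.mul_left _).mul_right _).hs.add (hB.mul_right _)).add
        (((hK.mul_left _).mul_right _).smul _)
    exact hD.star.mul m
  · rw [star_mul, star_J, mul_assoc]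

/-- The time derivatives of `u` and `w`. -/
theorem IsDiagonalizingFamily.hasFormDeriv {T : ℝ} {ρ : ℝ → State d} {γ₀ : Op d} {u w : ℝ → Op d}
    (hU : IsDiagonalizingFamily V v T ρ γ₀ u w) {t : ℝ} (ht : t ∈ Set.Ico 0 T) {f : L2 d}
    {a x A B : Op d} (hρ : ρ t = (J d f, J d * a * J d, J d * x))
    (hH : star (hLift V v f a) = hLift V v f a)
    (hK : star (kLift v f x) = conj (kLift v f x))
    (hA : star (u t) * J d = J d * A) (hB : w t = B * J d) :
    HasFormDeriv T u (Complex.I • (star A * hLift V v f a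
        + J d * B * J d * conj (kLift v f x) * J d)) t ∧
      HasFormDeriv T w (-(Complex.I • (star A * J d * kLift v f x * J d
        + J d * B * conj (hLift V v f a)))) t := by
  -- The first column of 𝒰* consists of u* and v*; the adjoints of their equations give the
  -- derivatives of u and v, with a sign from 𝒮 in the second row.
  have h0 := (hU.evol t ht 0 0).star_op
  have h1 := (hU.evol t ht 1 0).star_op
  have c0 : conjWeight (blockU (u t) (w t)) 0 0 = A := by
    simp only [conjWeight, Matrix.conjTranspose_apply, blockU, Matrix.of_apply,
      Matrix.cons_val_zero, Matrix.cons_val', Matrix.cons_val_fin_one, hA, weight_one_zero]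
  have c1 : conjWeight (blockU (u t) (w t)) 1 0 = star B * J d := by
    simp only [conjWeight, Matrix.conjTranspose_apply, blockU, Matrix.of_apply,
      Matrix.cons_val_zero, Matrix.cons_val_one, Matrix.cons_val', Matrix.cons_val_fin_one, hB,
      star_mul, star_J, mul_assoc, weight_one_zero]
  have hKc : star (conj (kLift v f x)) = kLift v f x := by rw [star_conj, hK, conj_conj]
  have hHc : star (conj (hLift V v f a)) = conj (hLift V v f a) := by rw [star_conj, hH]
  rw [hρ, lamOp_eq] at h0 h1
  simp only [Matrix.mul_apply, Fin.sum_univ_two, S, Matrix.conjTranspose_apply,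
    blockU, Matrix.of_apply, Matrix.cons_val_zero, Matrix.cons_val_one, Matrix.cons_val',
    Matrix.cons_val_fin_one, star_star, one_mul, zero_mul, add_zero, zero_add] at h0 h1
  simp only [blockU] at c0 c1
  rw [c0, c1] at h0 h1
  simp only [star_smul, star_neg, star_add, star_mul, star_star, hH, hK, hKc, hHc, star_J,
    Complex.star_def, Complex.conj_I, neg_neg, neg_mul, one_mul] at h0 h1
  constructor
  · convert h0 using 1
    simp only [mul_assoc]
  · convert h1 using 1
    simp only [mul_assoc, smul_add, smul_neg]
    abel

end

end

end HFB

/-! ### The proposition -/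

theorem mainTheorem11 (d : ℕ) (V v : HFB.E d → ℝ)
    (hV : Measurable V) (hVb : HFB.InfFormBounded V)
    (hv : Measurable v) (hv_even : ∀ x, v (-x) = v x) (hvb : HFB.SqLeM v)
    (T : ℝ) (hT : 0 < T) (ρ ρ' : ℝ → HFB.State d)
    (hρ : HFB.IsClassicalSolution V v T ρ ρ')
    (γ₀ : HFB.Op d) (hγ₀ : γ₀.IsPositive) (hγ₀' : HFB.calHNorm 1 γ₀ < ⊤)
    (u w : ℝ → HFB.Op d) (hU : HFB.IsDiagonalizingFamily V v T ρ γ₀ u w) :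
    (∀ t ∈ Set.Ico 0 T,
      HFB.AdmU (u t) ∧ HFB.AdmW (w t) ∧
      HFB.energy V v (ρ t) = HFB.ham V v γ₀ (ρ t).1 (u t) (w t) ∧
      HFB.HasGradKet (fun φ => HFB.ham V v γ₀ φ (u t) (w t)) (ρ t).1
        (Complex.I • (ρ' t).1) ∧
      ∃ Du Dw : HFB.Op d,
        HFB.HasFormDeriv T u Du t ∧ HFB.HasFormDeriv T w Dw t ∧
        HFB.HasGradAdj HFB.AdmU (fun u' => HFB.ham V v γ₀ (ρ t).1 u' (w t)) (u t)
          (-(Complex.I • (HFB.weight 0 1 γ₀ * Du))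
            + (1 / 2 : ℂ) • (w t * HFB.conj (HFB.k v (HFB.σφ (ρ t).1 (ρ t).2.2)) * HFB.J d)) ∧
        HFB.HasGradAdj HFB.AdmW (fun w' => HFB.ham V v γ₀ (ρ t).1 (u t) w') (w t)
          (Complex.I • (HFB.weight 0 1 γ₀ * Dw)
            + HFB.weight 0 1 (w t) * HFB.conj (HFB.hγOp V v (HFB.γφ (ρ t).1 (ρ t).2.1))
            + (1 / 2 : ℂ) • (u t * HFB.k v (HFB.σφ (ρ t).1 (ρ t).2.2) * HFB.J d))) ∧
    ∀ t ∈ Set.Ico 0 T, HFB.energy V v (ρ t) = HFB.energy V v (ρ 0) := by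
  obtain ⟨c, hc⟩ := HFB.exists_potBound hv hv_even hvb
  obtain ⟨f, a, x, f', a', x', hL, hρL⟩ := hρ.exists_lift
  obtain ⟨g, hg, rfl⟩ := HFB.calHNorm_lt_top (j := 0) hγ₀'
  have hγs : star (HFB.J d * g * HFB.J d) = HFB.J d * g * HFB.J d := hγ₀.isSelfAdjoint
  have hgs : star g = g := HFB.J_mul_cancel (HFB.mul_J_cancel ((HFB.star_weight g).symm.trans hγs))
  refine ⟨fun t ht => ?_, fun t ht => ?_⟩
  · obtain ⟨e1, e2⟩ := hL.gamOf_sigOf hV hVb hc (fun s hs => (hρL s hs).1) hU ht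
    obtain ⟨A, hA⟩ := (hU.mem_adjoint t ht).1
    obtain ⟨B, hB, hwB⟩ := HFB.exists_hs_mul_J hγ₀ (hL.nuc t ht) e1
    -- The second factorization of v is not part of admissibility; it enters only the gradient in u.
    obtain ⟨W, hW, hwW⟩ := HFB.exists_hs_J_mul (hU.symplecto t ht) (hU.mem t ht) hB hwB
    have ha := hL.nuc t ht
    have has := hL.star_a t ht
    have hx := hL.hs t ht
    have hxs := hL.transp_x t ht
    obtain ⟨du, dw⟩ := hU.hasFormDeriv ht (hρL t ht).1 (HFB.star_hLift hV hVb hc (f t) ha has)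
      (hc.star_kLift (f t) hx hxs) hA hwB
    have gu := HFB.hasGradAdj_u hV hVb hc (f := f t) hg hgs ha has hx hxs e1 e2 hA hB hwB hW hwW
    have gw := HFB.hasGradAdj_w hV hVb hc (f := f t) hg hgs ha has hx hxs e1 e2 hA hB hwB
    have hJB : HFB.J d * w t = HFB.J d * B * HFB.J d := by rw [hwB, mul_assoc]
    have hw0 : HFB.weight 0 1 (w t) = B := by rw [hwB, HFB.weight_zero_one]
    rw [(hρL t ht).1, (hρL t ht).2]
    refine ⟨⟨A, hA⟩, ⟨B, hB, hwB⟩, ?_, ?_, _, _, du, dw, ?_, ?_⟩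
    · rw [hc.energy_eq (f t) ha hx, hc.ham_eq (f t) hγs ha e1 e2]
    · refine HFB.hasGradKet_ham hV hVb hc hγs ha has hx hxs e1 e2 ?_
      rw [map_smul]
      exact hL.eqn_φ ht
    -- The form derivative of u carries a factor i, so −i·i = 1 matches the two expressions; in the
    -- next case the derivative of v has the opposite sign, as has its prefactor.
    · convert gu using 2
      · rw [HFB.weight_zero_one, mul_smul_comm, smul_smul, Complex.I_mul_I, neg_one_smul, neg_neg,
          hJB]
      · rfl
    · rw [hw0]
      convert gw using 3
      · rw [HFB.weight_zero_one, mul_neg, mul_smul_comm, smul_neg, smul_smul, Complex.I_mul_I,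
          neg_one_smul, neg_neg]
      · rfl
      · rfl
  · have h0 : (0 : ℝ) ∈ Set.Ico 0 T := ⟨le_rfl, hT⟩
    rw [(hρL t ht).1, (hρL 0 h0).1]
    exact HFB.eq_of_hasDerivWithinAt_zero (fun s hs => hL.hasDeriv_energy hV hVb hc hs) ht
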